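/- **Setting.** Let $1\to U(1)\to\widehat G\xrightarrow{q}G\to 1$ be a central extension of diffeological groups ($U(1)\to\widehat G$ an induction, $q$ a subduction), let $\sigma:\mathbb Z_2\to\mathrm{Aut}(G)$ be an action by smooth automorphisms, and let $\widehat\sigma:\mathbb Z_2\to\mathrm{Aut}(\widehat G)$ be an action by smooth automorphisms with $q\circ\widehat\sigma^{\varepsilon}=\sigma^{\varepsilon}\circ q$. Put $H_\sigma=G\rtimes_\sigma\mathbb Z_2$ and $\widehat H_{\widehat\sigma}=\widehat G\rtimes_{\widehat\sigma}\mathbb Z_2$. Let $X$ be a diffeological space with its D-topology, and assume that every open cover of $X$ admits a subordinate smooth partition of unity, and that smooth maps from open subsets of $X$ to $G$ lift locally to smooth maps to $\widehat G$. Let $P\to X$ be a (locally trivial) principal $H_\sigma$-bundle, and let $\alpha\in H^1(X;\mathbb Z_2)$ be the class of the $\mathbb Z_2$-components of its transition functions. The group $\mathbb Z_2$ acts on $U(1)\subset\widehat G$ through $\widehat\sigma$, and on $\mathbb R$ and $\mathbb Z$ by the corresponding signs ($+1$ if it acts trivially on $U(1)$, $-1$ if it acts by inversion). Let $U(1)_\alpha$,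 $\mathbb R_\alpha$, $\mathbb Z_\alpha$ be the sheaves of smooth sections of the bundles of groups associated with $P$ and these actions; they form the twisted exponential sequence $0\to\mathbb Z_\alpha\to\mathbb R_\alpha\to U(1)_\alpha\to0$, with second map $t\mapsto e^{2\pi i t}$. Let $H^*$ denote Čech cohomology (the direct limit over open covers). A lift of $P$ to $\widehat H_{\widehat\sigma}$ is a principal $\widehat H_{\widehat\sigma}$-bundle $\widehat P\to X$ with an isomorphism $\widehat P/U(1)\simeq P$. The lifting gerbe of $P$ is the stack over $X$ whose groupoid over an open set $U$ consists of the lifts of $P|_U$ and of the isomorphisms of $\widehat H_{\widehat\sigma}$-bundles compatible with the projections to $P|_U$. It is banded by $U(1)_\alpha$, and it is called trivial if it is equivalent, as a $U(1)_\alpha$-banded gerbe, to the gerbe of $U(1)_\alpha$-torsors. **Proposition.** (a) The connecting map of the twisted exponential sequence is an isomorphism $\delta:H^2(X;U(1)_\alpha)\to H^3(X;\mathbb Z_\alpha)$. (b) There are an open cover $(U_i)$ of $X$ and sections of $P$ over the $U_i$, with transition functions $(g_{ij},\varepsilon_{ij})$, such that the $g_{ij}$ have smooth lifts $\widehat g_{ij}:U_{ij}\to\widehat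 G$. For all such choices $$a_{ijk}=\widehat g_{ij}\,\widehat\sigma^{\varepsilon_{ij}}(\widehat g_{jk})\,\widehat g_{ik}^{-1}$$ is a Čech $2$-cocycle with values in $U(1)_\alpha$, and its class $[a]\in H^2(X;U(1)_\alpha)$ does not depend on the choices. Put $\mathrm{DD}_\alpha(P)=\delta[a]\in H^3(X;\mathbb Z_\alpha)$. (c) The following are equivalent: (1) $\mathrm{DD}_\alpha(P)=0$; (2) $[a]=0$ in $H^2(X;U(1)_\alpha)$; (3) the lifting gerbe of $P$ is trivial; (4) $P$ admits a lift to a principal $\widehat H_{\widehat\sigma}$-bundle. -/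

import Mathlib

open CategoryTheory TopologicalSpace Opposite Diffeology

universe u

noncomputable section

/-! ### Diffeologies on subspaces, products, quotients; diffeological groups -/

namespace DiffeologicalSpace

/-- The pullback of a diffeology along `f`: a parametrization of `Y` is a plot iff its composite
with `f` is a plot. -/
@[reducible]
def induced {Y Z : Type*} [DiffeologicalSpace Z] (f : Y → Z) : DiffeologicalSpace Y where
  plots n := {p | IsPlot (f ∘ p)}
  constant_plots _ := isPlot_const
  plot_reparam {_ _ p _} hp hf := isPlot_reparam (p := f ∘ p) hp hf
  locality {n p} hp := DiffeologicalSpace.locality (p := f ∘ p) fun x =>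
    let ⟨u, hu, hxu, h⟩ := hp x
    ⟨u, hu, hxu, fun hfu hf => h hfu hf⟩

/-- The pushforward of a diffeology along `f`: the finest diffeology making `f` smooth. -/
@[reducible]
def coinduced {Y Z : Type*} [DiffeologicalSpace Y] (f : Y → Z) : DiffeologicalSpace Z :=
  generateFrom {p | ∃ c : EuclideanSpace ℝ (Fin p.1) → Y, IsPlot c ∧ p.2 = f ∘ c}

end DiffeologicalSpace

/-- Subset diffeology. -/
instance Subtype.instDiffeologicalSpace {Y : Type*} [DiffeologicalSpace Y] {s : Y → Prop} :
    DiffeologicalSpace (Subtype s) := .induced Subtype.val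

/-- Product diffeology. -/
instance Prod.instDiffeologicalSpace {Y Z : Type*} [DiffeologicalSpace Y] [DiffeologicalSpace Z] :
    DiffeologicalSpace (Y × Z) :=
  DiffeologicalSpace.induced Prod.fst ⊓ DiffeologicalSpace.induced Prod.snd

/-- Quotient diffeology. -/
instance Quot.instDiffeologicalSpace {Y : Type*} [DiffeologicalSpace Y] {r : Y → Y → Prop} :
    DiffeologicalSpace (Quot r) := .coinduced (Quot.mk r)

instance Complex.instDiffeologicalSpace : DiffeologicalSpace ℂ := NormedSpace.toDiffeology ℂ

instance Complex.instIsContDiffCompatible : IsContDiffCompatible ℂ := ⟨Iff.rfl⟩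

/-- `U(1)` with its manifold diffeology, i.e. the subset diffeology of the unit circle in `ℂ`. -/
instance Circle.instDiffeologicalSpace : DiffeologicalSpace Circle := .induced ((↑) : Circle → ℂ)

instance Additive.instDiffeologicalSpaceCircle : DiffeologicalSpace (Additive Circle) :=
  .induced (fun z => (Additive.toMul z : Circle))

/-- `ℤ` with the subset diffeology of `ℤ ⊆ ℝ`, which is the discrete diffeology. -/
instance Int.instDiffeologicalSpace : DiffeologicalSpace ℤ := .induced ((↑) : ℤ → ℝ)

/-- The group with two elements, written multiplicatively. -/
abbrev Z2 : Type := Multiplicative (ZMod 2)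

/-- The discrete diffeology (the finest one) on `Z2`. -/
instance Z2.instDiffeologicalSpace : DiffeologicalSpace Z2 := ⊥

/-- A semidirect product carries the product diffeology. -/
instance SemidirectProduct.instDiffeologicalSpace {N K : Type*} [Group N] [Group K]
    [DiffeologicalSpace N] [DiffeologicalSpace K] {φ : K →* MulAut N} :
    DiffeologicalSpace (N ⋊[φ] K) := .induced (fun h => (h.left, h.right))

/-- A diffeological group: multiplication and inversion are smooth. -/
class IsDiffeologicalGroup (G : Type*) [Group G] [DiffeologicalSpace G] : Prop where
  smooth_mul : DSmooth (fun z : G × G => z.1 * z.2)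
  smooth_inv : DSmooth (fun g : G => g⁻¹)

/-- An additively written diffeological group. -/
class IsDiffeologicalAddGroup (T : Type*) [AddGroup T] [DiffeologicalSpace T] : Prop where
  smooth_add : DSmooth (fun z : T × T => z.1 + z.2)
  smooth_neg : DSmooth (fun t : T => -t)

/-- A subduction: a smooth surjection along which plots lift locally. -/
def IsSubduction {Y Z : Type*} [DiffeologicalSpace Y] [DiffeologicalSpace Z] (f : Y → Z) : Prop :=
  DSmooth f ∧ Function.Surjective f ∧
    ∀ (n : ℕ) (p : EuclideanSpace ℝ (Fin n) → Z), IsPlot p → ∀ t,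
      ∃ u : Set (EuclideanSpace ℝ (Fin n)), IsOpen u ∧ t ∈ u ∧
        ∃ c : u → Y, DSmooth c ∧ ∀ s : u, f (c s) = p s

/-- An induction: an injection whose source carries the pullback diffeology. -/
def IsInduction {Y Z : Type*} [DiffeologicalSpace Y] [DiffeologicalSpace Z] (f : Y → Z) : Prop :=
  Function.Injective f ∧
    ∀ (n : ℕ) (p : EuclideanSpace ℝ (Fin n) → Y), IsPlot p ↔ IsPlot (f ∘ p)

theorem DSmooth.prodMk' {W Y Z : Type*} [DiffeologicalSpace W] [DiffeologicalSpace Y]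
    [DiffeologicalSpace Z] {f : W → Y} {g : W → Z} (hf : DSmooth f) (hg : DSmooth g) :
    DSmooth (fun w => (f w, g w)) := fun n p hp =>
  DiffeologicalSpace.isPlot_inf_iff.2 ⟨hf n p hp, hg n p hp⟩

theorem dSmooth_fst' {Y Z : Type*} [DiffeologicalSpace Y] [DiffeologicalSpace Z] :
    DSmooth (Prod.fst : Y × Z → Y) := fun _ _ hp => (DiffeologicalSpace.isPlot_inf_iff.1 hp).1

theorem dSmooth_snd' {Y Z : Type*} [DiffeologicalSpace Y] [DiffeologicalSpace Z] :
    DSmooth (Prod.snd : Y × Z → Z) := fun _ _ hp => (DiffeologicalSpace.isPlot_inf_iff.1 hp).2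

theorem dSmooth_induced_iff {W Y Z : Type*} [DiffeologicalSpace W] [DiffeologicalSpace Z]
    (j : Y → Z) (f : W → Y) :
    @DSmooth W Y _ (DiffeologicalSpace.induced j) f ↔ DSmooth (j ∘ f) := Iff.rfl

theorem dSmooth_subtypeVal {Y : Type*} [DiffeologicalSpace Y] {s : Y → Prop} :
    DSmooth (Subtype.val : Subtype s → Y) := fun _ _ hp => hp

theorem dSmooth_quotMk {Y : Type*} [DiffeologicalSpace Y] {r : Y → Y → Prop} :
    DSmooth (Quot.mk r) := fun _ c hc =>
  DiffeologicalSpace.isPlot_generatedFrom_of_mem ⟨c, hc, rfl⟩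

instance : IsDiffeologicalAddGroup ℝ where
  smooth_add := fun _ _ hp => ((dSmooth_fst' _ _ hp).contDiff.add (dSmooth_snd' _ _ hp).contDiff).isPlot
  smooth_neg := fun _ _ hp => hp.contDiff.neg.isPlot

instance : IsDiffeologicalAddGroup ℤ where
  smooth_add := fun n p hp => by
    have h1 : IsPlot (fun t => ((p t).1 : ℝ)) := dSmooth_fst' n p hp
    have h2 : IsPlot (fun t => ((p t).2 : ℝ)) := dSmooth_snd' n p hp
    have h3 : IsPlot (fun t => (((p t).1 + (p t).2 : ℤ) : ℝ)) := by
      simp only [Int.cast_add]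
      exact (h1.contDiff.add h2.contDiff).isPlot
    exact h3
  smooth_neg := fun n p hp => by
    have h1 : IsPlot (fun t => ((p t : ℤ) : ℝ)) := hp
    have h2 : IsPlot (fun t => ((-(p t) : ℤ) : ℝ)) := by
      simp only [Int.cast_neg]
      exact h1.contDiff.neg.isPlot
    exact h2

instance : IsDiffeologicalAddGroup (Additive Circle) where
  smooth_add := fun n p hp => by
    have h1 : IsPlot (fun t => ((p t).1.toMul : ℂ)) := dSmooth_fst' n p hp
    have h2 : IsPlot (fun t => ((p t).2.toMul : ℂ)) := dSmooth_snd' n p hp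
    have h3 : IsPlot (fun t => (((p t).1.toMul * (p t).2.toMul : Circle) : ℂ)) := by
      simp only [Circle.coe_mul]
      exact (h1.contDiff.mul h2.contDiff).isPlot
    exact h3
  smooth_neg := fun n p hp => by
    have h1 : IsPlot (fun t => ((p t).toMul : ℂ)) := hp
    have h2 : IsPlot (fun t => (((p t).toMul⁻¹ : Circle) : ℂ)) := by
      simp only [Circle.coe_inv]
      exact (h1.contDiff.inv fun t => Circle.coe_ne_zero _).isPlot
    exact h2

/-! ### Čech cohomology -/

section CechCohomology

variable {X : Type u} [TopologicalSpace X]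

/-- An open cover of `X` indexed by the points of `X`, with `x` in the member of index `x`. Every
open cover is refined by such a cover. -/
structure PointedCover (X : Type u) [TopologicalSpace X] where
  set : X → Opens X
  mem : ∀ x, x ∈ set x

/-- `𝒰 ≤ 𝒱` iff `𝒱` refines `𝒰` index by index. -/
instance : Preorder (PointedCover X) where
  le 𝒰 𝒱 := ∀ x, 𝒱.set x ≤ 𝒰.set x
  le_refl _ _ := le_rfl
  le_trans _ _ _ h k x := (k x).trans (h x)

/-- The intersection `𝒰_{s 0} ∩ ⋯ ∩ 𝒰_{s n}`. -/
def PointedCover.inter (𝒰 : PointedCover X) {n : ℕ} (s : Fin (n + 1) → X) : Opens X :=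
  Finset.univ.inf fun i => 𝒰.set (s i)

theorem PointedCover.inter_le (𝒰 : PointedCover X) {n : ℕ} (s : Fin (n + 2) → X) (i : Fin (n + 2)) :
    𝒰.inter s ≤ 𝒰.inter (s ∘ i.succAbove) :=
  Finset.le_inf fun _ _ => Finset.inf_le (f := fun i => 𝒰.set (s i)) (Finset.mem_univ _)

theorem PointedCover.inter_mono {𝒰 𝒱 : PointedCover X} (h : 𝒰 ≤ 𝒱) {n : ℕ} (s : Fin (n + 1) → X) :
    𝒱.inter s ≤ 𝒰.inter s :=
  Finset.inf_mono_fun fun i _ => h (s i)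

namespace Cech

variable (F : (Opens X)ᵒᵖ ⥤ AddCommGrpCat.{u})

/-- The restriction homomorphism `F(V) → F(U)` for `U ≤ V`. -/
def res {U V : Opens X} (h : U ≤ V) : F.obj (op V) →+ F.obj (op U) := (F.map (homOfLE h).op).hom

theorem res_res {U V W : Opens X} (h : U ≤ V) (k : V ≤ W) (a : F.obj (op W)) :
    res F h (res F k a) = res F (h.trans k) a := by
  have : F.map (homOfLE (h.trans k)).op = F.map (homOfLE k).op ≫ F.map (homOfLE h).op := by
    rw [← F.map_comp]; rfl
  simp [res, this]

/-- Čech `n`-cochains of a cover. -/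
abbrev Cochain (𝒰 : PointedCover X) (n : ℕ) : Type u :=
  ∀ s : Fin (n + 1) → X, F.obj (op (𝒰.inter s))

/-- The Čech differential. -/
def d (𝒰 : PointedCover X) (n : ℕ) : Cochain F 𝒰 n →+ Cochain F 𝒰 (n + 1) where
  toFun c s := ∑ i : Fin (n + 2), (-1 : ℤ) ^ (i : ℕ) • res F (𝒰.inter_le s i) (c (s ∘ i.succAbove))
  map_zero' := by ext s; simp
  map_add' a b := by ext s; simp [Finset.sum_add_distrib]

/-- Čech cocycles. -/
def cocycles (𝒰 : PointedCover X) (n : ℕ) : AddSubgroup (Cochain F 𝒰 n) := (d F 𝒰 n).ker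

/-- Čech coboundaries. -/
def coboundaries (𝒰 : PointedCover X) : ∀ n : ℕ, AddSubgroup (Cochain F 𝒰 n)
  | 0 => ⊥
  | n + 1 => (d F 𝒰 n).range

/-- The Čech cohomology of a cover. -/
abbrev HCover (𝒰 : PointedCover X) (n : ℕ) : Type u :=
  cocycles F 𝒰 n ⧸ (coboundaries F 𝒰 n).addSubgroupOf (cocycles F 𝒰 n)

/-- Restriction of cochains to a refinement. -/
def refine {𝒰 𝒱 : PointedCover X} (h : 𝒰 ≤ 𝒱) (n : ℕ) : Cochain F 𝒰 n →+ Cochain F 𝒱 n where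
  toFun c s := res F (PointedCover.inter_mono h s) (c s)
  map_zero' := by ext s; simp
  map_add' a b := by ext s; simp

theorem d_refine {𝒰 𝒱 : PointedCover X} (h : 𝒰 ≤ 𝒱) (n : ℕ) (c : Cochain F 𝒰 n) :
    d F 𝒱 n (refine F h n c) = refine F h (n + 1) (d F 𝒰 n c) := by
  ext s
  simp [d, refine, res_res]

theorem refine_mem_cocycles {𝒰 𝒱 : PointedCover X} (h : 𝒰 ≤ 𝒱) {n : ℕ} {c : Cochain F 𝒰 n}
    (hc : c ∈ cocycles F 𝒰 n) : refine F h n c ∈ cocycles F 𝒱 n := by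
  have hc' : d F 𝒰 n c = 0 := hc
  change d F 𝒱 n _ = 0
  rw [d_refine, hc', map_zero]

theorem refine_mem_coboundaries {𝒰 𝒱 : PointedCover X} (h : 𝒰 ≤ 𝒱) {n : ℕ} {c : Cochain F 𝒰 n}
    (hc : c ∈ coboundaries F 𝒰 n) : refine F h n c ∈ coboundaries F 𝒱 n := by
  cases n with
  | zero =>
    have hc' : c = 0 := hc
    change refine F h 0 c = 0
    rw [hc', map_zero]
  | succ n =>
    obtain ⟨b, rfl⟩ := hc
    exact ⟨refine F h n b, d_refine F h n b⟩

/-- The map induced by a refinement on cocycles. -/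
def refineCocycles {𝒰 𝒱 : PointedCover X} (h : 𝒰 ≤ 𝒱) (n : ℕ) :
    cocycles F 𝒰 n →+ cocycles F 𝒱 n :=
  ((refine F h n).comp (cocycles F 𝒰 n).subtype).codRestrict _
    fun c => refine_mem_cocycles F h c.2

/-- The map induced by a refinement on the cohomology of covers. -/
def refineH (n : ℕ) (𝒰 𝒱 : PointedCover X) (h : 𝒰 ≤ 𝒱) : HCover F 𝒰 n →+ HCover F 𝒱 n :=
  QuotientAddGroup.map _ _ (refineCocycles F h n) fun _ hc => refine_mem_coboundaries F h hc

open Classical in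
/-- The Čech cohomology group `H^n(X; F)`: the direct limit of the cohomologies of open covers. -/
abbrev H (n : ℕ) : Type u :=
  AddCommGroup.DirectLimit (fun 𝒰 : PointedCover X => HCover F 𝒰 n) (refineH F n)

open Classical in
/-- The class in `H^n(X; F)` of a cocycle on a cover. -/
def mk (𝒰 : PointedCover X) {n : ℕ} (c : cocycles F 𝒰 n) : H F n :=
  AddCommGroup.DirectLimit.of (fun 𝒰 : PointedCover X => HCover F 𝒰 n) (refineH F n) 𝒰
    (QuotientAddGroup.mk c)

end Cech

end CechCohomology

/-! ### Principal bundles -/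

section Bundles

variable {X : Type u} [TopologicalSpace X] [DiffeologicalSpace X]

/-- `X` admits smooth partitions of unity subordinate to every (D-)open cover, i.e. the sheaf of
smooth real functions on `X` is fine. -/
def HasSmoothPartitionsOfUnity (X : Type u) [TopologicalSpace X] [DiffeologicalSpace X] : Prop :=
  ∀ (I : Type u) (U : I → Opens X), (∀ x, ∃ i, x ∈ U i) →
    ∃ f : I → X → ℝ, (∀ i, DSmooth (f i)) ∧ (∀ i x, 0 ≤ f i x) ∧
      LocallyFinite (fun i => Function.support (f i)) ∧
      (∀ i, closure (Function.support (f i)) ⊆ U i) ∧ ∀ x, ∑ᶠ i, f i x = 1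

/-- A principal `H`-bundle (right action, locally trivial) over the open subset `B` of `X`. -/
structure PrincipalBundle (H : Type u) [Group H] [DiffeologicalSpace H] (B : Opens X) where
  carrier : Type u
  [diffeology : DiffeologicalSpace carrier]
  proj : carrier → X
  proj_mem : ∀ p, proj p ∈ B
  smooth_proj : DSmooth proj
  act : carrier → H → carrier
  act_one : ∀ p, act p 1 = p
  act_mul : ∀ p h k, act p (h * k) = act (act p h) k
  smooth_act : DSmooth (fun z : carrier × H => act z.1 z.2)
  proj_act : ∀ p h, proj (act p h) = proj p
  free : ∀ p h k, act p h = act p k → h = k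
  /-- The action is transitive on fibres, and the element of `H` that moves one point of a fibre
  to another depends smoothly on the two points. -/
  exists_div : ∃ d : {z : carrier × carrier // proj z.1 = proj z.2} → H,
    DSmooth d ∧ ∀ z, act z.1.1 (d z) = z.1.2
  exists_local_section : ∀ x ∈ B, ∃ V : Opens X, x ∈ V ∧ V ≤ B ∧
    ∃ s : V → carrier, DSmooth s ∧ ∀ y, proj (s y) = y

attribute [instance] PrincipalBundle.diffeology

namespace PrincipalBundle

variable {H : Type u} [Group H] [DiffeologicalSpace H]

/-- The restriction of a principal bundle to a smaller open subset. -/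
def restrict {B : Opens X} (P : PrincipalBundle H B) (V : Opens X) (hV : V ≤ B) :
    PrincipalBundle H V where
  carrier := {p : P.carrier // P.proj p ∈ V}
  proj p := P.proj p.1
  proj_mem p := p.2
  smooth_proj := P.smooth_proj.comp dSmooth_subtypeVal
  act p h := ⟨P.act p.1 h, by rw [P.proj_act]; exact p.2⟩
  act_one p := Subtype.ext (P.act_one p.1)
  act_mul p h k := Subtype.ext (P.act_mul p.1 h k)
  smooth_act := P.smooth_act.comp
    (DSmooth.prodMk' (dSmooth_subtypeVal.comp dSmooth_fst') dSmooth_snd')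
  proj_act p h := P.proj_act p.1 h
  free p h k e := P.free p.1 h k (congrArg Subtype.val e)
  exists_div := by
    obtain ⟨d, hd, hd'⟩ := P.exists_div
    refine ⟨fun z => d ⟨(z.1.1.1, z.1.2.1), z.2⟩, hd.comp ?_, fun z =>
      Subtype.ext (hd' ⟨(z.1.1.1, z.1.2.1), z.2⟩)⟩
    exact DSmooth.prodMk'
      (dSmooth_subtypeVal.comp (dSmooth_fst'.comp dSmooth_subtypeVal))
      (dSmooth_subtypeVal.comp (dSmooth_snd'.comp dSmooth_subtypeVal))
  exists_local_section x hx := by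
    obtain ⟨W, hxW, _, s, hs, hs'⟩ := P.exists_local_section x (hV hx)
    refine ⟨W ⊓ V, ⟨hxW, hx⟩, inf_le_right,
      fun y => ⟨s ⟨y.1, y.2.1⟩, by rw [hs']; exact y.2.2⟩, ?_, fun y => hs' _⟩
    have hi : DSmooth (fun y : (W ⊓ V : Opens X) => (⟨y.1, y.2.1⟩ : W)) :=
      dSmooth_subtypeVal (Y := X)
    exact hs.comp hi

end PrincipalBundle

/-! ### Central extensions by `U(1)` compatible with an action of `Z2` -/

/-- A central extension `1 → U(1) → Ĝ → G → 1` of diffeological groups, an action `σ` of `Z2` on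
`G` by smooth automorphisms and a lift `σhat` of `σ` to an action on `Ĝ`. -/
structure TwistedCentralExtension (G Ghat : Type u) [Group G] [DiffeologicalSpace G]
    [Group Ghat] [DiffeologicalSpace Ghat] where
  incl : Circle →* Ghat
  quot : Ghat →* G
  incl_induction : IsInduction incl
  incl_central : ∀ z g, incl z * g = g * incl z
  quot_subduction : IsSubduction quot
  exact : quot.ker = incl.range
  σ : Z2 →* MulAut G
  smooth_σ : ∀ ε, DSmooth (σ ε)
  σhat : Z2 →* MulAut Ghat
  smooth_σhat : ∀ ε, DSmooth (σhat ε)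
  compat : ∀ ε g, quot (σhat ε g) = σ ε (quot g)

namespace TwistedCentralExtension

variable {G Ghat : Type u} [Group G] [DiffeologicalSpace G] [Group Ghat] [DiffeologicalSpace Ghat]
  (E : TwistedCentralExtension G Ghat)

/-- The semidirect product `H_σ = G ⋊_σ Z2`. -/
abbrev H : Type u := G ⋊[E.σ] Z2

/-- The semidirect product `Ĥ_σ̂ = Ĝ ⋊_σ̂ Z2`. -/
abbrev Hhat : Type u := Ghat ⋊[E.σhat] Z2

/-- The projection `Ĥ_σ̂ → H_σ`, `(ĝ, ε) ↦ (q ĝ, ε)`. -/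
def toH : E.Hhat →* E.H :=
  SemidirectProduct.map E.quot (MonoidHom.id Z2) fun ε => MonoidHom.ext fun g => E.compat ε g

/-- The inclusion `U(1) → Ĥ_σ̂`, `z ↦ (z, 1)`. -/
def inclHhat : Circle →* E.Hhat := SemidirectProduct.inl.comp E.incl

theorem exists_centralAction (ε : Z2) (z : Circle) : ∃ w, E.incl w = E.σhat ε (E.incl z) := by
  have h : E.σhat ε (E.incl z) ∈ E.quot.ker := by
    have hz : E.incl z ∈ E.quot.ker := E.exact ▸ ⟨z, rfl⟩
    rw [MonoidHom.mem_ker] at hz ⊢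
    rw [E.compat, hz, map_one]
  rw [E.exact] at h
  exact h

/-- The action of `Z2` on `U(1)` obtained by restricting `σhat`. -/
def centralAction (ε : Z2) : Circle →* Circle where
  toFun z := (E.exists_centralAction ε z).choose
  map_one' := E.incl_induction.1 <| by
    rw [(E.exists_centralAction ε 1).choose_spec]; simp
  map_mul' z w := E.incl_induction.1 <| by
    rw [(E.exists_centralAction ε (z * w)).choose_spec, map_mul, map_mul, map_mul,
      (E.exists_centralAction ε z).choose_spec, (E.exists_centralAction ε w).choose_spec]

theorem incl_centralAction (ε : Z2) (z : Circle) :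
    E.incl (E.centralAction ε z) = E.σhat ε (E.incl z) :=
  (E.exists_centralAction ε z).choose_spec

open Classical in
/-- The sign by which `ε` acts on `ℤ` and `ℝ`. A smooth automorphism of `U(1) = ℝ / ℤ` is either
the identity, induced by `1` on `ℝ`, or the inversion, induced by `-1` on `ℝ`. -/
def sign (ε : Z2) : ℤ := if E.centralAction ε = MonoidHom.id Circle then 1 else -1

/-- Smooth maps from open subsets of `X` to `G` lift locally to `Ĝ`. -/
def HasLocalLifts (X : Type u) [TopologicalSpace X] [DiffeologicalSpace X] : Prop :=
  ∀ (U : Opens X) (g : U → G), DSmooth g → ∀ x ∈ U, ∃ (V : Opens X) (hVU : V ≤ U), x ∈ V ∧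
    ∃ ghat : V → Ghat, DSmooth ghat ∧ ∀ y : V, E.quot (ghat y) = g ⟨y.1, hVU y.2⟩

end TwistedCentralExtension

/-! ### The local systems `ℤ_α`, `ℝ_α`, `U(1)_α` -/

section LocalSystems

variable {G Ghat : Type u} [Group G] [DiffeologicalSpace G] [Group Ghat] [DiffeologicalSpace Ghat]
  {E : TwistedCentralExtension G Ghat} (P : PrincipalBundle E.H (⊤ : Opens X))

/-- The sections over `U` of the bundle of groups associated with `P` and with the action `ρ` of
`H_σ → Z2` on `T`: smooth maps `f : P|_U → T` such that `f (p · h) = ρ (ε(h)⁻¹) (f p)`. A section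
`s` of `P` over `U` identifies them with smooth maps `f ∘ s : U → T`, and the identifications
given by `s_i` and `s_j = s_i · (g_ij, ε_ij)` differ by the action of `ε_ij`. -/
def twistedSections {T : Type} [AddCommGroup T] [DiffeologicalSpace T] [IsDiffeologicalAddGroup T]
    (ρ : Z2 → T →+ T) (U : Opens X) : AddSubgroup ({p : P.carrier // P.proj p ∈ U} → T) where
  carrier := {f | DSmooth f ∧ ∀ (p : {p : P.carrier // P.proj p ∈ U}) (h : E.H),
    f ⟨P.act p.1 h, by rw [P.proj_act]; exact p.2⟩ = ρ (h.right⁻¹) (f p)}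
  zero_mem' := ⟨dSmooth_const, fun p h => by simp⟩
  add_mem' := fun ha hb =>
    ⟨IsDiffeologicalAddGroup.smooth_add.comp (DSmooth.prodMk' ha.1 hb.1), fun p h => by
      simp [ha.2 p h, hb.2 p h]⟩
  neg_mem' := fun ha => ⟨IsDiffeologicalAddGroup.smooth_neg.comp ha.1, fun p h => by
      simp [ha.2 p h]⟩

/-- The sheaf of sections `twistedSections`, as a presheaf on `X`. -/
def localSystem {T : Type} [AddCommGroup T] [DiffeologicalSpace T] [IsDiffeologicalAddGroup T]
    (ρ : Z2 → T →+ T) : (Opens X)ᵒᵖ ⥤ AddCommGrpCat.{u} where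
  obj U := AddCommGrpCat.of (twistedSections P ρ U.unop)
  map {U V} i := AddCommGrpCat.ofHom
    { toFun := fun f => ⟨fun p => f.1 ⟨p.1, i.unop.le p.2⟩, And.intro (by
        have hi : DSmooth (fun p : {p : P.carrier // P.proj p ∈ V.unop} =>
            (⟨p.1, i.unop.le p.2⟩ : {p : P.carrier // P.proj p ∈ U.unop})) :=
          dSmooth_subtypeVal (Y := P.carrier)
        exact DSmooth.comp f.2.1 hi) fun p h => f.2.2 ⟨p.1, i.unop.le p.2⟩ h⟩
      map_zero' := rfl
      map_add' := fun _ _ => rfl }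

/-- `U(1)_α`, where `Z2` acts on `U(1) ⊆ Ĝ` through `σhat`. -/
abbrev circleSystem : (Opens X)ᵒᵖ ⥤ AddCommGrpCat.{u} :=
  localSystem P (T := Additive Circle) fun ε => (E.centralAction ε).toAdditive

/-- `ℝ_α`. -/
abbrev realSystem : (Opens X)ᵒᵖ ⥤ AddCommGrpCat.{u} :=
  localSystem P (T := ℝ) fun ε => zsmulAddGroupHom (E.sign ε)

/-- `ℤ_α`. -/
abbrev intSystem : (Opens X)ᵒᵖ ⥤ AddCommGrpCat.{u} :=
  localSystem P (T := ℤ) fun ε => zsmulAddGroupHom (E.sign ε)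

variable {P}

/-- The value of a section of `U(1)_α` at a point of `P`. -/
def circleEval {U : Opens X} (f : (circleSystem P).obj (op U)) (p : P.carrier)
    (hp : P.proj p ∈ U) : Circle :=
  Additive.toMul ((show twistedSections P _ U from f).1 ⟨p, hp⟩)

/-- The value of a section of `ℝ_α` at a point of `P`. -/
def realEval {U : Opens X} (f : (realSystem P).obj (op U)) (p : P.carrier)
    (hp : P.proj p ∈ U) : ℝ :=
  (show twistedSections P _ U from f).1 ⟨p, hp⟩

/-- The value of a section of `ℤ_α` at a point of `P`. -/
def intEval {U : Opens X} (f : (intSystem P).obj (op U)) (p : P.carrier)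
    (hp : P.proj p ∈ U) : ℤ :=
  (show twistedSections P _ U from f).1 ⟨p, hp⟩

end LocalSystems

/-! ### The connecting homomorphism and the obstruction class -/

section Obstruction

variable {G Ghat : Type u} [Group G] [DiffeologicalSpace G] [Group Ghat] [DiffeologicalSpace Ghat]
  {E : TwistedCentralExtension G Ghat} (P : PrincipalBundle E.H (⊤ : Opens X))

/-- The relation `δ c = d` for the connecting map `δ` of the twisted exponential sequence
`0 → ℤ_α → ℝ_α → U(1)_α → 0` (with `t ↦ exp (2πit)` as the second map): on some open cover,
`c` is represented by a cocycle `a = exp (2πir)` with an `ℝ_α`-valued cochain `r`, and the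
coboundary of `r` is the image of a cocycle `z` that represents `d`. -/
def IsConnecting (c : Cech.H (circleSystem P) 2) (d : Cech.H (intSystem P) 3) : Prop :=
  ∃ (𝒰 : PointedCover X) (a : Cech.cocycles (circleSystem P) 𝒰 2)
    (r : Cech.Cochain (realSystem P) 𝒰 2) (z : Cech.cocycles (intSystem P) 𝒰 3),
    Cech.mk _ 𝒰 a = c ∧ Cech.mk _ 𝒰 z = d ∧
    (∀ s p hp, Circle.exp (2 * Real.pi * realEval (r s) p hp) = circleEval (a.1 s) p hp) ∧
    ∀ s p hp, realEval (Cech.d _ 𝒰 2 r s) p hp = (intEval (z.1 s) p hp : ℝ)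

/-- The choices made in the construction of the obstruction cocycle: an open cover `(U_i)`, smooth
sections `s_i` of `P`, with transition functions `h_ij = (g_ij, ε_ij)`, `s_j = s_i h_ij`, and
smooth lifts `ĝ_ij` of `g_ij` to `Ĝ`. -/
structure LiftingDatum where
  I : Type u
  U : I → Opens X
  /-- for every point, a member of the cover that contains it -/
  index : X → I
  mem_index : ∀ x, x ∈ U (index x)
  s : ∀ i, U i → P.carrier
  smooth_s : ∀ i, DSmooth (s i)
  proj_s : ∀ i y, P.proj (s i y) = y
  h : ∀ i j, (U i ⊓ U j : Opens X) → E.H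
  s_eq : ∀ i j (y : (U i ⊓ U j : Opens X)), s j ⟨y.1, y.2.2⟩ = P.act (s i ⟨y.1, y.2.1⟩) (h i j y)
  ghat : ∀ i j, (U i ⊓ U j : Opens X) → Ghat
  smooth_ghat : ∀ i j, DSmooth (ghat i j)
  quot_ghat : ∀ i j y, E.quot (ghat i j y) = (h i j y).left

namespace LiftingDatum

variable {P} (D : LiftingDatum P)

/-- The cover `(U_i)`, reindexed by the points of `X`. -/
def cover : PointedCover X := ⟨fun x => D.U (D.index x), D.mem_index⟩

/-- `ĝ_ij(y) σ̂^{ε_ij(y)}(ĝ_jk(y)) ĝ_ik(y)⁻¹` for `y ∈ U_i ∩ U_j ∩ U_k`. -/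
def defect (i j k : D.I) (y : X) (hi : y ∈ D.U i) (hj : y ∈ D.U j) (hk : y ∈ D.U k) : Ghat :=
  D.ghat i j ⟨y, hi, hj⟩ * E.σhat (D.h i j ⟨y, hi, hj⟩).right (D.ghat j k ⟨y, hj, hk⟩) *
    (D.ghat i k ⟨y, hi, hk⟩)⁻¹

/-- `c` is the class `[a]` of the cocycle `a_ijk = ĝ_ij σ̂^{ε_ij}(ĝ_jk) ĝ_ik⁻¹`, the section of
`U(1)_α` over `U_ijk` being read off in the trivialization `s_i`. -/
def Represents (c : Cech.H (circleSystem P) 2) : Prop :=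
  ∃ a : Cech.cocycles (circleSystem P) D.cover 2, Cech.mk _ D.cover a = c ∧
    ∀ (t : Fin 3 → X) (y : X) (h0 : y ∈ D.U (D.index (t 0))) (h1 : y ∈ D.U (D.index (t 1)))
      (h2 : y ∈ D.U (D.index (t 2)))
      (hp : P.proj (D.s (D.index (t 0)) ⟨y, h0⟩) ∈ D.cover.inter t),
      E.incl (circleEval (a.1 t) (D.s (D.index (t 0)) ⟨y, h0⟩) hp) =
        D.defect (D.index (t 0)) (D.index (t 1)) (D.index (t 2)) y h0 h1 h2

end LiftingDatum

end Obstruction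

/-! ### Lifts and the lifting gerbe -/

section Gerbe

variable {G Ghat : Type u} [Group G] [DiffeologicalSpace G] [Group Ghat] [DiffeologicalSpace Ghat]
  {E : TwistedCentralExtension G Ghat}

/-- The quotient of a principal `Ĥ_σ̂`-bundle by `U(1)`. -/
abbrev PrincipalBundle.ModCircle {B : Opens X} (Q : PrincipalBundle E.Hhat B) : Type u :=
  Quot fun q q' : Q.carrier => ∃ z : Circle, q' = Q.act q (E.inclHhat z)

/-- A lift of a principal `H_σ`-bundle `R` over `B`: a principal `Ĥ_σ̂`-bundle `Q` over `B` with
an isomorphism `Q / U(1) ≃ R` of principal `H_σ`-bundles. -/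
structure BundleLift {B : Opens X} (R : PrincipalBundle E.H B) where
  bundle : PrincipalBundle E.Hhat B
  iso : bundle.ModCircle ≃ R.carrier
  smooth_iso : DSmooth iso
  smooth_iso_symm : DSmooth iso.symm
  proj_iso : ∀ q, R.proj (iso (Quot.mk _ q)) = bundle.proj q
  iso_act : ∀ q h, iso (Quot.mk _ (bundle.act q h)) = R.act (iso (Quot.mk _ q)) (E.toH h)

variable (P : PrincipalBundle E.H (⊤ : Opens X))

/-- Objects of the lifting gerbe: an open subset `U` of `X` and a lift of `P|_U`. -/
structure LiftingGerbe where
  U : Opens X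
  lift : BundleLift (P.restrict U le_top)

namespace LiftingGerbe

variable {P}

/-- The total space of the bundle. -/
abbrev carrier (Q : LiftingGerbe P) : Type u := Q.lift.bundle.carrier

/-- The projection of the bundle to `P`. -/
def toP (Q : LiftingGerbe P) (q : Q.carrier) : P.carrier := (Q.lift.iso (Quot.mk _ q)).1

theorem proj_toP (Q : LiftingGerbe P) (q : Q.carrier) : P.proj (Q.toP q) ∈ Q.U :=
  (Q.lift.iso (Quot.mk _ q)).2

/-- Morphisms over an inclusion `V ≤ U` of open subsets: smooth `Ĥ_σ̂`-equivariant maps compatible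
with the projections to `P`; such a map identifies the source with the restriction of the target
to `V`. For `V = U` they are the isomorphisms of `Ĥ_σ̂`-bundles compatible with the projections to
`P|_U`, so that the fibre of this category over `U` is the groupoid of lifts of `P|_U`. -/
@[ext]
structure Hom (Q Q' : LiftingGerbe P) where
  le : Q.U ≤ Q'.U
  toFun : Q.carrier → Q'.carrier
  smooth : DSmooth toFun
  map_act : ∀ q h, toFun (Q.lift.bundle.act q h) = Q'.lift.bundle.act (toFun q) h
  toP_comp : ∀ q, Q'.toP (toFun q) = Q.toP q

/-- The lifting gerbe, as a category fibred in groupoids over the open subsets of `X`. -/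
instance : Category (LiftingGerbe P) where
  Hom := Hom
  id Q := ⟨le_rfl, id, dSmooth_id, fun _ _ => rfl, fun _ => rfl⟩
  comp f g := ⟨f.le.trans g.le, g.toFun ∘ f.toFun, g.smooth.comp f.smooth,
    fun q h => by simp [f.map_act, g.map_act], fun q => by simp [f.toP_comp, g.toP_comp]⟩

/-- The band: a section `a` of `U(1)_α` over `U` acts on a lift of `P|_U` by the automorphism
`q ↦ q · a(q)`, where `a` is evaluated at the image of `q` in `P`. -/
def IsBandAutomorphism (Q : LiftingGerbe P) (a : (circleSystem P).obj (op Q.U)) (f : Q ⟶ Q) :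
    Prop :=
  ∀ q, Hom.toFun f q =
    Q.lift.bundle.act q (E.inclHhat (circleEval a (Q.toP q) (Q.proj_toP q)))

end LiftingGerbe

/-- Objects of the trivial gerbe banded by a sheaf of abelian groups `A` on `X`: an open subset `U`
of `X` and an `A|_U`-torsor. A sheaf on `U` is regarded as a sheaf of sets on `X` without sections
on the open sets that are not contained in `U`. -/
structure TorsorGerbe (A : (Opens X)ᵒᵖ ⥤ AddCommGrpCat.{u}) where
  U : Opens X
  sec : (Opens X)ᵒᵖ ⥤ Type u
  isSheaf : Presheaf.IsSheaf (Opens.grothendieckTopology X) sec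
  le_of_sec : ∀ V, sec.obj (op V) → V ≤ U
  act : ∀ V, A.obj (op V) → sec.obj (op V) → sec.obj (op V)
  zero_act : ∀ V t, act V 0 t = t
  add_act : ∀ V a b t, act V (a + b) t = act V a (act V b t)
  res_act : ∀ {V W : Opens X} (h : W ≤ V) a t, sec.map (homOfLE h).op (act V a t) =
    act W (Cech.res A h a) (sec.map (homOfLE h).op t)
  simply_transitive : ∀ V t t', ∃! a, act V a t = t'
  locally_nonempty : ∀ x ∈ U, ∃ V : Opens X, x ∈ V ∧ Nonempty (sec.obj (op V))

namespace TorsorGerbe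

variable {A : (Opens X)ᵒᵖ ⥤ AddCommGrpCat.{u}}

/-- Morphisms over an inclusion `V ≤ U`: `A`-equivariant maps of sheaves. -/
@[ext]
structure Hom (T T' : TorsorGerbe A) where
  le : T.U ≤ T'.U
  map : T.sec ⟶ T'.sec
  map_act : ∀ V a t, map.app (op V) (T.act V a t) = T'.act V a (map.app (op V) t)

/-- The trivial `A`-banded gerbe, as a category fibred in groupoids over the open subsets. -/
instance : Category (TorsorGerbe A) where
  Hom := Hom
  id T := ⟨le_rfl, 𝟙 _, fun _ _ _ => rfl⟩
  comp f g := ⟨f.le.trans g.le, f.map ≫ g.map, fun V a t => by simp [f.map_act, g.map_act]⟩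

end TorsorGerbe

/-- The lifting gerbe of `P` is trivial: it is equivalent, as a gerbe over `X` banded by `U(1)_α`,
to the gerbe of `U(1)_α`-torsors. -/
def LiftingGerbeIsTrivial : Prop :=
  ∃ F : LiftingGerbe P ⥤ TorsorGerbe (circleSystem P), F.IsEquivalence ∧
    (∀ Q, (F.obj Q).U = Q.U) ∧
    ∀ (Q : LiftingGerbe P) (a : (circleSystem P).obj (op Q.U)) (f : Q ⟶ Q),
      Q.IsBandAutomorphism a f → ∀ (V : Opens X) (hV : V ≤ Q.U) (t : (F.obj Q).sec.obj (op V)),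
        (TorsorGerbe.Hom.map (F.map f)).app (op V) t =
          (F.obj Q).act V (Cech.res (circleSystem P) hV a) t

end Gerbe

end Bundles

end

noncomputable section

/-! ### Plots and local smoothness -/

section Plots

open scoped ContDiff

variable {W Y Z : Type*} [DiffeologicalSpace W] [DiffeologicalSpace Y] [DiffeologicalSpace Z]

/-! The coefficient statement is the long exact sequence of the twisted exponential sequence. The
sheaf of real sections is fine: a partition of unity gives a contracting homotopy, so real cocycles
of positive degree are coboundaries already on the given cover (`exists_d_eq_of_real_cocycle`).
Circle-valued cochains have logarithms after a refinement (`exists_log_cochain`), and a real cochain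
with trivial exponential is integral (`exists_intCochain`). Equivariance of the exponential rests on
the fact that a smooth involution of the circle is the identity or the inversion
(`Circle.eq_id_or_eq_inv`). The usual diagram chases then show that `IsConnecting` is the graph of
an isomorphism.

Local choices must be made simultaneously on all intersections of a cover. Local finiteness of a
partition of unity makes this possible (`PointedCover.exists_refinement`), at the price of a
refinement that moves indices. Prism homotopies show that this does not change classes in degrees 2
and 3.

For the obstruction, a lift of a transition function is treated as one element `k = (ĝ, ε)` of the
semidirect product. The defect `k_xy k_yz k_xz⁻¹` lies in the kernel `U(1)`, and carrying a section
of the twisted circle sheaf from one point of `P` to another in its fibre is conjugation in that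
group (`hatAt_act`). The twisted cocycle identity and the independence of choices thus become
identities in a group.

If the class vanishes, a cochain bounding the defect corrects the `k` to a genuine cocycle, and this
cocycle glues a lift (`LiftCocycle`). Conversely, local sections of a lift have transition functions
with zero defect.

A lift `L` trivializes the gerbe by sending `Q` to the sheaf of morphisms from restrictions of `L`
to `Q`. Two such morphisms differ by a unique circle section, and every point of `Q` is hit by a
local morphism; this yields torsors and full faithfulness. Twisting the cocycle of `L` by that of a
torsor gives essential surjectivity. Conversely, a preimage of the trivial torsor over `X` is an
object of the gerbe over `X`, that is, a lift of `P`. -/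

theorem isPlot_of_locally {n : ℕ} {p : EuclideanSpace ℝ (Fin n) → Y}
    (h : ∀ t, ∃ u : Set (EuclideanSpace ℝ (Fin n)), IsOpen u ∧ t ∈ u ∧
      ∀ (m : ℕ) (g : EuclideanSpace ℝ (Fin m) → EuclideanSpace ℝ (Fin n)), (∀ x, g x ∈ u) →
        IsPlot g → IsPlot (p ∘ g)) : IsPlot p :=
  DiffeologicalSpace.locality fun t =>
    let ⟨u, hu, ht, h⟩ := h t
    ⟨u, hu, ht, fun {m g} hg hgs => h m g hg hgs.isPlot⟩

theorem Diffeology.IsPlot.comp_plot {n m : ℕ} {p : EuclideanSpace ℝ (Fin n) → Y} (hp : IsPlot p)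
    {g : EuclideanSpace ℝ (Fin m) → EuclideanSpace ℝ (Fin n)} (hg : IsPlot g) :
    IsPlot (fun x => p (g x)) :=
  isPlot_reparam hp hg.contDiff

theorem Diffeology.IsPlot.isOpen_preimage {X : Type*} [TopologicalSpace X] [DiffeologicalSpace X]
    [IsDTopologyCompatible X] {n : ℕ} {q : EuclideanSpace ℝ (Fin n) → X} (hq : IsPlot q)
    (V : Opens X) : IsOpen (q ⁻¹' V) := by
  have h : ∀ W : Set X, IsOpen W → IsOpen (q ⁻¹' W) := by
    rw [← IsDTopologyCompatible.dTop_eq X]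
    exact fun W hW => isOpen_iff_preimages_plots.1 hW n q hq
  exact h V V.isOpen

/-- Plots of `X` are continuous for the D-topology, so locality may be tested on the pullback of an
open cover of `X`. The test maps `g` have full Euclidean domain, which avoids plots defined on open
subsets. -/
theorem isPlot_of_opens {X : Type*} [TopologicalSpace X] [DiffeologicalSpace X]
    [IsDTopologyCompatible X] {n : ℕ} {q : EuclideanSpace ℝ (Fin n) → X} (hq : IsPlot q)
    {p : EuclideanSpace ℝ (Fin n) → Y}
    (h : ∀ t, ∃ V : Opens X, q t ∈ V ∧
      ∀ (m : ℕ) (g : EuclideanSpace ℝ (Fin m) → EuclideanSpace ℝ (Fin n)), (∀ x, q (g x) ∈ V) →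
        IsPlot g → IsPlot (p ∘ g)) : IsPlot p :=
  isPlot_of_locally fun t =>
    let ⟨V, ht, h⟩ := h t
    ⟨q ⁻¹' V, hq.isOpen_preimage V, ht, h⟩

theorem Diffeology.IsPlot.prodMk {n : ℕ} {p : EuclideanSpace ℝ (Fin n) → Y}
    {q : EuclideanSpace ℝ (Fin n) → Z} (hp : IsPlot p) (hq : IsPlot q) :
    IsPlot (fun t => (p t, q t)) :=
  DiffeologicalSpace.isPlot_inf_iff.2 ⟨hp, hq⟩

theorem Diffeology.DSmooth.isPlot_comp {f : Y → Z} (hf : DSmooth f) {n : ℕ}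
    {p : EuclideanSpace ℝ (Fin n) → Y} (hp : IsPlot p) : IsPlot (fun t => f (p t)) :=
  hf n p hp

theorem Diffeology.IsPlot.subtypeMk {s : Y → Prop} {n : ℕ} {p : EuclideanSpace ℝ (Fin n) → Y}
    (hp : IsPlot p) (h : ∀ w, s (p w)) : IsPlot (fun w => (⟨p w, h w⟩ : Subtype s)) := hp

theorem Diffeology.IsPlot.subtypeVal {s : Y → Prop} {n : ℕ} {p : EuclideanSpace ℝ (Fin n) → Subtype s}
    (hp : IsPlot p) : IsPlot (fun w => (p w).1) := hp

/-- The local lift is turned into a function on the whole Euclidean space. Its smoothness is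
asserted only along plots with values in `u`, which is the form that `isPlot_of_locally` consumes.
-/
theorem IsSubduction.exists_lift {f : Y → Z} (hf : IsSubduction f) {n : ℕ}
    {p : EuclideanSpace ℝ (Fin n) → Z} (hp : IsPlot p) (t : EuclideanSpace ℝ (Fin n)) :
    ∃ u : Set (EuclideanSpace ℝ (Fin n)), IsOpen u ∧ t ∈ u ∧
      ∃ c : EuclideanSpace ℝ (Fin n) → Y, (∀ s ∈ u, f (c s) = p s) ∧
        ∀ (m : ℕ) (g : EuclideanSpace ℝ (Fin m) → EuclideanSpace ℝ (Fin n)), (∀ x, g x ∈ u) →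
          IsPlot g → IsPlot (fun x => c (g x)) := by
  classical
  obtain ⟨u, hu, ht, c, hc, hcp⟩ := hf.2.2 n p hp t
  -- Outside `u` the value is irrelevant; the constant `c t` serves as a default.
  refine ⟨u, hu, ht, fun s => if h : s ∈ u then c ⟨s, h⟩ else c ⟨t, ht⟩, fun s hs => ?_,
    fun m g hg hgs => ?_⟩
  · simpa [hs] using hcp ⟨s, hs⟩
  · have := hc m (fun x => ⟨g x, hg x⟩) hgs
    simpa [hg, Function.comp_def] using this

/-- The quotient diffeology is generated by projections of plots, so comparing it with the pullback
diffeology along the induced map only requires a check on these generators. -/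
theorem dSmooth_quot_lift {r : Y → Y → Prop} {f : Y → Z} (hf : DSmooth f)
    (h : ∀ a b, r a b → f a = f b) : DSmooth (Quot.lift f h) := by
  refine DiffeologicalSpace.le_iff'.1 ((DiffeologicalSpace.generateFrom_le_iff
    (d := DiffeologicalSpace.induced (Quot.lift f h))).2 ?_)
  rintro n p ⟨c, hc, hp⟩
  have hp' : ∀ t, p t = Quot.mk r (c t) := congrFun hp
  have : Quot.lift f h ∘ p = fun t => f (c t) := by
    ext t
    rw [Function.comp_apply, hp']
  change IsPlot (Quot.lift f h ∘ p)
  rw [this]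
  exact hf n c hc

/-- Plots of the discrete group `Z2` are constant. -/
theorem Z2.isPlot_const {n : ℕ} {p : EuclideanSpace ℝ (Fin n) → Z2} (hp : IsPlot p)
    (s t : EuclideanSpace ℝ (Fin n)) : p s = p t := by
  -- The discrete diffeology is the finest one, so any embedding in `ℤ` is smooth. A plot then
  -- becomes a continuous integer-valued function on a connected space.
  let j : Z2 → ℤ := fun ε => if ε = 1 then 0 else 1
  have hj : Function.Injective j := by decide
  have hle : (⊥ : DiffeologicalSpace Z2) ≤ DiffeologicalSpace.induced j := bot_le
  have h1 : IsPlot (j ∘ p) := DiffeologicalSpace.le_iff'.1 hle n p hp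
  have h2 : IsPlot (fun t => ((j (p t) : ℤ) : ℝ)) := h1
  have h3 : Continuous (j ∘ p) :=
    Int.isClosedEmbedding_coe_real.isInducing.continuous_iff.2 h2.contDiff.continuous
  exact hj (PreconnectedSpace.constant inferInstance h3 (x := s) (y := t))

/-- Since the plot `e` is constant, smoothness of each single `ρ ε` replaces joint smoothness. -/
theorem Z2.isPlot_apply {ρ : Z2 → Y → Z} (hρ : ∀ ε, DSmooth (ρ ε)) {n : ℕ}
    {e : EuclideanSpace ℝ (Fin n) → Z2} (he : IsPlot e) {p : EuclideanSpace ℝ (Fin n) → Y}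
    (hp : IsPlot p) : IsPlot (fun t => ρ (e t) (p t)) := by
  have : (fun t => ρ (e t) (p t)) = fun t => ρ (e 0) (p t) := by
    ext t; rw [Z2.isPlot_const he t 0]
  rw [this]
  exact (hρ _).isPlot_comp hp

instance : IsDiffeologicalGroup Z2 where
  smooth_mul n p hp := by
    have h1 := Z2.isPlot_const (dSmooth_fst' n p hp)
    have h2 := Z2.isPlot_const (dSmooth_snd' n p hp)
    have : ((fun z : Z2 × Z2 => z.1 * z.2) ∘ p) = fun _ => (p 0).1 * (p 0).2 := by
      ext t; exact congrArg₂ (· * ·) (h1 t 0) (h2 t 0)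
    rw [this]; exact isPlot_const
  smooth_inv n p hp := by
    have : ((fun g : Z2 => g⁻¹) ∘ p) = fun _ => (p 0)⁻¹ := by
      ext t; exact congrArg (·⁻¹) (Z2.isPlot_const hp t 0)
    rw [this]; exact isPlot_const

theorem Diffeology.IsPlot.mul {N : Type*} [Group N] [DiffeologicalSpace N] [IsDiffeologicalGroup N] {n : ℕ}
    {p q : EuclideanSpace ℝ (Fin n) → N} (hp : IsPlot p) (hq : IsPlot q) :
    IsPlot (fun t => p t * q t) :=
  IsDiffeologicalGroup.smooth_mul n _ (hp.prodMk hq)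

theorem Diffeology.IsPlot.inv {N : Type*} [Group N] [DiffeologicalSpace N] [IsDiffeologicalGroup N] {n : ℕ}
    {p : EuclideanSpace ℝ (Fin n) → N} (hp : IsPlot p) : IsPlot (fun t => (p t)⁻¹) :=
  IsDiffeologicalGroup.smooth_inv n _ hp

end Plots

/-! ### Semidirect products with the discrete group `Z2` -/

section SemidirectProduct

variable {N : Type*} [Group N] [DiffeologicalSpace N] {φ : Z2 →* MulAut N}

theorem SemidirectProduct.isPlot_iff {n : ℕ} {p : EuclideanSpace ℝ (Fin n) → N ⋊[φ] Z2} :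
    IsPlot p ↔ IsPlot (fun t => (p t).left) ∧ IsPlot (fun t => (p t).right) :=
  DiffeologicalSpace.isPlot_inf_iff

theorem SemidirectProduct.isDiffeologicalGroup [IsDiffeologicalGroup N]
    (hφ : ∀ ε, DSmooth (φ ε)) : IsDiffeologicalGroup (N ⋊[φ] Z2) where
  smooth_mul n p hp := by
    obtain ⟨h1, h1'⟩ := SemidirectProduct.isPlot_iff.1 (dSmooth_fst' n p hp)
    obtain ⟨h2, h2'⟩ := SemidirectProduct.isPlot_iff.1 (dSmooth_snd' n p hp)
    exact SemidirectProduct.isPlot_iff.2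
      ⟨h1.mul (Z2.isPlot_apply (ρ := fun ε => φ ε) hφ h1' h2), h1'.mul h2'⟩
  smooth_inv n p hp := by
    obtain ⟨h1, h1'⟩ := SemidirectProduct.isPlot_iff.1 hp
    exact SemidirectProduct.isPlot_iff.2
      ⟨Z2.isPlot_apply (ρ := fun ε => φ ε) hφ h1'.inv h1.inv, h1'.inv⟩

end SemidirectProduct

/-! ### Smooth involutions of the circle -/

section CircleInvolution

open scoped ContDiff

theorem Circle.dSmooth_exp : DSmooth Circle.exp := fun n p hp => by
  have : ContDiff ℝ ∞ (fun t => Complex.exp (p t * Complex.I)) :=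
    ((Complex.ofRealCLM.contDiff.comp hp.contDiff).mul contDiff_const).cexp
  exact (show ContDiff ℝ ∞ (fun t => (Circle.exp (p t) : ℂ)) by simpa using this).isPlot

/-- Composition with `exp` moves the question to `ℝ`, where smoothness in the diffeological sense is
ordinary smoothness; no comparison of topologies on the circle is needed. -/
theorem Circle.continuous_of_dSmooth {f : Circle → Circle} (hf : DSmooth f) :
    Continuous fun t : ℝ => f (Circle.exp t) := by
  have h : DSmooth (fun t : ℝ => (f (Circle.exp t) : ℂ)) := fun n p hp =>
    (hf.comp Circle.dSmooth_exp) n p hp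
  exact Topology.IsInducing.subtypeVal.continuous_iff.2 h.contDiff.continuous

/-- A smooth involution of the group `U(1)` is the identity or the inversion. -/
theorem Circle.eq_id_or_eq_inv (φ : Circle →* Circle) (hφ : DSmooth φ)
    (hinv : ∀ z, φ (φ z) = z) : φ = MonoidHom.id Circle ∨ ∀ z, φ z = z⁻¹ := by
  -- The norm of the involution: all values `z φ(z)` are fixed by `φ`. If the norm is trivial, `φ`
  -- is the inversion; otherwise its image has to be shown to be large.
  let ψ : ℝ → Circle := fun t => Circle.exp t * φ (Circle.exp t)
  have hψ : Continuous ψ := Circle.exp.continuous.mul (Circle.continuous_of_dSmooth hφ)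
  have hfix : ∀ t, φ (ψ t) = ψ t := fun t => by simp [ψ, hinv, mul_comm]
  by_cases h1 : ∀ t, ψ t = 1
  · right
    intro z
    obtain ⟨t, rfl⟩ := Circle.exp_surjective z
    exact eq_inv_of_mul_eq_one_right (h1 t)
  · left
    push Not at h1
    obtain ⟨t₀, ht₀⟩ := h1
    have hadd : ∀ s t, ψ (s + t) = ψ s * ψ t := fun s t => by
      simp only [ψ, Circle.exp_add, map_mul]; exact mul_mul_mul_comm _ _ _ _
    -- The preimage under `exp` of the image of `ψ`. The map `φ` fixes the exponentials of its
    -- elements.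
    let S : AddSubgroup ℝ :=
      { carrier := {s | ∃ t, ψ t = Circle.exp s}
        zero_mem' := ⟨0, by simp [ψ]⟩
        add_mem' := by
          rintro a b ⟨s, hs⟩ ⟨t, ht⟩
          exact ⟨s + t, by rw [hadd, hs, ht, Circle.exp_add]⟩
        neg_mem' := by
          rintro a ⟨s, hs⟩
          refine ⟨-s, ?_⟩
          have : ψ (-s) * ψ s = 1 := by rw [← hadd]; simp [ψ]
          rw [Circle.exp_neg, ← hs, eq_inv_of_mul_eq_one_left this] }
    -- The image of `ψ` is connected and contains `1` and `ψ t₀ ≠ 1`, whereas a countable subset of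
    -- the plane is totally disconnected.
    have hconn : (Set.range ψ).Countable → False := fun hc => by
      have hpre : IsPreconnected (Set.range ψ) := isPreconnected_range hψ
      have := hpre.image _ continuous_subtype_val.continuousOn
      have hsub := (hc.image ((↑) : Circle → ℂ)).isTotallyDisconnected _ subset_rfl this
      refine ht₀ (Circle.coe_injective (hsub ⟨_, ⟨t₀, rfl⟩, rfl⟩ ⟨_, ⟨0, ?_⟩, rfl⟩))
      simp [ψ]
    have hS : ∀ s ∈ S, φ (Circle.exp s) = Circle.exp s := by
      rintro s ⟨t, ht⟩; rw [← ht, hfix]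
    -- If `S` is dense, `φ` agrees with the identity by continuity. If `S` is cyclic, the image of
    -- `ψ` is countable.
    rcases S.dense_or_cyclic with hd | ⟨a, ha⟩
    · have : (fun s => φ (Circle.exp s)) = fun s => Circle.exp s :=
        Continuous.ext_on hd (Circle.continuous_of_dSmooth hφ) Circle.exp.continuous hS
      ext1 z
      obtain ⟨t, rfl⟩ := Circle.exp_surjective z
      exact congrFun this t
    · refine (hconn ?_).elim
      have hc : (S : Set ℝ).Countable := by
        rw [ha, ← AddSubgroup.zmultiples_eq_closure]
        exact Set.countable_range _
      refine (hc.image Circle.exp).mono ?_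
      rintro _ ⟨t, rfl⟩
      obtain ⟨s, hs⟩ := Circle.exp_surjective (ψ t)
      exact ⟨s, ⟨t, hs.symm⟩, hs⟩

end CircleInvolution

/-! ### The extension of `H_σ` by `U(1)` and the sign action -/

namespace TwistedCentralExtension

variable {G Ghat : Type u} [Group G] [DiffeologicalSpace G] [Group Ghat] [DiffeologicalSpace Ghat]
  (E : TwistedCentralExtension G Ghat)

theorem isDiffeologicalGroup_Hhat [IsDiffeologicalGroup Ghat] : IsDiffeologicalGroup E.Hhat :=
  SemidirectProduct.isDiffeologicalGroup E.smooth_σhat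

theorem dSmooth_incl : DSmooth E.incl := fun n p hp => (E.incl_induction.2 n p).1 hp

theorem dSmooth_toH : DSmooth E.toH := fun n p hp => by
  obtain ⟨h1, h1'⟩ := SemidirectProduct.isPlot_iff.1 hp
  exact SemidirectProduct.isPlot_iff.2 ⟨E.quot_subduction.1.isPlot_comp h1, h1'⟩

theorem dSmooth_inclHhat : DSmooth E.inclHhat := fun _ _ hp =>
  SemidirectProduct.isPlot_iff.2 ⟨E.dSmooth_incl.isPlot_comp hp, isPlot_const⟩

@[simp] theorem inclHhat_left (z : Circle) : (E.inclHhat z).left = E.incl z := rfl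
@[simp] theorem inclHhat_right (z : Circle) : (E.inclHhat z).right = 1 := rfl

theorem isPlot_of_inclHhat {n : ℕ} {p : EuclideanSpace ℝ (Fin n) → Circle}
    (hp : IsPlot (fun t => E.inclHhat (p t))) : IsPlot p :=
  (E.incl_induction.2 n p).2 (SemidirectProduct.isPlot_iff.1 hp).1

theorem inclHhat_injective : Function.Injective E.inclHhat := fun _ _ h =>
  E.incl_induction.1 (congrArg SemidirectProduct.left h)

theorem quot_incl (z : Circle) : E.quot (E.incl z) = 1 := by
  have : E.incl z ∈ E.quot.ker := E.exact ▸ ⟨z, rfl⟩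
  exact this

theorem toH_inclHhat (z : Circle) : E.toH (E.inclHhat z) = 1 :=
  SemidirectProduct.ext (E.quot_incl z) rfl

theorem toH_eq_one_iff {k : E.Hhat} : E.toH k = 1 ↔ ∃ z, k = E.inclHhat z := by
  refine ⟨fun h => ?_, by rintro ⟨z, rfl⟩; exact E.toH_inclHhat z⟩
  have h1 : k.left ∈ E.quot.ker := congrArg SemidirectProduct.left h
  rw [E.exact] at h1
  obtain ⟨z, hz⟩ := h1
  have h2 : k.right = 1 := congrArg SemidirectProduct.right h
  exact ⟨z, SemidirectProduct.ext hz.symm h2⟩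

theorem toH_eq_iff {k l : E.Hhat} : E.toH k = E.toH l ↔ ∃ z, k = E.inclHhat z * l := by
  rw [← mul_inv_eq_one, ← map_inv, ← map_mul, E.toH_eq_one_iff]
  simp only [mul_inv_eq_iff_eq_mul]

theorem toH_surjective : Function.Surjective E.toH := fun h => by
  obtain ⟨g, hg⟩ := E.quot_subduction.2.1 h.left
  exact ⟨⟨g, h.right⟩, SemidirectProduct.ext hg rfl⟩

theorem isSubduction_toH : IsSubduction E.toH := by
  refine ⟨E.dSmooth_toH, E.toH_surjective, fun n p hp t => ?_⟩
  obtain ⟨h1, h1'⟩ := SemidirectProduct.isPlot_iff.1 hp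
  obtain ⟨u, hu, ht, c, hc, hcp⟩ := E.quot_subduction.2.2 n _ h1 t
  refine ⟨u, hu, ht, fun s => ⟨c s, (p s).right⟩, fun m g hg => ?_, fun s => ?_⟩
  · exact SemidirectProduct.isPlot_iff.2 ⟨hc.isPlot_comp hg, h1'.comp_plot hg⟩
  · exact SemidirectProduct.ext (hcp s) rfl

theorem centralAction_mul (ε η : Z2) (z : Circle) :
    E.centralAction (ε * η) z = E.centralAction ε (E.centralAction η z) :=
  E.incl_induction.1 (by simp [incl_centralAction])

theorem centralAction_one (z : Circle) : E.centralAction 1 z = z :=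
  E.incl_induction.1 (by simp [incl_centralAction])

theorem dSmooth_centralAction (ε : Z2) : DSmooth (E.centralAction ε) := fun n p hp => by
  rw [E.incl_induction.2 n]
  have : (E.incl ∘ (E.centralAction ε ∘ p)) = fun t => E.σhat ε (E.incl (p t)) := by
    ext t; exact E.incl_centralAction ε _
  rw [this]
  exact (E.smooth_σhat ε).isPlot_comp (E.dSmooth_incl.isPlot_comp hp)

/-- Centrality of `U(1)` holds in `Ĝ` but not in the semidirect product: the `Z2`-component of `k`
acts on the circle when the two are interchanged. This is the source of the twist in the
coefficients. -/
theorem mul_inclHhat (k : E.Hhat) (z : Circle) :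
    k * E.inclHhat z = E.inclHhat (E.centralAction k.right z) * k := by
  refine SemidirectProduct.ext ?_ ?_
  · rw [SemidirectProduct.mul_left, SemidirectProduct.mul_left, inclHhat_left, inclHhat_left,
      inclHhat_right, map_one, MulAut.one_apply, incl_centralAction, ← incl_centralAction,
      E.incl_central]
  · simp

theorem inclHhat_mul (k : E.Hhat) (z : Circle) :
    E.inclHhat z * k = k * E.inclHhat (E.centralAction (k.right⁻¹) z) := by
  rw [mul_inclHhat, ← centralAction_mul, mul_inv_cancel, centralAction_one]

/-- Every element of `Z2` squares to `1` and hence acts by a smooth involution, so the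
classification of these applies. -/
theorem centralAction_eq (ε : Z2) :
    E.centralAction ε = MonoidHom.id Circle ∨ ∀ z, E.centralAction ε z = z⁻¹ :=
  Circle.eq_id_or_eq_inv _ (E.dSmooth_centralAction ε) fun z => by
    rw [← centralAction_mul, show ε * ε = 1 by revert ε; decide, centralAction_one]

theorem sign_one : E.sign 1 = 1 := if_pos (MonoidHom.ext E.centralAction_one)

theorem sign_mul_self (ε : Z2) : E.sign ε * E.sign ε = 1 := by
  unfold sign; split_ifs <;> rfl

theorem sign_mul (ε η : Z2) : E.sign (ε * η) = E.sign ε * E.sign η := by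
  have key : ∀ ε : Z2, ε = 1 ∨ ε = Multiplicative.ofAdd 1 := by decide
  rcases key ε with rfl | rfl
  · rw [one_mul, sign_one, one_mul]
  · rcases key η with rfl | rfl
    · rw [mul_one, sign_one, mul_one]
    · rw [sign_mul_self, ← sign_one E]; rfl

/-- This justifies the definition of `sign`: by the dichotomy above, an action that is not trivial
is the inversion, which `-1` induces on `ℝ`. -/
theorem exp_sign (ε : Z2) (t : ℝ) :
    Circle.exp (2 * Real.pi * (E.sign ε • t)) = E.centralAction ε (Circle.exp (2 * Real.pi * t)) := by
  unfold sign
  split_ifs with h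
  · simp [h]
  · rcases E.centralAction_eq ε with h' | h'
    · exact absurd h' h
    · simp [h', Circle.exp_neg]

end TwistedCentralExtension

section Bundles

variable {X : Type u} [TopologicalSpace X] [DiffeologicalSpace X]

/-! ### Division in principal bundles -/

namespace PrincipalBundle

variable {H : Type u} [Group H] [DiffeologicalSpace H] {B : Opens X} (P : PrincipalBundle H B)

open Classical in
/-- The element of the structure group that moves `p` to `q`, for `p` and `q` in one fibre. -/
def div (p q : P.carrier) : H :=
  if h : P.proj p = P.proj q then P.exists_div.choose ⟨(p, q), h⟩ else 1

variable {P}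

theorem act_div {p q : P.carrier} (h : P.proj p = P.proj q) : P.act p (P.div p q) = q := by
  rw [div, dif_pos h]
  exact P.exists_div.choose_spec.2 ⟨(p, q), h⟩

theorem div_eq {p q : P.carrier} {k : H} (h : P.act p k = q) : P.div p q = k :=
  P.free p _ _ ((act_div (by rw [← h, P.proj_act])).trans h.symm)

@[simp] theorem div_self (p : P.carrier) : P.div p p = 1 := div_eq (P.act_one p)

theorem div_act_right {p q : P.carrier} (h : P.proj p = P.proj q) (k : H) :
    P.div p (P.act q k) = P.div p q * k :=
  div_eq (by rw [P.act_mul, act_div h])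

theorem act_act_inv (p : P.carrier) (k : H) : P.act (P.act p k) k⁻¹ = p := by
  rw [← P.act_mul, mul_inv_cancel, P.act_one]

theorem isPlot_proj {n : ℕ} {p : EuclideanSpace ℝ (Fin n) → P.carrier} (hp : IsPlot p) :
    IsPlot (fun t => P.proj (p t)) := P.smooth_proj.isPlot_comp hp

theorem isPlot_act {n : ℕ} {p : EuclideanSpace ℝ (Fin n) → P.carrier}
    {k : EuclideanSpace ℝ (Fin n) → H} (hp : IsPlot p) (hk : IsPlot k) :
    IsPlot (fun t => P.act (p t) (k t)) :=
  P.smooth_act.isPlot_comp (hp.prodMk hk)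

theorem isPlot_div {n : ℕ} {p q : EuclideanSpace ℝ (Fin n) → P.carrier} (hp : IsPlot p)
    (hq : IsPlot q) (h : ∀ t, P.proj (p t) = P.proj (q t)) :
    IsPlot (fun t => P.div (p t) (q t)) := by
  have := P.exists_div.choose_spec.1.isPlot_comp ((hp.prodMk hq).subtypeMk h)
  refine (congrArg IsPlot (funext fun t => ?_)).mp this
  rw [div, dif_pos (h t)]

theorem exists_mem_fibre (P : PrincipalBundle H B) {x : X} (hx : x ∈ B) :
    ∃ p : P.carrier, P.proj p = x :=
  let ⟨_, hxV, _, s, _, hs⟩ := P.exists_local_section x hx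
  ⟨s ⟨x, hxV⟩, hs _⟩

end PrincipalBundle

/-! ### Lifts from equivariant maps -/

section Lifts

variable {G Ghat : Type u} [Group G] [DiffeologicalSpace G] [Group Ghat] [DiffeologicalSpace Ghat]
  {E : TwistedCentralExtension G Ghat} {B : Opens X}

/-- A smooth equivariant map over the base from a principal `Ĥ_σ̂`-bundle to a principal
`H_σ`-bundle. -/
structure LiftingMap (Q : PrincipalBundle E.Hhat B) (R : PrincipalBundle E.H B) where
  toFun : Q.carrier → R.carrier
  smooth : DSmooth toFun
  proj_map : ∀ q, R.proj (toFun q) = Q.proj q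
  map_act : ∀ q h, toFun (Q.act q h) = R.act (toFun q) (E.toH h)

namespace LiftingMap

variable {Q : PrincipalBundle E.Hhat B} {R : PrincipalBundle E.H B} (π : LiftingMap Q R)

/-- Points with one image lie in one fibre, and by freeness of `R` the element that moves one to the
other lies in the kernel of `toH`. Hence the quotient of `Q` by `U(1)` maps injectively to `R`. -/
theorem eq_iff {q q' : Q.carrier} :
    π.toFun q = π.toFun q' ↔ ∃ z : Circle, q' = Q.act q (E.inclHhat z) := by
  constructor
  · intro h
    have hp : Q.proj q = Q.proj q' := by rw [← π.proj_map, h, π.proj_map]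
    have h1 : E.toH (Q.div q q') = 1 := by
      apply R.free (π.toFun q)
      rw [← π.map_act, PrincipalBundle.act_div hp, R.act_one, h]
    obtain ⟨z, hz⟩ := E.toH_eq_one_iff.1 h1
    exact ⟨z, by rw [← hz, PrincipalBundle.act_div hp]⟩
  · rintro ⟨z, rfl⟩
    rw [π.map_act, E.toH_inclHhat, R.act_one]

theorem surjective : Function.Surjective π.toFun := fun r => by
  obtain ⟨q, hq⟩ := Q.exists_mem_fibre (R.proj_mem r)
  obtain ⟨k, hk⟩ := E.toH_surjective (R.div (π.toFun q) r)
  exact ⟨Q.act q k, by rw [π.map_act, hk, PrincipalBundle.act_div (by rw [π.proj_map, hq])]⟩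

/-- Plots of the base of a lifting map lift locally. -/
theorem isPlot_of_lift [IsDTopologyCompatible X] {Z : Type*} [DiffeologicalSpace Z] {n : ℕ}
    {r : EuclideanSpace ℝ (Fin n) → R.carrier} (hr : IsPlot r) {f : EuclideanSpace ℝ (Fin n) → Z}
    (h : ∀ (m : ℕ) (g : EuclideanSpace ℝ (Fin m) → EuclideanSpace ℝ (Fin n))
      (c : EuclideanSpace ℝ (Fin m) → Q.carrier), IsPlot g → IsPlot c →
      (∀ x, π.toFun (c x) = r (g x)) → IsPlot (fun x => f (g x))) : IsPlot f := by
  refine isPlot_of_opens (PrincipalBundle.isPlot_proj hr) fun t => ?_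
  obtain ⟨V, htV, _, s, hs, hsp⟩ := Q.exists_local_section _ (R.proj_mem (r t))
  refine ⟨V, htV, fun m g hgV hg => ?_⟩
  have hrg := hr.comp_plot hg
  have hsg := hs.isPlot_comp ((PrincipalBundle.isPlot_proj hrg).subtypeMk hgV)
  have hproj : ∀ x, R.proj (π.toFun (s ⟨R.proj (r (g x)), hgV x⟩)) = R.proj (r (g x)) :=
    fun x => by rw [π.proj_map, hsp]
  -- The plot `r` differs from the image of a local section of `Q` by an `H_σ`-valued plot. Lifting
  -- the latter along the subduction `toH` and translating the section by it lifts `r`.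
  have hκ := PrincipalBundle.isPlot_div (π.smooth.isPlot_comp hsg) hrg hproj
  refine isPlot_of_locally fun x => ?_
  obtain ⟨u, hu, hxu, c, hc, hcp⟩ := E.isSubduction_toH.exists_lift hκ x
  refine ⟨u, hu, hxu, fun l g' hg'u hg' => ?_⟩
  refine h l (fun y => g (g' y)) _ (hg.comp_plot hg')
    (PrincipalBundle.isPlot_act (hsg.comp_plot hg') (hcp l g' hg'u hg')) fun y => ?_
  rw [π.map_act, hc _ (hg'u y), PrincipalBundle.act_div (hproj _)]

/-- The lift defined by an equivariant map. -/
def bundleLift [IsDTopologyCompatible X] : BundleLift R where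
  bundle := Q
  iso := Equiv.ofBijective
    (Quot.lift π.toFun fun _ _ h => π.eq_iff.2 h)
    ⟨by
      rintro ⟨q⟩ ⟨q'⟩ h
      exact Quot.sound (π.eq_iff.1 h),
     fun r => let ⟨q, hq⟩ := π.surjective r; ⟨Quot.mk _ q, hq⟩⟩
  smooth_iso := dSmooth_quot_lift π.smooth _
  -- A plot of `R` lifts locally to `Q`, and the inverse map sends it to the class of any such lift.
  smooth_iso_symm := fun n r hr => by
    refine π.isPlot_of_lift hr fun m g c _ hc hcr => ?_
    refine (congrArg IsPlot (funext fun x => ?_)).mp (dSmooth_quotMk.isPlot_comp hc)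
    rw [Function.comp_apply, ← hcr]
    exact (Equiv.symm_apply_apply (Equiv.ofBijective _ _) _).symm
  proj_iso := π.proj_map
  iso_act := π.map_act

end LiftingMap

/-- The equivariant map that underlies a lift. -/
def BundleLift.map {R : PrincipalBundle E.H B} (L : BundleLift R) : LiftingMap L.bundle R where
  toFun q := L.iso (Quot.mk _ q)
  smooth := L.smooth_iso.comp dSmooth_quotMk
  proj_map := L.proj_iso
  map_act := L.iso_act

end Lifts

/-! ### Sections of local systems -/

section LocalSystems

/-- An action of `Z2` by smooth endomorphisms. -/
structure IsSmoothAction {T : Type} [AddCommGroup T] [DiffeologicalSpace T] (ρ : Z2 → T →+ T) :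
    Prop where
  smooth : ∀ ε, DSmooth (ρ ε)
  one : ∀ t, ρ 1 t = t
  mul : ∀ ε η t, ρ (ε * η) t = ρ ε (ρ η t)

variable {G Ghat : Type u} [Group G] [DiffeologicalSpace G] [Group Ghat] [DiffeologicalSpace Ghat]
  {E : TwistedCentralExtension G Ghat} {P : PrincipalBundle E.H (⊤ : Opens X)}

theorem TwistedCentralExtension.isSmoothAction_circle (E : TwistedCentralExtension G Ghat) :
    IsSmoothAction fun ε => (E.centralAction ε).toAdditive where
  smooth ε := E.dSmooth_centralAction ε
  one := E.centralAction_one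
  mul := E.centralAction_mul

theorem TwistedCentralExtension.isSmoothAction_real (E : TwistedCentralExtension G Ghat) :
    IsSmoothAction fun ε => (zsmulAddGroupHom (E.sign ε) : ℝ →+ ℝ) where
  smooth ε := by
    have : ContDiff ℝ (⊤ : ℕ∞) (fun t : ℝ => (E.sign ε : ℝ) * t) := contDiff_const.mul contDiff_id
    refine (congrArg DSmooth (funext fun t => ?_)).mp this.dSmooth
    simp
  one t := by simp [E.sign_one]
  mul ε η t := by simp [E.sign_mul, mul_assoc]

variable {T : Type} [AddCommGroup T] [DiffeologicalSpace T] [IsDiffeologicalAddGroup T]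
  {ρ : Z2 → T →+ T} {U V : Opens X}

open Classical in
/-- The value of a section of a local system at a point of `P`, extended by zero. -/
def evalAt (p : P.carrier) : (localSystem P ρ).obj (op U) →+ T where
  toFun f := if h : P.proj p ∈ U then (show twistedSections P ρ U from f).1 ⟨p, h⟩ else 0
  map_zero' := by split_ifs <;> rfl
  map_add' f g := by split_ifs <;> [rfl; simp]

theorem evalAt_of_mem (f : (localSystem P ρ).obj (op U)) {p : P.carrier} (h : P.proj p ∈ U) :
    evalAt p f = (show twistedSections P ρ U from f).1 ⟨p, h⟩ := dif_pos h

theorem evalAt_of_notMem (f : (localSystem P ρ).obj (op U)) {p : P.carrier} (h : P.proj p ∉ U) :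
    evalAt p f = 0 := dif_neg h

theorem circleEval_eq (f : (circleSystem P).obj (op U)) {p : P.carrier} (h : P.proj p ∈ U) :
    circleEval f p h = Additive.toMul (evalAt p f) :=
  congrArg Additive.toMul (evalAt_of_mem f h).symm

theorem realEval_eq (f : (realSystem P).obj (op U)) {p : P.carrier} (h : P.proj p ∈ U) :
    realEval f p h = evalAt p f := (evalAt_of_mem f h).symm

theorem intEval_eq (f : (intSystem P).obj (op U)) {p : P.carrier} (h : P.proj p ∈ U) :
    intEval f p h = evalAt p f := (evalAt_of_mem f h).symm

theorem section_ext {f g : (localSystem P ρ).obj (op U)}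
    (h : ∀ p : P.carrier, P.proj p ∈ U → evalAt p f = evalAt p g) : f = g :=
  Subtype.ext (funext fun p => by
    have := h p.1 p.2
    rwa [evalAt_of_mem f p.2, evalAt_of_mem g p.2] at this)

theorem evalAt_res (h : U ≤ V) (f : (localSystem P ρ).obj (op V)) {p : P.carrier}
    (hp : P.proj p ∈ U) : evalAt p (Cech.res (localSystem P ρ) h f) = evalAt p f := by
  rw [evalAt_of_mem _ hp, evalAt_of_mem _ (h hp)]
  rfl

/-- Outside `U` both sides are the default value zero, so no membership hypothesis is needed. -/
theorem evalAt_act (f : (localSystem P ρ).obj (op U)) (p : P.carrier) (k : E.H) :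
    evalAt (P.act p k) f = ρ (k.right⁻¹) (evalAt p f) := by
  by_cases h : P.proj p ∈ U
  · rw [evalAt_of_mem _ h, evalAt_of_mem _ (by rwa [P.proj_act])]
    exact (show twistedSections P ρ U from f).2.2 ⟨p, h⟩ k
  · rw [evalAt_of_notMem _ h, evalAt_of_notMem _ (by rwa [P.proj_act]), map_zero]

theorem isPlot_evalAt (f : (localSystem P ρ).obj (op U)) {n : ℕ}
    {p : EuclideanSpace ℝ (Fin n) → P.carrier} (hp : IsPlot p) (h : ∀ t, P.proj (p t) ∈ U) :
    IsPlot (fun t => evalAt (p t) f) := by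
  have := (show twistedSections P ρ U from f).2.1.isPlot_comp (hp.subtypeMk h)
  refine (congrArg IsPlot (funext fun t => ?_)).mp this
  rw [evalAt_of_mem _ (h t)]

/-- The section of a local system defined by a function on `P`. -/
def sectionMk (f : P.carrier → T)
    (hf : ∀ (n : ℕ) (p : EuclideanSpace ℝ (Fin n) → P.carrier), IsPlot p →
      (∀ t, P.proj (p t) ∈ U) → IsPlot (fun t => f (p t)))
    (hρ : ∀ p k, P.proj p ∈ U → f (P.act p k) = ρ (k.right⁻¹) (f p)) :
    (localSystem P ρ).obj (op U) :=
  (⟨fun p => f p.1, fun n p hp => hf n _ hp.subtypeVal fun t => (p t).2,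
    fun p k => hρ p.1 k p.2⟩ : twistedSections P ρ U)

theorem evalAt_sectionMk {f : P.carrier → T} {hf hρ} {p : P.carrier} (h : P.proj p ∈ U) :
    evalAt p (sectionMk (ρ := ρ) (U := U) f hf hρ) = f p := by
  rw [evalAt_of_mem _ h]; rfl

/-- Two sections that agree along a section of `P` are equal. -/
theorem section_ext_of_section {f g : (localSystem P ρ).obj (op U)} (s : U → P.carrier)
    (hs : ∀ y, P.proj (s y) = y) (h : ∀ y, evalAt (s y) f = evalAt (s y) g) : f = g :=
  section_ext fun p hp => by
    have hy : P.proj (s ⟨P.proj p, hp⟩) = P.proj p := hs _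
    rw [← PrincipalBundle.act_div hy, evalAt_act, evalAt_act, h]

/-- A smooth function on `U` is a section of a local system over `U` in the trivialization defined
by a section of `P`. -/
theorem exists_section_of_trivialization (hρ : IsSmoothAction ρ) (s : U → P.carrier)
    (hs : DSmooth s) (hsp : ∀ y, P.proj (s y) = y) (g : U → T) (hg : DSmooth g) :
    ∃ f : (localSystem P ρ).obj (op U), ∀ y, evalAt (s y) f = g y := by
  classical
  -- Equivariance forces the value `ρ(k⁻¹) g` at the point `s · k`.
  let f : P.carrier → T := fun p => if h : P.proj p ∈ U then
    ρ ((P.div (s ⟨P.proj p, h⟩) p).right⁻¹) (g ⟨P.proj p, h⟩) else 0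
  have hf : ∀ p (h : P.proj p ∈ U), f p =
    ρ ((P.div (s ⟨P.proj p, h⟩) p).right⁻¹) (g ⟨P.proj p, h⟩) := fun p h => dif_pos h
  refine ⟨sectionMk f (fun n p hp h => ?_) fun p k h => ?_, fun y => ?_⟩
  · have hq := (PrincipalBundle.isPlot_proj hp).subtypeMk h
    have hd := (SemidirectProduct.isPlot_iff.1 (PrincipalBundle.isPlot_div (hs.isPlot_comp hq) hp
      fun t => hsp _)).2
    exact (congrArg IsPlot (funext fun t => (hf _ (h t)).symm)).mp
      (Z2.isPlot_apply (ρ := fun ε => ρ ε) hρ.smooth hd.inv (hg.isPlot_comp hq))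
  · have h' : P.proj (P.act p k) ∈ U := by rwa [P.proj_act]
    rw [hf _ h, hf _ h', ← hρ.mul]
    have hy : (⟨P.proj (P.act p k), h'⟩ : U) = ⟨P.proj p, h⟩ := Subtype.ext (P.proj_act p k)
    rw [hy, PrincipalBundle.div_act_right (hsp _), SemidirectProduct.mul_right, mul_inv_rev]
  · have h : P.proj (s y) ∈ U := by rw [hsp]; exact y.2
    have hy : (⟨P.proj (s y), h⟩ : U) = y := Subtype.ext (hsp y)
    rw [evalAt_sectionMk h, hf _ h, hy, PrincipalBundle.div_self, SemidirectProduct.one_right,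
      inv_one, hρ.one]

end LocalSystems

end Bundles

/-! ### Čech classes, changes of index and simultaneous refinement -/

section CechCohomology

variable {X : Type u} [TopologicalSpace X]

namespace PointedCover

instance : Nonempty (PointedCover X) := ⟨⟨fun _ => ⊤, fun _ => trivial⟩⟩

instance : IsDirectedOrder (PointedCover X) where
  directed 𝒰 𝒱 := ⟨⟨fun x => 𝒰.set x ⊓ 𝒱.set x, fun x => ⟨𝒰.mem x, 𝒱.mem x⟩⟩,
    fun _ => inf_le_left, fun _ => inf_le_right⟩

theorem mem_inter {𝒰 : PointedCover X} {n : ℕ} {s : Fin (n + 1) → X} {x : X} :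
    x ∈ 𝒰.inter s ↔ ∀ i, x ∈ 𝒰.set (s i) := by
  simp only [inter, ← SetLike.mem_coe, Opens.coe_finset_inf]
  simp

theorem inter_le_comp {𝒰 𝒱 : PointedCover X} {τ : X → X} (h : ∀ x, 𝒱.set x ≤ 𝒰.set (τ x)) {n : ℕ}
    (s : Fin (n + 1) → X) : 𝒱.inter s ≤ 𝒰.inter (τ ∘ s) :=
  Finset.inf_mono_fun fun i _ => h (s i)

end PointedCover

namespace Cech

variable (F : (Opens X)ᵒᵖ ⥤ AddCommGrpCat.{u})

theorem res_self {U : Opens X} (h : U ≤ U) (a : F.obj (op U)) : res F h a = a := by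
  simp [res]

instance (n : ℕ) : DirectedSystem (fun 𝒰 : PointedCover X => HCover F 𝒰 n)
    fun 𝒰 𝒱 h => refineH F n 𝒰 𝒱 h where
  map_self 𝒰 c := by
    induction c using QuotientAddGroup.induction_on with
    | H c =>
      refine congrArg QuotientAddGroup.mk (Subtype.ext (funext fun s => ?_))
      exact res_self F _ _
  map_map 𝒰 𝒱 𝒲 h k c := by
    induction c using QuotientAddGroup.induction_on with
    | H c =>
      refine congrArg QuotientAddGroup.mk (Subtype.ext (funext fun s => ?_))
      exact res_res F _ _ _

variable {F} {n : ℕ} {𝒰 𝒱 : PointedCover X}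

theorem exists_mk (x : H F n) : ∃ (𝒰 : PointedCover X) (c : cocycles F 𝒰 n), mk F 𝒰 c = x := by
  classical
  induction x using AddCommGroup.DirectLimit.induction_on with
  | ih 𝒰 c =>
    obtain ⟨c, rfl⟩ := QuotientAddGroup.mk_surjective c
    exact ⟨𝒰, c, rfl⟩

theorem mk_refine (h : 𝒰 ≤ 𝒱) (c : cocycles F 𝒰 n) :
    mk F 𝒱 (refineCocycles F h n c) = mk F 𝒰 c := by
  classical
  exact AddCommGroup.DirectLimit.of_f (f := refineH F n) h (QuotientAddGroup.mk c)

theorem mk_add (a b : cocycles F 𝒰 n) : mk F 𝒰 (a + b) = mk F 𝒰 a + mk F 𝒰 b := by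
  classical
  exact map_add (AddCommGroup.DirectLimit.of (fun 𝒰 : PointedCover X => HCover F 𝒰 n)
    (refineH F n) 𝒰) (QuotientAddGroup.mk a) (QuotientAddGroup.mk b)

theorem mk_neg (a : cocycles F 𝒰 n) : mk F 𝒰 (-a) = -mk F 𝒰 a := by
  classical
  exact map_neg (AddCommGroup.DirectLimit.of (fun 𝒰 : PointedCover X => HCover F 𝒰 n)
    (refineH F n) 𝒰) (QuotientAddGroup.mk a)

theorem mk_eq_zero_of_mem {a : cocycles F 𝒰 n} (h : a.1 ∈ coboundaries F 𝒰 n) :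
    mk F 𝒰 a = 0 := by
  have h0 : (QuotientAddGroup.mk a : HCover F 𝒰 n) = 0 :=
    (QuotientAddGroup.eq_zero_iff a).2 (AddSubgroup.mem_addSubgroupOf.2 h)
  rw [mk, h0, map_zero]

theorem mk_eq_of_sub_mem {a b : cocycles F 𝒰 n} (h : a.1 - b.1 ∈ coboundaries F 𝒰 n) :
    mk F 𝒰 a = mk F 𝒰 b := by
  have : mk F 𝒰 (a - b) = 0 := mk_eq_zero_of_mem h
  rw [sub_eq_add_neg, mk_add, mk_neg, ← sub_eq_add_neg] at this
  exact sub_eq_zero.1 this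

theorem exists_refine_of_mk_eq_zero {a : cocycles F 𝒰 n} (h : mk F 𝒰 a = 0) :
    ∃ (𝒱 : PointedCover X) (h : 𝒰 ≤ 𝒱), refine F h n a.1 ∈ coboundaries F 𝒱 n := by
  classical
  obtain ⟨𝒱, hle, h0⟩ := AddCommGroup.DirectLimit.of.zero_exact (f := refineH F n) _ _ h
  exact ⟨𝒱, hle, AddSubgroup.mem_addSubgroupOf.1 ((QuotientAddGroup.eq_zero_iff _).1 h0)⟩

/-- The pullback of cochains along a map of indices. -/
def pullback (F : (Opens X)ᵒᵖ ⥤ AddCommGrpCat.{u}) {τ : X → X} (h : ∀ x, 𝒱.set x ≤ 𝒰.set (τ x))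
    (n : ℕ) : Cochain F 𝒰 n →+ Cochain F 𝒱 n where
  toFun c s := res F (PointedCover.inter_le_comp h s) (c (τ ∘ s))
  map_zero' := by ext s; simp
  map_add' a b := by ext s; simp

theorem d_pullback {τ : X → X} (h : ∀ x, 𝒱.set x ≤ 𝒰.set (τ x)) (n : ℕ) (c : Cochain F 𝒰 n) :
    d F 𝒱 n (pullback F h n c) = pullback F h (n + 1) (d F 𝒰 n c) := by
  ext s
  simp [d, pullback, res_res, Function.comp_assoc]

theorem pullback_mem_cocycles {τ : X → X} (h : ∀ x, 𝒱.set x ≤ 𝒰.set (τ x)) {c : Cochain F 𝒰 n}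
    (hc : c ∈ cocycles F 𝒰 n) : pullback F h n c ∈ cocycles F 𝒱 n := by
  have hc' : d F 𝒰 n c = 0 := hc
  change d F 𝒱 n _ = 0
  rw [d_pullback, hc', map_zero]

end Cech

/-- Simultaneous refinement: a property of open sets that depends on a tuple of members of a cover
and holds locally on the intersections of the cover holds on the intersections of a refinement. -/
theorem PointedCover.exists_refinement [DiffeologicalSpace X] [IsDTopologyCompatible X]
    (hX : HasSmoothPartitionsOfUnity X) (𝒰 : PointedCover X) (n : ℕ)
    (Q : (Fin (n + 1) → X) → Opens X → Prop) (hbot : ∀ s, Q s ⊥)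
    (hmono : ∀ s (V W : Opens X), V ≤ W → Q s W → Q s V)
    (hloc : ∀ s, ∀ x ∈ 𝒰.inter s, ∃ V : Opens X, x ∈ V ∧ Q s V) :
    ∃ (𝒱 : PointedCover X) (τ : X → X), 𝒰 ≤ 𝒱 ∧ (∀ x, 𝒱.set x ≤ 𝒰.set (τ x)) ∧
      ∀ s, Q (τ ∘ s) (𝒱.inter s) := by
  obtain ⟨f, hf, -, hfin, hsupp, hsum⟩ := hX X 𝒰.set fun x => ⟨x, 𝒰.mem x⟩
  have hex : ∀ x, ∃ i, f i x ≠ 0 := fun x => by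
    by_contra! h
    have := hsum x
    simp [h] at this
  -- The index `τ x` belongs to a function that does not vanish at `x`. A neighbourhood of `x` where
  -- it stays nonzero lies in the member of index `τ x`.
  choose τ hτ using hex
  have hV : ∀ x, ∃ V : Opens X, x ∈ V ∧ V ≤ 𝒰.set x ∧ (∀ y ∈ V, f (τ x) y ≠ 0) ∧
      ∀ s : Fin (n + 1) → X, (∀ i, ∃ y ∈ V, f (s i) y ≠ 0) → Q s V := by
    intro x
    obtain ⟨N, hN, hNfin⟩ := hfin x
    set A := {i | (Function.support (f i) ∩ N).Nonempty} with hA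
    have hAfin : A.Finite := hNfin
    -- Only the finitely many indices in `A` have supports meeting `N`. Those whose closed support
    -- misses `x` are removed by shrinking the neighbourhood. For the remaining ones `x` lies in the
    -- member of the cover, so the local hypothesis is applied to finitely many tuples only.
    let B := {i ∈ A | x ∈ closure (Function.support (f i))}
    have hB : B.Finite := hAfin.subset fun i hi => hi.1
    have hS : {s : Fin (n + 1) → X | ∀ i, s i ∈ B}.Finite := Set.Finite.pi' fun _ => hB
    have hQ : ∀ s : Fin (n + 1) → X, (∀ i, s i ∈ B) → ∃ V : Opens X, x ∈ V ∧ Q s V := fun s hs =>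
      hloc s x (PointedCover.mem_inter.2 fun i => hsupp _ (hs i).2)
    choose! V hxV hVQ using hQ
    have h1 : (⋂ s ∈ {s : Fin (n + 1) → X | ∀ i, s i ∈ B}, (V s : Set X)) ∈ nhds x :=
      (Filter.biInter_mem hS).2 fun s hs => (V s).isOpen.mem_nhds (hxV s hs)
    have h2 : (⋂ i ∈ A \ B, (closure (Function.support (f i)))ᶜ) ∈ nhds x :=
      (Filter.biInter_mem (hAfin.subset Set.sdiff_subset)).2 fun i hi =>
        isClosed_closure.isOpen_compl.mem_nhds fun h => hi.2 ⟨hi.1, h⟩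
    have h3 : {y | f (τ x) y ≠ 0} ∈ nhds x :=
      (isOpen_ne.preimage (hf (τ x)).continuous').mem_nhds (hτ x)
    obtain ⟨W, hW, hWo, hxW⟩ := mem_nhds_iff.1 (Filter.inter_mem (Filter.inter_mem hN h1)
      (Filter.inter_mem h2 (Filter.inter_mem h3 ((𝒰.set x).isOpen.mem_nhds (𝒰.mem x)))))
    refine ⟨⟨W, hWo⟩, hxW, fun y hy => (hW hy).2.2.2, fun y hy => (hW hy).2.2.1, fun s hs => ?_⟩
    have hsB : ∀ i, s i ∈ B := fun i => by
      obtain ⟨y, hy, hfy⟩ := hs i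
      have hiA : s i ∈ A := ⟨y, hfy, (hW hy).1.1⟩
      by_contra hiB
      exact Set.mem_iInter₂.1 (hW hy).2.1 (s i) ⟨hiA, hiB⟩ (subset_closure hfy)
    exact hmono s _ _ (fun y hy => Set.mem_iInter₂.1 (hW hy).1.2 s hsB) (hVQ s hsB)
  choose V hxV hVU hVτ hVQ using hV
  refine ⟨⟨V, hxV⟩, τ, hVU, fun x y hy => hsupp _ (subset_closure (hVτ x y hy)), fun s => ?_⟩
  -- At a common point `y`, all functions of index `τ (s i)` are nonzero. The tuple `τ ∘ s` is
  -- therefore one of those controlled by the neighbourhood of `s 0`, and monotonicity passes to the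
  -- intersection. An empty intersection is covered by `hbot`.
  by_cases hne : ∃ y, y ∈ PointedCover.inter ⟨V, hxV⟩ s
  · obtain ⟨y, hy⟩ := hne
    have hy' := PointedCover.mem_inter.1 hy
    refine hmono _ _ (V (s 0)) (Finset.inf_le (Finset.mem_univ 0)) (hVQ _ _ fun i => ?_)
    exact ⟨y, hy' 0, hVτ _ y (hy' i)⟩
  · have : PointedCover.inter ⟨V, hxV⟩ s = ⊥ := by
      ext y
      simpa using fun h => hne ⟨y, h⟩
    rw [this]
    exact hbot _

end CechCohomology

/-! ### Čech simplices given by explicit vertices -/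

section Vectors

variable {X : Type u}

theorem eq_vec_three (s : Fin 3 → X) : s = ![s 0, s 1, s 2] := by ext i; fin_cases i <;> rfl

theorem eq_vec_four (s : Fin 4 → X) : s = ![s 0, s 1, s 2, s 3] := by ext i; fin_cases i <;> rfl

variable [TopologicalSpace X] {𝒰 : PointedCover X}

theorem mem_inter_two {x y a : X} :
    a ∈ 𝒰.inter ![x, y] ↔ a ∈ 𝒰.set x ∧ a ∈ 𝒰.set y := by
  simp [PointedCover.mem_inter, Fin.forall_fin_succ]

theorem mem_inter_three {x y z a : X} :
    a ∈ 𝒰.inter ![x, y, z] ↔ a ∈ 𝒰.set x ∧ a ∈ 𝒰.set y ∧ a ∈ 𝒰.set z := by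
  simp [PointedCover.mem_inter, Fin.forall_fin_succ]

theorem mem_inter_four {x y z w a : X} : a ∈ 𝒰.inter ![x, y, z, w] ↔
    a ∈ 𝒰.set x ∧ a ∈ 𝒰.set y ∧ a ∈ 𝒰.set z ∧ a ∈ 𝒰.set w := by
  simp [PointedCover.mem_inter, Fin.forall_fin_succ]

theorem mem_inter_five {x y z w v a : X} : a ∈ 𝒰.inter ![x, y, z, w, v] ↔
    a ∈ 𝒰.set x ∧ a ∈ 𝒰.set y ∧ a ∈ 𝒰.set z ∧ a ∈ 𝒰.set w ∧ a ∈ 𝒰.set v := by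
  simp [PointedCover.mem_inter, Fin.forall_fin_succ]

end Vectors

/-! ### Čech cochains with values in local systems -/

section LocalSystemCochains

open Cech

variable {X : Type u} [TopologicalSpace X] [DiffeologicalSpace X]
  {G Ghat : Type u} [Group G] [DiffeologicalSpace G] [Group Ghat] [DiffeologicalSpace Ghat]
  {E : TwistedCentralExtension G Ghat} {P : PrincipalBundle E.H (⊤ : Opens X)}
  {T : Type} [AddCommGroup T] [DiffeologicalSpace T] [IsDiffeologicalAddGroup T]
  {ρ : Z2 → T →+ T} {𝒰 𝒱 : PointedCover X}

theorem evalAt_d {n : ℕ} (c : Cochain (localSystem P ρ) 𝒰 n) {s : Fin (n + 2) → X} {p : P.carrier}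
    (hp : P.proj p ∈ 𝒰.inter s) : evalAt p (d _ 𝒰 n c s) =
      ∑ i : Fin (n + 2), (-1 : ℤ) ^ (i : ℕ) • evalAt p (c (s ∘ i.succAbove)) := by
  simp only [d, AddMonoidHom.coe_mk, ZeroHom.coe_mk, map_sum, map_zsmul, evalAt_res _ _ hp]

theorem evalAt_refine (h : 𝒰 ≤ 𝒱) {n : ℕ} (c : Cochain (localSystem P ρ) 𝒰 n)
    {s : Fin (n + 1) → X} {p : P.carrier} (hp : P.proj p ∈ 𝒱.inter s) :
    evalAt p (refine _ h n c s) = evalAt p (c s) :=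
  evalAt_res (PointedCover.inter_mono h s) _ hp

theorem evalAt_pullback {τ : X → X} (h : ∀ x, 𝒱.set x ≤ 𝒰.set (τ x)) {n : ℕ}
    (c : Cochain (localSystem P ρ) 𝒰 n) {s : Fin (n + 1) → X} {p : P.carrier}
    (hp : P.proj p ∈ 𝒱.inter s) : evalAt p (pullback _ h n c s) = evalAt p (c (τ ∘ s)) :=
  evalAt_res (PointedCover.inter_le_comp h s) _ hp

theorem evalAt_d_one (c : Cochain (localSystem P ρ) 𝒰 1) {x y z : X} {p : P.carrier}
    (hp : P.proj p ∈ 𝒰.inter ![x, y, z]) : evalAt p (d _ 𝒰 1 c ![x, y, z]) =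
      evalAt p (c ![y, z]) - evalAt p (c ![x, z]) + evalAt p (c ![x, y]) := by
  have h0 : ![x, y, z] ∘ Fin.succAbove 0 = ![y, z] := by ext i; fin_cases i <;> rfl
  have h1 : ![x, y, z] ∘ Fin.succAbove 1 = ![x, z] := by ext i; fin_cases i <;> rfl
  have h2 : ![x, y, z] ∘ Fin.succAbove 2 = ![x, y] := by ext i; fin_cases i <;> rfl
  rw [evalAt_d c hp, Fin.sum_univ_three, h0, h1, h2]
  simp [sub_eq_add_neg]

theorem evalAt_d_two (c : Cochain (localSystem P ρ) 𝒰 2) {x y z w : X} {p : P.carrier}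
    (hp : P.proj p ∈ 𝒰.inter ![x, y, z, w]) : evalAt p (d _ 𝒰 2 c ![x, y, z, w]) =
      evalAt p (c ![y, z, w]) - evalAt p (c ![x, z, w]) + evalAt p (c ![x, y, w]) -
        evalAt p (c ![x, y, z]) := by
  have h0 : ![x, y, z, w] ∘ Fin.succAbove 0 = ![y, z, w] := by ext i; fin_cases i <;> rfl
  have h1 : ![x, y, z, w] ∘ Fin.succAbove 1 = ![x, z, w] := by ext i; fin_cases i <;> rfl
  have h2 : ![x, y, z, w] ∘ Fin.succAbove 2 = ![x, y, w] := by ext i; fin_cases i <;> rfl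
  have h3 : ![x, y, z, w] ∘ Fin.succAbove 3 = ![x, y, z] := by ext i; fin_cases i <;> rfl
  rw [evalAt_d c hp, Fin.sum_univ_four, h0, h1, h2, h3]
  simp [sub_eq_add_neg, show (-1 : ℤ) ^ 3 = -1 by norm_num]

theorem evalAt_d_three (c : Cochain (localSystem P ρ) 𝒰 3) {x y z w v : X} {p : P.carrier}
    (hp : P.proj p ∈ 𝒰.inter ![x, y, z, w, v]) : evalAt p (d _ 𝒰 3 c ![x, y, z, w, v]) =
      evalAt p (c ![y, z, w, v]) - evalAt p (c ![x, z, w, v]) + evalAt p (c ![x, y, w, v]) -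
        evalAt p (c ![x, y, z, v]) + evalAt p (c ![x, y, z, w]) := by
  have h0 : ![x, y, z, w, v] ∘ Fin.succAbove 0 = ![y, z, w, v] := by ext i; fin_cases i <;> rfl
  have h1 : ![x, y, z, w, v] ∘ Fin.succAbove 1 = ![x, z, w, v] := by ext i; fin_cases i <;> rfl
  have h2 : ![x, y, z, w, v] ∘ Fin.succAbove 2 = ![x, y, w, v] := by ext i; fin_cases i <;> rfl
  have h3 : ![x, y, z, w, v] ∘ Fin.succAbove 3 = ![x, y, z, v] := by ext i; fin_cases i <;> rfl
  have h4 : ![x, y, z, w, v] ∘ Fin.succAbove 4 = ![x, y, z, w] := by ext i; fin_cases i <;> rfl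
  rw [evalAt_d c hp, Fin.sum_univ_five, h0, h1, h2, h3, h4]
  simp [sub_eq_add_neg, show (-1 : ℤ) ^ 3 = -1 by norm_num, show (-1 : ℤ) ^ 4 = 1 by norm_num]

theorem evalAt_cocycle {n : ℕ} {c : Cochain (localSystem P ρ) 𝒰 n} (hc : c ∈ cocycles _ 𝒰 n)
    (s : Fin (n + 2) → X) (p : P.carrier) : evalAt p (d _ 𝒰 n c s) = 0 := by
  have hc' : d _ 𝒰 n c = 0 := hc
  rw [hc']; exact map_zero _

/-- The pullback of a `2`-cocycle along a refinement map does not depend on the map. -/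
theorem pullback_sub_refine_mem_two {τ : X → X} (h : 𝒰 ≤ 𝒱) (hτ : ∀ x, 𝒱.set x ≤ 𝒰.set (τ x))
    {c : Cochain (localSystem P ρ) 𝒰 2} (hc : c ∈ cocycles _ 𝒰 2) :
    pullback _ hτ 2 c - refine _ h 2 c ∈ coboundaries (localSystem P ρ) 𝒱 2 := by
  have le1 : ∀ s : Fin 2 → X, 𝒱.inter s ≤ 𝒰.inter ![s 0, τ (s 0), τ (s 1)] := fun s a ha => by
    have ha := PointedCover.mem_inter.1 ha
    exact mem_inter_three.2 ⟨h _ (ha 0), hτ _ (ha 0), hτ _ (ha 1)⟩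
  have le2 : ∀ s : Fin 2 → X, 𝒱.inter s ≤ 𝒰.inter ![s 0, s 1, τ (s 1)] := fun s a ha => by
    have ha := PointedCover.mem_inter.1 ha
    exact mem_inter_three.2 ⟨h _ (ha 0), h _ (ha 1), hτ _ (ha 1)⟩
  -- The prism operator between the identity and `τ`, on the edge `(s 0, s 1)`: the alternating sum
  -- over the two triangles of the square with top edge `(τ (s 0), τ (s 1))`.
  let b : Cochain (localSystem P ρ) 𝒱 1 := fun s => res _ (le1 s) (c ![s 0, τ (s 0), τ (s 1)]) -
    res _ (le2 s) (c ![s 0, s 1, τ (s 1)])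
  have hb : ∀ (x y : X) (p : P.carrier), P.proj p ∈ 𝒱.set x → P.proj p ∈ 𝒱.set y →
      evalAt p (b ![x, y]) = evalAt p (c ![x, τ x, τ y]) - evalAt p (c ![x, y, τ y]) := by
    intro x y p hx hy
    have hxy := mem_inter_two.2 ⟨hx, hy⟩
    exact (map_sub _ _ _).trans
      (congrArg₂ _ (evalAt_res (le1 _) _ hxy) (evalAt_res (le2 _) _ hxy))
  refine ⟨b, funext fun s => section_ext fun p hp => ?_⟩
  rw [eq_vec_three s] at hp ⊢
  generalize s 0 = x, s 1 = y, s 2 = z at *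
  obtain ⟨hx, hy, hz⟩ := mem_inter_three.1 hp
  have hτv : τ ∘ ![x, y, z] = ![τ x, τ y, τ z] := by ext i; fin_cases i <;> rfl
  rw [evalAt_d_one _ hp, Pi.sub_apply, hb _ _ _ hx hy, hb _ _ _ hx hz, hb _ _ _ hy hz, map_sub,
    evalAt_pullback hτ c hp, evalAt_refine h c hp, hτv]
  -- The cocycle condition on the three tetrahedra that fill the prism over `(x, y, z)`.
  have e1 := evalAt_cocycle hc ![x, τ x, τ y, τ z] p
  have e2 := evalAt_cocycle hc ![x, y, τ y, τ z] p
  have e3 := evalAt_cocycle hc ![x, y, z, τ z] p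
  rw [evalAt_d_two c (mem_inter_four.2 ⟨h _ hx, hτ _ hx, hτ _ hy, hτ _ hz⟩)] at e1
  rw [evalAt_d_two c (mem_inter_four.2 ⟨h _ hx, h _ hy, hτ _ hy, hτ _ hz⟩)] at e2
  rw [evalAt_d_two c (mem_inter_four.2 ⟨h _ hx, h _ hy, h _ hz, hτ _ hz⟩)] at e3
  -- The zero is written as a signed sum of three zeros, so that each can be replaced by the cocycle
  -- condition of one tetrahedron, with its sign in the prism.
  refine sub_eq_zero.1 (Eq.trans ?_ (show -(0 : T) + 0 - 0 = 0 by simp))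
  nth_rewrite 1 [← e1]
  nth_rewrite 1 [← e2]
  rw [← e3]
  abel

/-- The pullback of a `3`-cocycle along a refinement map does not depend on the map. -/
theorem pullback_sub_refine_mem_three {τ : X → X} (h : 𝒰 ≤ 𝒱) (hτ : ∀ x, 𝒱.set x ≤ 𝒰.set (τ x))
    {c : Cochain (localSystem P ρ) 𝒰 3} (hc : c ∈ cocycles _ 𝒰 3) :
    pullback _ hτ 3 c - refine _ h 3 c ∈ coboundaries (localSystem P ρ) 𝒱 3 := by
  have le1 : ∀ s : Fin 3 → X, 𝒱.inter s ≤ 𝒰.inter ![s 0, τ (s 0), τ (s 1), τ (s 2)] :=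
    fun s a ha => by
      have ha := PointedCover.mem_inter.1 ha
      exact mem_inter_four.2 ⟨h _ (ha 0), hτ _ (ha 0), hτ _ (ha 1), hτ _ (ha 2)⟩
  have le2 : ∀ s : Fin 3 → X, 𝒱.inter s ≤ 𝒰.inter ![s 0, s 1, τ (s 1), τ (s 2)] :=
    fun s a ha => by
      have ha := PointedCover.mem_inter.1 ha
      exact mem_inter_four.2 ⟨h _ (ha 0), h _ (ha 1), hτ _ (ha 1), hτ _ (ha 2)⟩
  have le3 : ∀ s : Fin 3 → X, 𝒱.inter s ≤ 𝒰.inter ![s 0, s 1, s 2, τ (s 2)] :=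
    fun s a ha => by
      have ha := PointedCover.mem_inter.1 ha
      exact mem_inter_four.2 ⟨h _ (ha 0), h _ (ha 1), h _ (ha 2), hτ _ (ha 2)⟩
  -- The prism operator one degree higher: three tetrahedra over each triangle. The relations `e1`
  -- to `e4` below come from the four 4-simplices over a tetrahedron.
  let b : Cochain (localSystem P ρ) 𝒱 2 := fun s =>
    res _ (le1 s) (c ![s 0, τ (s 0), τ (s 1), τ (s 2)]) -
    res _ (le2 s) (c ![s 0, s 1, τ (s 1), τ (s 2)]) + res _ (le3 s) (c ![s 0, s 1, s 2, τ (s 2)])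
  have hb : ∀ (x y z : X) (p : P.carrier), P.proj p ∈ 𝒱.set x → P.proj p ∈ 𝒱.set y →
      P.proj p ∈ 𝒱.set z → evalAt p (b ![x, y, z]) = evalAt p (c ![x, τ x, τ y, τ z]) -
        evalAt p (c ![x, y, τ y, τ z]) + evalAt p (c ![x, y, z, τ z]) := by
    intro x y z p hx hy hz
    have hxy := mem_inter_three.2 ⟨hx, hy, hz⟩
    exact (map_add _ _ _).trans (congrArg₂ _ ((map_sub _ _ _).trans
      (congrArg₂ _ (evalAt_res (le1 _) _ hxy) (evalAt_res (le2 _) _ hxy)))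
      (evalAt_res (le3 _) _ hxy))
  refine ⟨b, funext fun s => section_ext fun p hp => ?_⟩
  rw [eq_vec_four s] at hp ⊢
  generalize s 0 = x, s 1 = y, s 2 = z, s 3 = w at *
  obtain ⟨hx, hy, hz, hw⟩ := mem_inter_four.1 hp
  have hτv : τ ∘ ![x, y, z, w] = ![τ x, τ y, τ z, τ w] := by ext i; fin_cases i <;> rfl
  rw [evalAt_d_two _ hp, Pi.sub_apply, hb _ _ _ _ hx hy hz, hb _ _ _ _ hx hy hw,
    hb _ _ _ _ hx hz hw, hb _ _ _ _ hy hz hw, map_sub, evalAt_pullback hτ c hp,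
    evalAt_refine h c hp, hτv]
  have e1 := evalAt_cocycle hc ![x, τ x, τ y, τ z, τ w] p
  have e2 := evalAt_cocycle hc ![x, y, τ y, τ z, τ w] p
  have e3 := evalAt_cocycle hc ![x, y, z, τ z, τ w] p
  have e4 := evalAt_cocycle hc ![x, y, z, w, τ w] p
  rw [evalAt_d_three c (mem_inter_five.2 ⟨h _ hx, hτ _ hx, hτ _ hy, hτ _ hz, hτ _ hw⟩)] at e1
  rw [evalAt_d_three c (mem_inter_five.2 ⟨h _ hx, h _ hy, hτ _ hy, hτ _ hz, hτ _ hw⟩)] at e2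
  rw [evalAt_d_three c (mem_inter_five.2 ⟨h _ hx, h _ hy, h _ hz, hτ _ hz, hτ _ hw⟩)] at e3
  rw [evalAt_d_three c (mem_inter_five.2 ⟨h _ hx, h _ hy, h _ hz, h _ hw, hτ _ hw⟩)] at e4
  refine sub_eq_zero.1 (Eq.trans ?_ (show -(0 : T) + 0 - 0 + 0 = 0 by simp))
  nth_rewrite 1 [← e1]
  nth_rewrite 1 [← e2]
  nth_rewrite 1 [← e3]
  rw [← e4]
  abel

end LocalSystemCochains

/-- The connecting map is available only as a relation, witnessed by a cover, a cocycle and a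
logarithm. Subtracting two related pairs reduces single-valuedness to the case of zero, so no
well-definedness check on choices is required. -/
theorem exists_addEquiv_of_relation {A B : Type*} [AddCommGroup A] [AddCommGroup B]
    (R : A → B → Prop) (hadd : ∀ a a' b b', R a b → R a' b' → R (a + a') (b + b'))
    (hneg : ∀ a b, R a b → R (-a) (-b)) (hleft : ∀ a, ∃ b, R a b) (hright : ∀ b, ∃ a, R a b)
    (h0 : ∀ b, R 0 b → b = 0) (h0' : ∀ a, R a 0 → a = 0) :
    ∃ e : A ≃+ B, ∀ a b, e a = b ↔ R a b := by
  choose f hf using hleft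
  have huniq : ∀ a b b', R a b → R a b' → b = b' := fun a b b' h h' => by
    have := hadd _ _ _ _ h (hneg _ _ h')
    rw [add_neg_cancel] at this
    exact add_neg_eq_zero.1 (h0 _ this)
  have hfadd : ∀ a a', f (a + a') = f a + f a' := fun a a' =>
    huniq _ _ _ (hf _) (hadd _ _ _ _ (hf a) (hf a'))
  refine ⟨AddEquiv.ofBijective (AddMonoidHom.mk' f hfadd) ⟨?_, fun b => ?_⟩, fun a b => ?_⟩
  · rw [injective_iff_map_eq_zero]
    intro a ha
    have := hf a
    exact h0' a (by rwa [show f a = 0 from ha] at this)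
  · obtain ⟨a, ha⟩ := hright b
    exact ⟨a, huniq _ _ _ (hf a) ha⟩
  · exact ⟨fun h => by have := hf a; rwa [show f a = b from h] at this,
      fun h => huniq _ _ _ (hf a) h⟩

/-! ### Smooth maps on open subsets are continuous -/

instance Complex.instIsDTopologyCompatible : IsDTopologyCompatible ℂ := ⟨rfl⟩

/-- Openness is tested in `X`, on plots of `X`. Near a parameter that is mapped into `U`, a plot of
`X` is restricted to a ball inside the preimage of `U` to give a plot of `U`. -/
theorem Diffeology.DSmooth.continuous_of_opens {X Z : Type*} [TopologicalSpace X]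
    [DiffeologicalSpace X] [IsDTopologyCompatible X] [TopologicalSpace Z] [DiffeologicalSpace Z]
    [IsDTopologyCompatible Z] {U : Opens X} {g : U → Z} (hg : DSmooth g) : Continuous g := by
  refine continuous_def.2 fun O hO => ?_
  have key : IsOpen (Subtype.val '' (g ⁻¹' O)) := by
    have h : ∀ W : Set X, (∀ (n : ℕ) (p : EuclideanSpace ℝ (Fin n) → X), IsPlot p →
        IsOpen (p ⁻¹' W)) → IsOpen W := by
      rw [← IsDTopologyCompatible.dTop_eq X]
      exact fun W hW => isOpen_iff_preimages_plots.2 hW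
    refine h _ fun n p hp => isOpen_iff_mem_nhds.2 fun t ht => ?_
    have htU : p t ∈ U := by
      obtain ⟨y, _, hy⟩ := ht
      exact hy ▸ y.2
    obtain ⟨ε, hε, hball⟩ := Metric.isOpen_iff.1 (hp.isOpen_preimage U) t htU
    -- A smooth parametrization of the ball by the whole space, since plots have full Euclidean
    -- domain.
    let b := OpenPartialHomeomorph.univBall t ε
    have hb : ∀ s, p (b s) ∈ U := fun s => hball (by
      have := b.map_source (x := s) (by simp [b])
      rwa [OpenPartialHomeomorph.univBall_target t hε] at this)
    have hpb : IsPlot (fun s => p (b s)) :=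
      hp.comp_plot (OpenPartialHomeomorph.contDiff_univBall).isPlot
    have hgb : IsPlot (fun s => g ⟨p (b s), hb s⟩) := hg.isPlot_comp (hpb.subtypeMk hb)
    have hopen : IsOpen ((fun s => g ⟨p (b s), hb s⟩) ⁻¹' O) := by
      exact hO.preimage hgb.dSmooth.continuous'
    have himg := b.isOpen_image_of_subset_source hopen (by simp [b])
    have hc : b 0 = t := OpenPartialHomeomorph.univBall_apply_zero t ε
    refine Filter.mem_of_superset (himg.mem_nhds ⟨0, ?_, hc⟩) ?_
    · obtain ⟨y, hy, hyt⟩ := ht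
      have : (⟨p (b 0), hb 0⟩ : U) = y := Subtype.ext ((congrArg p hc).trans hyt.symm)
      change g _ ∈ O
      rw [this]; exact hy
    · rintro _ ⟨s, hs, rfl⟩
      exact ⟨_, hs, rfl⟩
  have := key.preimage (continuous_subtype_val (p := (· ∈ U)))
  rwa [Set.preimage_image_eq _ Subtype.val_injective] at this

section ExponentialSequence

open Cech

variable {X : Type u} [TopologicalSpace X] [DiffeologicalSpace X]
  {G Ghat : Type u} [Group G] [DiffeologicalSpace G] [Group Ghat] [DiffeologicalSpace Ghat]
  {E : TwistedCentralExtension G Ghat} {P : PrincipalBundle E.H (⊤ : Opens X)}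

/-! ### Coefficient homomorphisms -/

section Coefficients

variable {T T' : Type} [AddCommGroup T] [DiffeologicalSpace T] [IsDiffeologicalAddGroup T]
  [AddCommGroup T'] [DiffeologicalSpace T'] [IsDiffeologicalAddGroup T']
  {ρ : Z2 → T →+ T} {ρ' : Z2 → T' →+ T'}

/-- A smooth homomorphism compatible with the actions of `Z2`. -/
structure CoefficientHom (ρ : Z2 → T →+ T) (ρ' : Z2 → T' →+ T') where
  hom : T →+ T'
  smooth : DSmooth hom
  comm : ∀ ε t, hom (ρ ε t) = ρ' ε (hom t)

variable (φ : CoefficientHom ρ ρ')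

/-- The image of a section under a homomorphism of coefficients. -/
def mapSection {U : Opens X} (f : (localSystem P ρ).obj (op U)) : (localSystem P ρ').obj (op U) :=
  sectionMk (fun p => φ.hom (evalAt p f))
    (fun _ _ hp h => φ.smooth.isPlot_comp (isPlot_evalAt f hp h))
    fun p k _ => by rw [evalAt_act, φ.comm]

theorem evalAt_mapSection {U : Opens X} (f : (localSystem P ρ).obj (op U)) (p : P.carrier) :
    evalAt p (mapSection φ f) = φ.hom (evalAt p f) := by
  by_cases hp : P.proj p ∈ U
  · exact evalAt_sectionMk hp
  · rw [evalAt_of_notMem _ hp, evalAt_of_notMem _ hp, map_zero]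

/-- The map on sections induced by a homomorphism of coefficients. -/
def sectionMap (U : Opens X) : (localSystem P ρ).obj (op U) →+ (localSystem P ρ').obj (op U) :=
  AddMonoidHom.mk' (mapSection φ) fun f g => section_ext fun p _ => by
    rw [map_add, evalAt_mapSection, evalAt_mapSection, evalAt_mapSection, map_add, map_add]

@[simp] theorem evalAt_sectionMap {U : Opens X} (f : (localSystem P ρ).obj (op U)) (p : P.carrier) :
    evalAt p (sectionMap φ U f) = φ.hom (evalAt p f) := evalAt_mapSection φ f p

variable {𝒰 𝒱 : PointedCover X} {n : ℕ}

/-- The map on cochains induced by a homomorphism of coefficients. -/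
def cochainMap : Cochain (localSystem P ρ) 𝒰 n →+ Cochain (localSystem P ρ') 𝒰 n where
  toFun c s := sectionMap φ _ (c s)
  map_zero' := by ext s : 1; simp
  map_add' a b := by ext s : 1; simp

theorem evalAt_cochainMap (c : Cochain (localSystem P ρ) 𝒰 n) (s : Fin (n + 1) → X)
    (p : P.carrier) : evalAt p (cochainMap φ c s) = φ.hom (evalAt p (c s)) :=
  evalAt_sectionMap φ _ p

theorem d_cochainMap (c : Cochain (localSystem P ρ) 𝒰 n) :
    d _ 𝒰 n (cochainMap φ c) = cochainMap φ (d _ 𝒰 n c) :=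
  funext fun s => section_ext fun p hp => by
    simp only [evalAt_cochainMap, evalAt_d _ hp, map_sum, map_zsmul]

theorem refine_cochainMap (h : 𝒰 ≤ 𝒱) (c : Cochain (localSystem P ρ) 𝒰 n) :
    refine _ h n (cochainMap φ c) = cochainMap φ (refine _ h n c) :=
  funext fun s => section_ext fun p hp => by
    simp only [evalAt_cochainMap, evalAt_refine _ _ hp]

theorem pullback_cochainMap {τ : X → X} (h : ∀ x, 𝒱.set x ≤ 𝒰.set (τ x))
    (c : Cochain (localSystem P ρ) 𝒰 n) :
    pullback _ h n (cochainMap φ c) = cochainMap φ (pullback _ h n c) :=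
  funext fun s => section_ext fun p hp => by
    simp only [evalAt_cochainMap, evalAt_pullback _ _ hp]

theorem cochainMap_injective (hφ : Function.Injective φ.hom) :
    Function.Injective (cochainMap φ : Cochain (localSystem P ρ) 𝒰 n → _) := fun a b h =>
  funext fun s => section_ext fun p _ => hφ (by
    rw [← evalAt_cochainMap, ← evalAt_cochainMap, h])

end Coefficients

variable (E) in
/-- The inclusion `ℤ_α → ℝ_α`. -/
def TwistedCentralExtension.intCoeff : CoefficientHom
    (fun ε => (zsmulAddGroupHom (E.sign ε) : ℤ →+ ℤ))
    (fun ε => (zsmulAddGroupHom (E.sign ε) : ℝ →+ ℝ)) where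
  hom := Int.castAddHom ℝ
  smooth := fun _ _ hp => hp
  comm ε t := by simp

variable (E) in
/-- The exponential map `ℝ_α → U(1)_α`, `t ↦ exp (2πit)`. -/
def TwistedCentralExtension.expCoeff : CoefficientHom
    (fun ε => (zsmulAddGroupHom (E.sign ε) : ℝ →+ ℝ))
    (fun ε => (E.centralAction ε).toAdditive) where
  hom := Circle.expHom.comp (AddMonoidHom.mulLeft (2 * Real.pi))
  smooth := fun _ _ hp => Circle.dSmooth_exp.isPlot_comp (contDiff_const.mul hp.contDiff).isPlot
  comm ε t := congrArg Additive.ofMul (E.exp_sign ε t)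

theorem toMul_expCoeff (t : ℝ) :
    Additive.toMul (E.expCoeff.hom t) = Circle.exp (2 * Real.pi * t) := rfl

theorem expCoeff_eq_zero {t : ℝ} (h : E.expCoeff.hom t = 0) : ∃ m : ℤ, (m : ℝ) = t := by
  have h' : Circle.exp (2 * Real.pi * t) = 1 := h
  rw [Circle.exp_eq_one] at h'
  obtain ⟨m, hm⟩ := h'
  refine ⟨m, ?_⟩
  have := Real.pi_pos
  field_simp at hm
  linarith

theorem expCoeff_intCoeff (m : ℤ) : E.expCoeff.hom (E.intCoeff.hom m) = 0 := by
  change Circle.exp (2 * Real.pi * m) = 1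
  rw [mul_comm]; exact Circle.exp_int_mul_two_pi m

theorem intCoeff_injective : Function.Injective E.intCoeff.hom := Int.cast_injective

/-- Exactness of the exponential sequence at `ℝ_α`. -/
theorem exists_intCochain {𝒰 : PointedCover X} {n : ℕ} (r : Cochain (realSystem P) 𝒰 n)
    (h : cochainMap E.expCoeff r = 0) :
    ∃ m : Cochain (intSystem P) 𝒰 n, cochainMap E.intCoeff m = r := by
  have h1 : ∀ s p, E.expCoeff.hom (evalAt p (r s)) = 0 := fun s p => by
    rw [← evalAt_cochainMap, h]; exact map_zero _
  choose m hm using fun s p => expCoeff_eq_zero (h1 s p)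
  have hm' : ∀ s p, E.intCoeff.hom (m s p) = evalAt p (r s) := hm
  refine ⟨fun s => sectionMk (m s) (fun n p hp hs => ?_) fun p k hp => ?_, ?_⟩
  · have := isPlot_evalAt (r s) hp hs
    have h2 : IsPlot (fun t => ((m s (p t) : ℤ) : ℝ)) :=
      (congrArg IsPlot (funext fun t => (hm s (p t)).symm)).mp this
    exact h2
  · apply intCoeff_injective (E := E)
    rw [hm', evalAt_act, E.intCoeff.comm, hm']
  · refine funext fun s => section_ext fun p hp => ?_
    rw [evalAt_cochainMap, ← hm']
    exact congrArg E.intCoeff.hom (evalAt_sectionMk hp)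

theorem exp_intCochain {𝒰 : PointedCover X} {n : ℕ} (m : Cochain (intSystem P) 𝒰 n) :
    cochainMap E.expCoeff (cochainMap E.intCoeff m) = 0 :=
  funext fun s => section_ext fun p _ => by
    rw [evalAt_cochainMap, evalAt_cochainMap, expCoeff_intCoeff]; exact (map_zero _).symm

/-- Local logarithms of sections of `U(1)_α`. -/
theorem exists_local_log [IsDTopologyCompatible X] {U : Opens X}
    (f : (circleSystem P).obj (op U)) {x : X} (hx : x ∈ U) :
    ∃ (V : Opens X) (hV : V ≤ U), x ∈ V ∧ ∃ r : (realSystem P).obj (op V),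
      sectionMap E.expCoeff V r = res _ hV f := by
  obtain ⟨V, hxV, -, s, hs, hsp⟩ := P.exists_local_section x trivial
  let g : (V ⊓ U : Opens X) → Circle := fun y => Additive.toMul (evalAt (s ⟨y, y.2.1⟩) f)
  have hg : DSmooth g := fun n p hp =>
    isPlot_evalAt f (hs.isPlot_comp (hp.subtypeVal.subtypeMk fun t => (p t).2.1))
      fun t => by rw [hsp]; exact (p t).2.2
  let x' : (V ⊓ U : Opens X) := ⟨x, hxV, hx⟩
  have hg' : DSmooth (fun y => (g y : ℂ) * ((g x')⁻¹ : ℂ)) := fun n p hp =>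
    ((show IsPlot (fun t => (g (p t) : ℂ)) from hg n p hp).contDiff.mul contDiff_const).isPlot
  -- Dividing by the value at `x` moves it to `1`; on `W` the quotient avoids the branch cut of the
  -- logarithm.
  let W : Opens X := ⟨Subtype.val '' {y | (g y : ℂ) * ((g x')⁻¹ : ℂ) ∈ Complex.slitPlane},
    (V ⊓ U).isOpen.isOpenMap_subtype_val _
      (Complex.isOpen_slitPlane.preimage hg'.continuous_of_opens)⟩
  have hWVU : W ≤ V ⊓ U := by rintro _ ⟨y, _, rfl⟩; exact y.2
  have hW : ∀ y : W, (g ⟨y, hWVU y.2⟩ : ℂ) * ((g x')⁻¹ : ℂ) ∈ Complex.slitPlane := by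
    rintro ⟨_, y, hy, rfl⟩; exact hy
  obtain ⟨θ, hθ⟩ := Circle.exp_surjective (g x')
  -- The angle `θ` of the value at `x` is added back, and the factor `2π` is the normalization of
  -- the exponential sequence.
  let r : W → ℝ := fun y =>
    (θ + (Complex.log ((g ⟨y, hWVU y.2⟩ : ℂ) * ((g x')⁻¹ : ℂ))).im) / (2 * Real.pi)
  have hr : DSmooth r := fun n p hp => by
    have h1 := (hg'.isPlot_comp (hp.subtypeVal.subtypeMk fun t => hWVU (p t).2)).contDiff
    have h2 : ContDiff ℝ (⊤ : ℕ∞) fun t =>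
        Complex.log ((g ⟨p t, hWVU (p t).2⟩ : ℂ) * ((g x')⁻¹ : ℂ)) :=
      contDiff_iff_contDiffAt.2 fun t =>
        (((Complex.contDiffAt_log (hW (p t))).restrict_scalars ℝ).comp t h1.contDiffAt :)
    exact ((contDiff_const.add (Complex.imCLM.contDiff.comp h2)).div_const _).isPlot
  have hexp : ∀ y : W, Circle.exp (2 * Real.pi * r y) = g ⟨y, hWVU y.2⟩ := fun y => by
    have : 2 * Real.pi * r y =
        θ + (Complex.log (((g ⟨y, hWVU y.2⟩ * (g x')⁻¹ : Circle) : ℂ))).im := by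
      simp only [r, Circle.coe_mul, Circle.coe_inv]
      field_simp [Real.pi_ne_zero]
    rw [this, Circle.exp_add, hθ, Complex.log_im, Circle.exp_arg, mul_comm, inv_mul_cancel_right]
  have hsW : DSmooth (fun y : W => s ⟨y, (hWVU y.2).1⟩) := fun n p hp =>
    hs.isPlot_comp (hp.subtypeVal.subtypeMk fun t => (hWVU (p t).2).1)
  obtain ⟨R, hR⟩ := exists_section_of_trivialization (P := P) E.isSmoothAction_real
    (fun y : W => s ⟨y, (hWVU y.2).1⟩) hsW (fun y => hsp _) r hr
  refine ⟨W, hWVU.trans inf_le_right, ⟨x', ?_, rfl⟩, R,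
    section_ext_of_section (fun y : W => s ⟨y, (hWVU y.2).1⟩) (fun y => hsp _) fun y => ?_⟩
  · change (g x' : ℂ) * ((g x')⁻¹ : ℂ) ∈ Complex.slitPlane
    rw [mul_inv_cancel₀ (Circle.coe_ne_zero _)]
    exact Complex.one_mem_slitPlane
  · rw [evalAt_sectionMap, hR, evalAt_res _ _ (by rw [hsp]; exact y.2)]
    exact congrArg Additive.ofMul (hexp y)

/-- Cochains with values in `U(1)_α` lift to `ℝ_α` along a refinement. -/
theorem exists_log_cochain [IsDTopologyCompatible X] (hX : HasSmoothPartitionsOfUnity X)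
    {𝒰 : PointedCover X} {n : ℕ} (c : Cochain (circleSystem P) 𝒰 n) :
    ∃ (𝒱 : PointedCover X) (τ : X → X) (_ : 𝒰 ≤ 𝒱) (hτ : ∀ x, 𝒱.set x ≤ 𝒰.set (τ x))
      (r : Cochain (realSystem P) 𝒱 n), cochainMap E.expCoeff r = pullback _ hτ n c := by
  -- The open set in the predicate is not required to lie in `𝒰.inter s`, so membership there is a
  -- hypothesis on points. It is discharged at the end by the inclusion of intersections along `τ`.
  obtain ⟨𝒱, τ, h, hτ, hQ⟩ := 𝒰.exists_refinement hX n
    (fun s V => ∃ r : (realSystem P).obj (op V), ∀ p : P.carrier, P.proj p ∈ V →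
      P.proj p ∈ 𝒰.inter s → E.expCoeff.hom (evalAt p r) = evalAt p (c s))
    (fun s => ⟨0, fun p hp => hp.elim⟩)
    (fun s V W hVW ⟨r, hr⟩ => ⟨res _ hVW r, fun p hp hp' => by
      rw [evalAt_res _ _ hp, hr p (hVW hp) hp']⟩)
    (fun s x hx => by
      obtain ⟨V, hV, hxV, r, hr⟩ := exists_local_log (c s) hx
      refine ⟨V, hxV, r, fun p hp _ => ?_⟩
      rw [← evalAt_sectionMap, hr, evalAt_res _ _ hp])
  choose r hr using hQ
  refine ⟨𝒱, τ, h, hτ, r, funext fun s => section_ext fun p hp => ?_⟩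
  rw [evalAt_cochainMap, evalAt_pullback hτ _ hp,
    hr s p hp (PointedCover.inter_le_comp hτ s hp)]

theorem cons_comp_succAbove_succ {α : Type*} {n : ℕ} (a : α) (s : Fin (n + 1) → α)
    (k : Fin (n + 1)) :
    (Fin.cons a s : Fin (n + 2) → α) ∘ k.succ.succAbove = Fin.cons a (s ∘ k.succAbove) := by
  funext j
  refine Fin.cases ?_ (fun j => ?_) j
  · simp
  · simp

/-- Čech cocycles with values in `ℝ_α` of positive degree are coboundaries. -/
theorem exists_d_eq_of_real_cocycle [IsDTopologyCompatible X] (hX : HasSmoothPartitionsOfUnity X)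
    {𝒰 : PointedCover X} {n : ℕ} {z : Cochain (realSystem P) 𝒰 (n + 1)}
    (hz : z ∈ cocycles (realSystem P) 𝒰 (n + 1)) :
    ∃ r : Cochain (realSystem P) 𝒰 n, d _ 𝒰 n r = z := by
  obtain ⟨f, hf, -, hfin, hsupp, hsum⟩ := hX X 𝒰.set fun x => ⟨x, 𝒰.mem x⟩
  have hpt : ∀ (p : P.carrier) (e : X → ℝ),
      (Function.support fun i => f i (P.proj p) * e i) ⊆ {i | f i (P.proj p) ≠ 0} :=
    fun p e i hi => left_ne_zero_of_mul hi
  have hptf : ∀ p : P.carrier, {i | f i (P.proj p) ≠ 0}.Finite := fun p =>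
    hfin.point_finite (P.proj p)
  have hmem : ∀ {s : Fin (n + 1) → X} {x : X} {i : X}, x ∈ 𝒰.inter s → x ∈ 𝒰.set i →
      x ∈ 𝒰.inter (Fin.cons i s : Fin (n + 2) → X) := fun hs hi =>
    PointedCover.mem_inter.2 fun j => Fin.cases hi (PointedCover.mem_inter.1 hs) j
  -- The contracting homotopy of a fine sheaf: the average of `z` on the cones `(i, s)` with the
  -- weights `f i`.
  let r : Cochain (realSystem P) 𝒰 n := fun s => sectionMk
    (fun p => ∑ᶠ i, f i (P.proj p) * evalAt p (z (Fin.cons i s))) (fun m p hp hs => by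
      refine isPlot_of_opens (PrincipalBundle.isPlot_proj hp) fun t => ?_
      obtain ⟨N, hN, hNfin⟩ := hfin (P.proj (p t))
      obtain ⟨V, hVN, hVo, htV⟩ := mem_nhds_iff.1 hN
      refine ⟨⟨V, hVo⟩, htV, fun l g hg hgs => ?_⟩
      have hpg := hp.comp_plot hgs
      have hsupp' : ∀ x, (Function.support fun i => f i (P.proj (p (g x))) *
          evalAt (p (g x)) (z (Fin.cons i s))) ⊆ hNfin.toFinset := fun x i hi => by
        simp only [Set.Finite.coe_toFinset, Set.mem_ofPred_eq]
        exact ⟨_, left_ne_zero_of_mul hi, hVN (hg x)⟩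
      have heq : ((fun t => ∑ᶠ i, f i (P.proj (p t)) * evalAt (p t) (z (Fin.cons i s))) ∘ g) =
          fun x => ∑ i ∈ hNfin.toFinset, f i (P.proj (p (g x))) *
            evalAt (p (g x)) (z (Fin.cons i s)) :=
        funext fun x => finsum_eq_sum_of_support_subset _ (hsupp' x)
      rw [heq]
      refine (ContDiff.sum fun i _ => IsPlot.contDiff ?_).isPlot
      refine isPlot_of_opens (PrincipalBundle.isPlot_proj hpg) fun x => ?_
      -- The value of `z` on the cone is controlled only inside the member of index `i`. Off the
      -- closed support of `f i` the product vanishes, and these two open sets cover.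
      by_cases hi : P.proj (p (g x)) ∈ 𝒰.set i
      · refine ⟨𝒰.set i, hi, fun l' g' hg' hgs' => ?_⟩
        have hq := hpg.comp_plot hgs'
        exact (((hf i).isPlot_comp (PrincipalBundle.isPlot_proj hq)).contDiff.mul
          (isPlot_evalAt _ hq fun y => hmem (hs _) (hg' y)).contDiff).isPlot
      · refine ⟨⟨(closure (Function.support (f i)))ᶜ, isClosed_closure.isOpen_compl⟩,
          fun h => hi (hsupp i h), fun l' g' hg' hgs' => ?_⟩
        refine (congrArg IsPlot (funext fun y => ?_)).mp (isPlot_const (x := (0 : ℝ)))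
        have : f i (P.proj (p (g (g' y)))) = 0 := by
          by_contra h
          exact hg' y (subset_closure h)
        simp [this])
    (fun p k _ => by
      have := (zsmulAddGroupHom (E.sign (k.right⁻¹)) : ℝ →+ ℝ).map_finsum
        ((hptf p).subset (hpt p fun i => evalAt p (z (Fin.cons i s))))
      rw [this]
      refine finsum_congr fun i => ?_
      rw [P.proj_act, evalAt_act]
      simp only [zsmulAddGroupHom_apply, mul_smul_comm])
  refine ⟨r, funext fun s => section_ext fun p hp => ?_⟩
  have hr : ∀ k : Fin (n + 2), evalAt p (r (s ∘ k.succAbove)) = ∑ i ∈ (hptf p).toFinset,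
      f i (P.proj p) * evalAt p (z (Fin.cons i (s ∘ k.succAbove))) := fun k =>
    (evalAt_sectionMk (𝒰.inter_le s k hp)).trans
      (finsum_eq_sum_of_support_subset _ (by simpa using hpt p _))
  have hone : ∑ i ∈ (hptf p).toFinset, f i (P.proj p) = 1 := by
    rw [← hsum (P.proj p)]
    refine (finsum_eq_sum_of_support_subset _ ?_).symm
    simp
  rw [evalAt_d _ hp]
  simp only [hr, Finset.smul_sum]
  rw [Finset.sum_comm]
  rw [← one_mul (evalAt p (z s)), ← hone, Finset.sum_mul]
  refine Finset.sum_congr rfl fun i hi => ?_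
  have hi' : P.proj p ∈ 𝒰.set i := hsupp i (subset_closure (by simpa using hi))
  -- The cocycle condition on the cone `(i, s)` writes `z s` as the alternating sum of `z` over the
  -- cones on the faces of `s`. Since the weights sum to `1`, averaging over `i` recovers `z s`.
  have hc := evalAt_cocycle hz (Fin.cons i s) p
  have hmem' : P.proj p ∈ 𝒰.inter (Fin.cons i s : Fin (n + 3) → X) :=
    PointedCover.mem_inter.2 fun j => Fin.cases hi' (PointedCover.mem_inter.1 hp) j
  rw [evalAt_d _ hmem', Fin.sum_univ_succ] at hc
  simp only [Fin.val_zero, pow_zero, one_smul, Fin.val_succ,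
    pow_succ, mul_neg, mul_one, neg_smul, Finset.sum_neg_distrib] at hc
  have hcons : (Fin.cons i s : Fin (n + 3) → X) ∘ Fin.succAbove 0 = s := by
    funext j; simp
  rw [hcons, add_neg_eq_zero] at hc
  rw [hc, Finset.mul_sum]
  refine Finset.sum_congr rfl fun k _ => (mul_smul_comm _ _ _).symm.trans ?_
  have hk : evalAt p (z ((Fin.cons i s : Fin (n + 3) → X) ∘ k.succ.succAbove)) =
      evalAt p (z (Fin.cons i (s ∘ k.succAbove))) := by
    rw [cons_comp_succAbove_succ]
  exact congrArg (fun t => f i (P.proj p) * (-1 : ℤ) ^ (k : ℕ) • t) hk.symm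

/-! ### The connecting isomorphism -/

/-- As identities of cochains, the pointwise conditions can be carried along refinements, pullbacks
and differentials. -/
theorem isConnecting_iff {c : H (circleSystem P) 2} {e : H (intSystem P) 3} :
    IsConnecting P c e ↔ ∃ (𝒰 : PointedCover X) (a : cocycles (circleSystem P) 𝒰 2)
      (r : Cochain (realSystem P) 𝒰 2) (z : cocycles (intSystem P) 𝒰 3),
      mk _ 𝒰 a = c ∧ mk _ 𝒰 z = e ∧ cochainMap E.expCoeff r = a.1 ∧
        d _ 𝒰 2 r = cochainMap E.intCoeff z.1 := by
  refine exists_congr fun 𝒰 => exists_congr fun a => exists_congr fun r => exists_congr fun z =>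
    and_congr_right fun _ => and_congr_right fun _ => and_congr ⟨fun h => ?_, fun h s p hp => ?_⟩
      ⟨fun h => ?_, fun h s p hp => ?_⟩
  · refine funext fun s => section_ext fun p hp => ?_
    have := h s p hp
    rw [realEval_eq, circleEval_eq] at this
    rw [evalAt_cochainMap]
    exact congrArg Additive.ofMul this
  · rw [realEval_eq, circleEval_eq, ← h, evalAt_cochainMap, toMul_expCoeff]
  · refine funext fun s => section_ext fun p hp => ?_
    have := h s p hp
    rw [realEval_eq, intEval_eq] at this
    rw [evalAt_cochainMap]
    exact this
  · rw [realEval_eq, intEval_eq, h, evalAt_cochainMap]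
    rfl

theorem cochainMap_mem_cocycles {T T' : Type} [AddCommGroup T] [DiffeologicalSpace T]
    [IsDiffeologicalAddGroup T] [AddCommGroup T'] [DiffeologicalSpace T']
    [IsDiffeologicalAddGroup T'] {ρ : Z2 → T →+ T} {ρ' : Z2 → T' →+ T'}
    (φ : CoefficientHom ρ ρ') (hφ : Function.Injective φ.hom) {𝒰 : PointedCover X} {n : ℕ}
    {c : Cochain (localSystem P ρ) 𝒰 n} :
    cochainMap φ c ∈ cocycles (localSystem P ρ') 𝒰 n ↔ c ∈ cocycles (localSystem P ρ) 𝒰 n := by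
  change d _ 𝒰 n _ = 0 ↔ d _ 𝒰 n _ = 0
  rw [d_cochainMap]
  exact map_eq_zero_iff _ (cochainMap_injective φ hφ)

theorem d_d_one {T : Type} [AddCommGroup T] [DiffeologicalSpace T] [IsDiffeologicalAddGroup T]
    {ρ : Z2 → T →+ T} {𝒰 : PointedCover X} (r : Cochain (localSystem P ρ) 𝒰 1) :
    d _ 𝒰 2 (d _ 𝒰 1 r) = 0 := by
  refine funext fun s => section_ext fun p hp => ?_
  obtain ⟨x, y, z, w, rfl⟩ : ∃ x y z w, s = ![x, y, z, w] := ⟨_, _, _, _, eq_vec_four s⟩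
  obtain ⟨hx, hy, hz, hw⟩ := mem_inter_four.1 hp
  rw [evalAt_d_two _ hp, evalAt_d_one _ (mem_inter_three.2 ⟨hx, hy, hz⟩),
    evalAt_d_one _ (mem_inter_three.2 ⟨hx, hy, hw⟩),
    evalAt_d_one _ (mem_inter_three.2 ⟨hx, hz, hw⟩),
    evalAt_d_one _ (mem_inter_three.2 ⟨hy, hz, hw⟩)]
  refine Eq.trans ?_ (map_zero (evalAt p)).symm
  abel

theorem d_d_two {T : Type} [AddCommGroup T] [DiffeologicalSpace T] [IsDiffeologicalAddGroup T]
    {ρ : Z2 → T →+ T} {𝒰 : PointedCover X} (r : Cochain (localSystem P ρ) 𝒰 2) :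
    d _ 𝒰 3 (d _ 𝒰 2 r) = 0 := by
  refine funext fun s => section_ext fun p hp => ?_
  obtain ⟨x, y, z, w, v, rfl⟩ : ∃ x y z w v, s = ![x, y, z, w, v] :=
    ⟨s 0, s 1, s 2, s 3, s 4, by ext i; fin_cases i <;> rfl⟩
  obtain ⟨hx, hy, hz, hw, hv⟩ := mem_inter_five.1 hp
  rw [evalAt_d_three _ hp, evalAt_d_two _ (mem_inter_four.2 ⟨hx, hy, hz, hw⟩),
    evalAt_d_two _ (mem_inter_four.2 ⟨hx, hy, hz, hv⟩),
    evalAt_d_two _ (mem_inter_four.2 ⟨hx, hy, hw, hv⟩),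
    evalAt_d_two _ (mem_inter_four.2 ⟨hx, hz, hw, hv⟩),
    evalAt_d_two _ (mem_inter_four.2 ⟨hy, hz, hw, hv⟩)]
  refine Eq.trans ?_ (map_zero (evalAt p)).symm
  abel

/-- By the prism homotopy, the index map produced by a simultaneous refinement has no effect on
classes. -/
theorem mk_pullback_two {T : Type} [AddCommGroup T] [DiffeologicalSpace T]
    [IsDiffeologicalAddGroup T] {ρ : Z2 → T →+ T} {𝒰 𝒱 : PointedCover X} {τ : X → X} (h : 𝒰 ≤ 𝒱)
    (hτ : ∀ x, 𝒱.set x ≤ 𝒰.set (τ x)) (c : cocycles (localSystem P ρ) 𝒰 2) :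
    mk _ 𝒱 ⟨pullback _ hτ 2 c.1, pullback_mem_cocycles hτ c.2⟩ = mk _ 𝒰 c :=
  (mk_eq_of_sub_mem (pullback_sub_refine_mem_two h hτ c.2)).trans (mk_refine h c)

theorem mk_pullback_three {T : Type} [AddCommGroup T] [DiffeologicalSpace T]
    [IsDiffeologicalAddGroup T] {ρ : Z2 → T →+ T} {𝒰 𝒱 : PointedCover X} {τ : X → X} (h : 𝒰 ≤ 𝒱)
    (hτ : ∀ x, 𝒱.set x ≤ 𝒰.set (τ x)) (c : cocycles (localSystem P ρ) 𝒰 3) :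
    mk _ 𝒱 ⟨pullback _ hτ 3 c.1, pullback_mem_cocycles hτ c.2⟩ = mk _ 𝒰 c :=
  (mk_eq_of_sub_mem (pullback_sub_refine_mem_three h hτ c.2)).trans (mk_refine h c)

namespace IsConnecting

theorem neg {c : H (circleSystem P) 2} {e : H (intSystem P) 3} (h : IsConnecting P c e) :
    IsConnecting P (-c) (-e) := by
  obtain ⟨𝒰, a, r, z, rfl, rfl, h1, h2⟩ := isConnecting_iff.1 h
  exact isConnecting_iff.2 ⟨𝒰, -a, -r, -z, mk_neg _, mk_neg _, by rw [map_neg, h1]; rfl,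
    by rw [map_neg, h2]; exact (map_neg _ _).symm⟩

theorem add {c c' : H (circleSystem P) 2} {e e' : H (intSystem P) 3} (h : IsConnecting P c e)
    (h' : IsConnecting P c' e') : IsConnecting P (c + c') (e + e') := by
  obtain ⟨𝒰, a, r, z, rfl, rfl, h1, h2⟩ := isConnecting_iff.1 h
  obtain ⟨𝒰', a', r', z', rfl, rfl, h1', h2'⟩ := isConnecting_iff.1 h'
  obtain ⟨𝒱, k, k'⟩ := exists_ge_ge 𝒰 𝒰'
  refine isConnecting_iff.2 ⟨𝒱, refineCocycles _ k 2 a + refineCocycles _ k' 2 a',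
    refine _ k 2 r + refine _ k' 2 r', refineCocycles _ k 3 z + refineCocycles _ k' 3 z', ?_, ?_,
    ?_, ?_⟩
  · rw [mk_add, mk_refine, mk_refine]
  · rw [mk_add, mk_refine, mk_refine]
  · rw [map_add, ← refine_cochainMap, ← refine_cochainMap, h1, h1']; rfl
  · rw [map_add, d_refine, d_refine, h2, h2', refine_cochainMap, refine_cochainMap, ← map_add]; rfl

/-- After a refinement the cocycle has a logarithm `r`, whose coboundary has trivial exponential and
so is integral. -/
theorem exists_right [IsDTopologyCompatible X] (hX : HasSmoothPartitionsOfUnity X)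
    (c : H (circleSystem P) 2) : ∃ e, IsConnecting P c e := by
  obtain ⟨𝒰, a, rfl⟩ := exists_mk c
  obtain ⟨𝒱, τ, h, hτ, r, hr⟩ := exists_log_cochain hX a.1
  obtain ⟨z, hz⟩ := exists_intCochain (d _ 𝒱 2 r) (by
    rw [← d_cochainMap, hr]
    exact pullback_mem_cocycles hτ a.2)
  have hzc : z ∈ cocycles (intSystem P) 𝒱 3 := by
    rw [← cochainMap_mem_cocycles E.intCoeff intCoeff_injective, hz]
    exact d_d_two r
  exact ⟨_, isConnecting_iff.2 ⟨𝒱, ⟨_, pullback_mem_cocycles hτ a.2⟩, r, ⟨z, hzc⟩,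
    mk_pullback_two h hτ a, rfl, hr, hz.symm⟩⟩

/-- Seen in the real coefficients, the integral cocycle is the coboundary of some `r`, and the
exponential of `r` is the required circle cocycle. -/
theorem exists_left [IsDTopologyCompatible X] (hX : HasSmoothPartitionsOfUnity X)
    (e : H (intSystem P) 3) : ∃ c, IsConnecting P c e := by
  obtain ⟨𝒰, z, rfl⟩ := exists_mk e
  obtain ⟨r, hr⟩ := exists_d_eq_of_real_cocycle hX
    ((cochainMap_mem_cocycles E.intCoeff intCoeff_injective).2 z.2)
  have ha : cochainMap E.expCoeff r ∈ cocycles (circleSystem P) 𝒰 2 := by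
    change d _ 𝒰 2 _ = 0
    rw [d_cochainMap, hr, exp_intCochain]
  exact ⟨_, isConnecting_iff.2 ⟨𝒰, ⟨_, ha⟩, r, z, rfl, rfl, rfl, hr⟩⟩

/-- If the circle cocycle is the coboundary of `b` and `β` is a logarithm of `b`, then `r - dβ` is
integral and has the same coboundary as `r`. Hence the integral cocycle is a coboundary of integral
cochains. -/
theorem eq_zero_right [IsDTopologyCompatible X] (hX : HasSmoothPartitionsOfUnity X)
    {e : H (intSystem P) 3} (he : IsConnecting P 0 e) : e = 0 := by
  obtain ⟨𝒰, a, r, z, ha, rfl, h1, h2⟩ := isConnecting_iff.1 he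
  obtain ⟨𝒱, k, b, hb⟩ := exists_refine_of_mk_eq_zero ha
  obtain ⟨𝒲, τ, h, hτ, β, hβ⟩ := exists_log_cochain hX b
  obtain ⟨m, hm⟩ := exists_intCochain (pullback _ hτ 2 (refine _ k 2 r) - d _ 𝒲 1 β) (by
    rw [map_sub, ← d_cochainMap, hβ, ← pullback_cochainMap, ← refine_cochainMap, h1, d_pullback,
      hb, sub_self])
  rw [← mk_refine k z, ← mk_pullback_three h hτ]
  refine mk_eq_zero_of_mem ⟨m, cochainMap_injective E.intCoeff intCoeff_injective ?_⟩
  rw [← d_cochainMap, hm, map_sub]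
  have hdd : d _ 𝒲 2 (d _ 𝒲 1 β) = 0 := d_d_one β
  rw [hdd, sub_zero, d_pullback, d_refine, h2, refine_cochainMap, pullback_cochainMap]
  rfl

/-- If the integral cocycle bounds `m`, then `r - m` is a real cocycle, hence some `dβ`.
Exponentiation kills `m` and exhibits the circle cocycle as a coboundary. -/
theorem eq_zero_left [IsDTopologyCompatible X] (hX : HasSmoothPartitionsOfUnity X)
    {c : H (circleSystem P) 2} (hc : IsConnecting P c 0) : c = 0 := by
  obtain ⟨𝒰, a, r, z, rfl, hz, h1, h2⟩ := isConnecting_iff.1 hc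
  obtain ⟨𝒱, k, m, hm⟩ := exists_refine_of_mk_eq_zero hz
  obtain ⟨β, hβ⟩ := exists_d_eq_of_real_cocycle hX
    (z := refine _ k 2 r - cochainMap E.intCoeff m) (by
      change d _ 𝒱 2 _ = 0
      rw [map_sub, d_refine, h2, d_cochainMap, hm, refine_cochainMap, sub_self])
  rw [← mk_refine k a]
  refine mk_eq_zero_of_mem ⟨cochainMap E.expCoeff β, ?_⟩
  rw [d_cochainMap, hβ, map_sub, exp_intCochain, sub_zero, ← refine_cochainMap, h1]
  rfl

end IsConnecting

/-- The connecting homomorphism of the twisted exponential sequence is an isomorphism. -/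
theorem exists_connecting_equiv [IsDTopologyCompatible X] (hX : HasSmoothPartitionsOfUnity X)
    (P : PrincipalBundle E.H (⊤ : Opens X)) :
    ∃ Δ : H (circleSystem P) 2 ≃+ H (intSystem P) 3, ∀ x y, Δ x = y ↔ IsConnecting P x y :=
  exists_addEquiv_of_relation (IsConnecting P) (fun _ _ _ _ => IsConnecting.add)
    (fun _ _ => IsConnecting.neg) (IsConnecting.exists_right hX) (IsConnecting.exists_left hX)
    (fun _ => IsConnecting.eq_zero_right hX) (fun _ => IsConnecting.eq_zero_left hX)

end ExponentialSequence

section Obstruction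

open Cech

variable {X : Type u} [TopologicalSpace X] [DiffeologicalSpace X]
  {G Ghat : Type u} [Group G] [DiffeologicalSpace G] [Group Ghat] [DiffeologicalSpace Ghat]
  {E : TwistedCentralExtension G Ghat} {P : PrincipalBundle E.H (⊤ : Opens X)}

/-! ### Sections of `U(1)_α` as elements of `Ĥ_σ̂` -/

theorem TwistedCentralExtension.inclHhat_centralAction (E : TwistedCentralExtension G Ghat)
    (κ : E.Hhat) (z : Circle) :
    E.inclHhat (E.centralAction (κ.right⁻¹) z) = κ⁻¹ * E.inclHhat z * κ := by
  rw [mul_assoc, E.inclHhat_mul, inv_mul_cancel_left]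

/-- The value of a section of `U(1)_α`, as an element of `Ĥ_σ̂`. -/
def hatAt {U : Opens X} (p : P.carrier) (f : (circleSystem P).obj (op U)) : E.Hhat :=
  E.inclHhat (Additive.toMul (evalAt p f))

/-- The equivariance of a section becomes conjugation, so the twist by the signs needs no separate
bookkeeping once values are taken in `Ĥ_σ̂`. -/
theorem hatAt_act {U : Opens X} (f : (circleSystem P).obj (op U)) (p : P.carrier) (κ : E.Hhat) :
    hatAt (P.act p (E.toH κ)) f = κ⁻¹ * hatAt p f * κ := by
  rw [hatAt, evalAt_act]
  exact E.inclHhat_centralAction κ _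

theorem TwistedCentralExtension.inclHhat_toMul_add (E : TwistedCentralExtension G Ghat)
    (a b : Additive Circle) : E.inclHhat (Additive.toMul (a + b)) =
      E.inclHhat (Additive.toMul a) * E.inclHhat (Additive.toMul b) :=
  map_mul E.inclHhat _ _

theorem TwistedCentralExtension.inclHhat_toMul_injective (E : TwistedCentralExtension G Ghat)
    {a b : Additive Circle} (h : E.inclHhat (Additive.toMul a) = E.inclHhat (Additive.toMul b)) :
    a = b := Additive.toMul.injective (E.inclHhat_injective h)

/-! ### Systems of local lifts -/

variable (P) in
/-- Local sections of `P` over the members of a cover, with lifts of the transition functions to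
`Ĥ_σ̂`. -/
structure LiftSystem (𝒰 : PointedCover X) where
  s : ∀ x y, y ∈ 𝒰.set x → P.carrier
  smooth_s : ∀ x (n : ℕ) (q : EuclideanSpace ℝ (Fin n) → X), IsPlot q →
    ∀ h : ∀ t, q t ∈ 𝒰.set x, IsPlot (fun t => s x (q t) (h t))
  proj_s : ∀ x y h, P.proj (s x y h) = y
  k : ∀ x x' y, y ∈ 𝒰.set x → y ∈ 𝒰.set x' → E.Hhat
  smooth_k : ∀ x x' (n : ℕ) (q : EuclideanSpace ℝ (Fin n) → X), IsPlot q →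
    ∀ (h : ∀ t, q t ∈ 𝒰.set x) (h' : ∀ t, q t ∈ 𝒰.set x'),
      IsPlot (fun t => k x x' (q t) (h t) (h' t))
  s_eq : ∀ x x' y h h', s x' y h' = P.act (s x y h) (E.toH (k x x' y h h'))

namespace LiftSystem

variable {𝒰 𝒱 : PointedCover X} (L : LiftSystem P 𝒰)

theorem toH_k_mul {x y z w : X} (hx : w ∈ 𝒰.set x) (hy : w ∈ 𝒰.set y) (hz : w ∈ 𝒰.set z) :
    E.toH (L.k x y w hx hy * L.k y z w hy hz) = E.toH (L.k x z w hx hz) := by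
  apply P.free (L.s x w hx)
  rw [map_mul, P.act_mul, ← L.s_eq, ← L.s_eq, ← L.s_eq]

theorem exists_defect {x y z w : X} (hx : w ∈ 𝒰.set x) (hy : w ∈ 𝒰.set y) (hz : w ∈ 𝒰.set z) :
    ∃ a : Circle, E.inclHhat a = L.k x y w hx hy * L.k y z w hy hz * (L.k x z w hx hz)⁻¹ := by
  obtain ⟨a, ha⟩ := E.toH_eq_iff.1 (L.toH_k_mul hx hy hz)
  exact ⟨a, by rw [ha, mul_inv_cancel_right]⟩

theorem s_eq_symm {x x' y : X} (h : y ∈ 𝒰.set x) (h' : y ∈ 𝒰.set x') :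
    L.s x y h = P.act (L.s x' y h') (E.toH (L.k x x' y h h')⁻¹) := by
  rw [L.s_eq x x' y h h', map_inv, PrincipalBundle.act_act_inv]

theorem exists_cochain [IsDiffeologicalGroup Ghat] (t : Fin 3 → X) :
    ∃ f : (circleSystem P).obj (op (𝒰.inter t)), ∀ (y : X) (h : ∀ i, y ∈ 𝒰.set (t i)),
      hatAt (L.s (t 0) y (h 0)) f = L.k (t 0) (t 1) y (h 0) (h 1) *
        L.k (t 1) (t 2) y (h 1) (h 2) * (L.k (t 0) (t 2) y (h 0) (h 2))⁻¹ := by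
  have : IsDiffeologicalGroup E.Hhat := E.isDiffeologicalGroup_Hhat
  have hm : ∀ y : 𝒰.inter t, ∀ i, y.1 ∈ 𝒰.set (t i) := fun y => PointedCover.mem_inter.1 y.2
  choose a ha using fun y : 𝒰.inter t => L.exists_defect (hm y 0) (hm y 1) (hm y 2)
  obtain ⟨f, hf⟩ := exists_section_of_trivialization (P := P) E.isSmoothAction_circle
    (fun y : 𝒰.inter t => L.s (t 0) y.1 (hm y 0))
    (fun n q hq => L.smooth_s _ n _ hq.subtypeVal fun t => hm (q t) 0)
    (fun y => L.proj_s _ _ _) (fun y => Additive.ofMul (a y)) (fun n q hq => by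
      refine E.isPlot_of_inclHhat (p := fun t => a (q t)) ?_
      simp only [ha]
      exact ((L.smooth_k _ _ n _ hq.subtypeVal (fun t => hm (q t) 0) fun t => hm (q t) 1).mul
        (L.smooth_k _ _ n _ hq.subtypeVal (fun t => hm (q t) 1) fun t => hm (q t) 2)).mul
        (L.smooth_k _ _ n _ hq.subtypeVal (fun t => hm (q t) 0) fun t => hm (q t) 2).inv)
  refine ⟨f, fun y h => ?_⟩
  have := hf ⟨y, PointedCover.mem_inter.2 h⟩
  rw [hatAt, this]
  exact ha _

theorem section_ext_at {x : X} {U : Opens X} (hU : U ≤ 𝒰.set x)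
    {f g : (circleSystem P).obj (op U)}
    (h : ∀ y (hy : y ∈ 𝒰.set x), y ∈ U → evalAt (L.s x y hy) f = evalAt (L.s x y hy) g) : f = g :=
  section_ext_of_section (fun y : U => L.s x y.1 (hU y.2)) (fun _ => L.proj_s _ _ _)
    fun y => h _ _ y.2

/-- A section of `U(1)_α` over `U` with prescribed values in `Ĥ_σ̂` along a section of `P`. -/
theorem exists_section_of_hat {x : X} {U : Opens X} (hU : U ≤ 𝒰.set x)
    (β : ∀ y, y ∈ U → E.Hhat) (hβ : ∀ y hy, E.toH (β y hy) = 1)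
    (hs : ∀ (n : ℕ) (q : EuclideanSpace ℝ (Fin n) → X), IsPlot q → ∀ h : ∀ t, q t ∈ U,
      IsPlot (fun t => β (q t) (h t))) :
    ∃ f : (circleSystem P).obj (op U), ∀ y (hy : y ∈ U),
      hatAt (L.s x y (hU hy)) f = β y hy := by
  choose a ha using fun y : U => E.toH_eq_one_iff.1 (hβ y.1 y.2)
  obtain ⟨f, hf⟩ := exists_section_of_trivialization (P := P) E.isSmoothAction_circle
    (fun y : U => L.s x y.1 (hU y.2))
    (fun n q hq => L.smooth_s _ n _ hq.subtypeVal fun t => hU (q t).2)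
    (fun y => L.proj_s _ _ _) (fun y => Additive.ofMul (a y)) (fun n q hq => by
      refine E.isPlot_of_inclHhat (p := fun t => a (q t)) ?_
      simp only [← ha]
      exact hs n _ hq.subtypeVal fun t => (q t).2)
  refine ⟨f, fun y hy => ?_⟩
  have := hf ⟨y, hy⟩
  rw [hatAt, this]
  exact (ha _).symm

variable [IsDiffeologicalGroup Ghat]

/-- The obstruction cochain `ĥ_xy ĥ_yz ĥ_xz⁻¹`. -/
def cochain : Cochain (circleSystem P) 𝒰 2 := fun t => (L.exists_cochain t).choose

theorem hatAt_cochain {x y z w : X} (hx : w ∈ 𝒰.set x) (hy : w ∈ 𝒰.set y) (hz : w ∈ 𝒰.set z) :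
    hatAt (L.s x w hx) (L.cochain ![x, y, z]) =
      L.k x y w hx hy * L.k y z w hy hz * (L.k x z w hx hz)⁻¹ :=
  (L.exists_cochain ![x, y, z]).choose_spec w fun i => by fin_cases i <;> assumption

theorem cochain_mem : L.cochain ∈ cocycles (circleSystem P) 𝒰 2 := by
  refine funext fun t => ?_
  obtain ⟨x, y, z, w, rfl⟩ : ∃ x y z w, t = ![x, y, z, w] := ⟨_, _, _, _, eq_vec_four t⟩
  refine L.section_ext_at (x := x) (fun v hv => (mem_inter_four.1 hv).1) fun v hx hv => ?_
  obtain ⟨-, hy, hz, hw⟩ := mem_inter_four.1 hv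
  rw [evalAt_d_two _ (by rwa [L.proj_s])]
  refine Eq.trans ?_ (map_zero _).symm
  -- The face `(y, z, w)` is given in the trivialization of `y` and reaches that of `x` by
  -- conjugation with `k_xy`. Both sides then equal `k_xy k_yz k_zw k_xw⁻¹`.
  have key : evalAt (L.s x v hx) (L.cochain ![y, z, w]) +
      evalAt (L.s x v hx) (L.cochain ![x, y, w]) = evalAt (L.s x v hx) (L.cochain ![x, y, z]) +
        evalAt (L.s x v hx) (L.cochain ![x, z, w]) := by
    apply E.inclHhat_toMul_injective
    rw [E.inclHhat_toMul_add, E.inclHhat_toMul_add]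
    change hatAt _ _ * hatAt _ _ = hatAt _ _ * hatAt _ _
    rw [L.hatAt_cochain hx hy hw, L.hatAt_cochain hx hy hz, L.hatAt_cochain hx hz hw,
      L.s_eq_symm hx hy, hatAt_act, L.hatAt_cochain hy hz hw]
    group
  rw [sub_add_eq_add_sub, key]
  abel

/-- The obstruction class. -/
def obstruction : H (circleSystem P) 2 := Cech.mk _ 𝒰 ⟨L.cochain, L.cochain_mem⟩

/-- The restriction of a system of local lifts to a refinement. -/
def restrict (h : 𝒰 ≤ 𝒱) : LiftSystem P 𝒱 where
  s x y hy := L.s x y (h x hy)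
  smooth_s x n q hq hm := L.smooth_s x n q hq fun t => h x (hm t)
  proj_s x y _ := L.proj_s x y _
  k x x' y hx hx' := L.k x x' y (h x hx) (h x' hx')
  smooth_k x x' n q hq hm hm' := L.smooth_k x x' n q hq (fun t => h x (hm t)) fun t => h x' (hm' t)
  s_eq x x' y _ _ := L.s_eq x x' y _ _

theorem restrict_cochain (h : 𝒰 ≤ 𝒱) : (L.restrict h).cochain = refine _ h 2 L.cochain := by
  refine funext fun t => ?_
  obtain ⟨x, y, z, rfl⟩ : ∃ x y z, t = ![x, y, z] := ⟨_, _, _, eq_vec_three t⟩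
  refine (L.restrict h).section_ext_at (x := x) (fun v hv => (mem_inter_three.1 hv).1)
    fun v hx hv => ?_
  obtain ⟨-, hy, hz⟩ := mem_inter_three.1 hv
  rw [evalAt_refine h _ (by rwa [(L.restrict h).proj_s])]
  apply E.inclHhat_toMul_injective
  exact ((L.restrict h).hatAt_cochain hx hy hz).trans
    (L.hatAt_cochain (h x hx) (h y hy) (h z hz)).symm

theorem restrict_obstruction (h : 𝒰 ≤ 𝒱) : (L.restrict h).obstruction = L.obstruction := by
  have : (⟨(L.restrict h).cochain, (L.restrict h).cochain_mem⟩ : cocycles (circleSystem P) 𝒱 2) =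
      refineCocycles _ h 2 ⟨L.cochain, L.cochain_mem⟩ := Subtype.ext (L.restrict_cochain h)
  rw [obstruction, this, mk_refine, obstruction]

/-- Systems of local lifts on one cover that are related by smooth maps to `Ĥ_σ̂` have the same
obstruction class. -/
theorem obstruction_eq_of_transition (L L' : LiftSystem P 𝒰) (K : ∀ x y, y ∈ 𝒰.set x → E.Hhat)
    (hK : ∀ x (n : ℕ) (q : EuclideanSpace ℝ (Fin n) → X), IsPlot q →
      ∀ h : ∀ t, q t ∈ 𝒰.set x, IsPlot (fun t => K x (q t) (h t)))
    (hs : ∀ x y h, L'.s x y h = P.act (L.s x y h) (E.toH (K x y h))) :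
    L'.obstruction = L.obstruction := by
  have : IsDiffeologicalGroup E.Hhat := E.isDiffeologicalGroup_Hhat
  -- The lifts of `L`, transported by `K` to the sections of `L'`. They have the same image in `H_σ`
  -- as the lifts of `L'`, so the quotients are circle-valued; these form the cochain `b` that
  -- bounds the difference.
  let m : ∀ x x' y, y ∈ 𝒰.set x → y ∈ 𝒰.set x' → E.Hhat := fun x x' y h h' =>
    (K x y h)⁻¹ * L.k x x' y h h' * K x' y h'
  have hm : ∀ x x' y h h', E.toH (m x x' y h h') = E.toH (L'.k x x' y h h') := by
    intro x x' y h h'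
    apply P.free (L'.s x y h)
    rw [← L'.s_eq, hs, hs, map_mul, map_mul, map_inv, P.act_mul, P.act_mul,
      PrincipalBundle.act_act_inv, ← L.s_eq]
  have hmem : ∀ (t : Fin 2 → X) {y : X}, y ∈ 𝒰.inter t → ∀ i, y ∈ 𝒰.set (t i) := fun t y hy =>
    PointedCover.mem_inter.1 hy
  choose b hb using fun t : Fin 2 → X => L'.exists_section_of_hat (x := t 0) (U := 𝒰.inter t)
    (fun y hy => hmem t hy 0)
    (fun y hy => L'.k (t 0) (t 1) y (hmem t hy 0) (hmem t hy 1) *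
      (m (t 0) (t 1) y (hmem t hy 0) (hmem t hy 1))⁻¹)
    (fun y hy => by rw [map_mul, map_inv, hm, mul_inv_cancel])
    (fun n q hq h => (L'.smooth_k _ _ n q hq (fun t' => hmem t (h t') 0)
      fun t' => hmem t (h t') 1).mul
      (((hK _ n q hq fun t' => hmem t (h t') 0).inv.mul
        (L.smooth_k _ _ n q hq (fun t' => hmem t (h t') 0) fun t' => hmem t (h t') 1)).mul
        (hK _ n q hq fun t' => hmem t (h t') 1)).inv)
  have hb' : ∀ x y w (hx : w ∈ 𝒰.set x) (hy : w ∈ 𝒰.set y), hatAt (L'.s x w hx) (b ![x, y]) =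
      L'.k x y w hx hy * (m x y w hx hy)⁻¹ := fun x y w hx hy =>
    hb ![x, y] w (mem_inter_two.2 ⟨hx, hy⟩)
  refine mk_eq_of_sub_mem ⟨b, funext fun t => ?_⟩
  obtain ⟨x, y, z, rfl⟩ : ∃ x y z, t = ![x, y, z] := ⟨_, _, _, eq_vec_three t⟩
  refine L'.section_ext_at (x := x) (fun v hv => (mem_inter_three.1 hv).1) fun v hx hv => ?_
  obtain ⟨-, hy, hz⟩ := mem_inter_three.1 hv
  rw [evalAt_d_one _ (by rwa [L'.proj_s]), Pi.sub_apply, map_sub]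
  -- The summands are ordered so that the product telescopes: both sides become `k'_xy k'_yz
  -- m_xz⁻¹`.
  have key : evalAt (L'.s x v hx) (b ![x, y]) + evalAt (L'.s x v hx) (b ![y, z]) +
      evalAt (L'.s x v hx) (L.cochain ![x, y, z]) =
      evalAt (L'.s x v hx) (L'.cochain ![x, y, z]) + evalAt (L'.s x v hx) (b ![x, z]) := by
    apply E.inclHhat_toMul_injective
    simp only [E.inclHhat_toMul_add]
    change hatAt _ _ * hatAt _ _ * hatAt _ _ = hatAt _ _ * hatAt _ _
    have h1 : L'.s x v hx = P.act (L'.s y v hy) (E.toH (m x y v hx hy)⁻¹) := by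
      rw [map_inv, hm, ← map_inv, ← L'.s_eq_symm]
    rw [hb' x y v hx hy, hb' x z v hx hz, L'.hatAt_cochain hx hy hz]
    have h2 : hatAt (L'.s x v hx) (b ![y, z]) = m x y v hx hy *
        (L'.k y z v hy hz * (m y z v hy hz)⁻¹) * (m x y v hx hy)⁻¹ := by
      rw [h1, hatAt_act, hb' y z v hy hz, inv_inv]
    rw [h2, hs, hatAt_act, L.hatAt_cochain hx hy hz]
    simp only [m]
    group
  rw [sub_add_eq_add_sub, sub_eq_sub_iff_add_eq_add, ← key]
  abel

/-- The obstruction class does not depend on the system of local lifts. -/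
theorem obstruction_eq (hE : E.HasLocalLifts X) (L : LiftSystem P 𝒰)
    (L' : LiftSystem P 𝒱) : L'.obstruction = L.obstruction := by
  obtain ⟨𝒲, h, h'⟩ := exists_ge_ge 𝒰 𝒱
  have hdiv : ∀ x (n : ℕ) (q : EuclideanSpace ℝ (Fin n) → X), IsPlot q →
      ∀ hq : ∀ t, q t ∈ 𝒲.set x, IsPlot (fun t =>
        P.div (L.s x (q t) (h x (hq t))) (L'.s x (q t) (h' x (hq t)))) := fun x n q hq hm =>
    PrincipalBundle.isPlot_div (L.smooth_s _ n q hq _) (L'.smooth_s _ n q hq _)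
      fun t => by rw [L.proj_s, L'.proj_s]
  -- The comparison involves one lift for each index. Indices are points, so it suffices to shrink
  -- the member of index `x` around `x`, and no simultaneous refinement is needed.
  have hex : ∀ x, ∃ (V : Opens X) (hV : V ≤ 𝒲.set x), x ∈ V ∧ ∃ g : V → Ghat, DSmooth g ∧
      ∀ y : V, E.quot (g y) =
        (P.div (L.s x y (h x (hV y.2))) (L'.s x y (h' x (hV y.2)))).left := fun x =>
    hE (𝒲.set x) (fun y => (P.div (L.s x y (h x y.2)) (L'.s x y (h' x y.2))).left)
      (fun n q hq => (SemidirectProduct.isPlot_iff.1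
        (hdiv x n _ hq.subtypeVal fun t => (q t).2)).1) x (𝒲.mem x)
  choose V hV hxV g hg hgq using hex
  let 𝒱' : PointedCover X := ⟨V, hxV⟩
  have hle : 𝒲 ≤ 𝒱' := hV
  rw [← L.restrict_obstruction (h.trans hle), ← L'.restrict_obstruction (h'.trans hle)]
  refine obstruction_eq_of_transition _ _ (fun x y hy => ⟨g x ⟨y, hy⟩,
    (P.div (L.s x y (h x (hV x hy))) (L'.s x y (h' x (hV x hy)))).right⟩)
    (fun x n q hq hm => SemidirectProduct.isPlot_iff.2 ⟨(hg x).isPlot_comp (hq.subtypeMk hm),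
      (SemidirectProduct.isPlot_iff.1 (hdiv x n q hq fun t => hV x (hm t))).2⟩)
    fun x y hy => ?_
  have : E.toH ⟨g x ⟨y, hy⟩, (P.div (L.s x y (h x (hV x hy))) (L'.s x y (h' x (hV x hy)))).right⟩ =
      P.div (L.s x y (h x (hV x hy))) (L'.s x y (h' x (hV x hy))) :=
    SemidirectProduct.ext (hgq x ⟨y, hy⟩) rfl
  rw [this]
  exact (PrincipalBundle.act_div ((L.proj_s _ _ _).trans (L'.proj_s _ _ _).symm)).symm

end LiftSystem

/-! ### Lifting data -/

/-- The hypothesis on `E` lifts each transition function near each point of a double intersection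
only. Simultaneous refinement in degree 1 produces a cover on whose double intersections all of them
lift. -/
theorem exists_liftSystem [IsDTopologyCompatible X] (hX : HasSmoothPartitionsOfUnity X)
    (hE : E.HasLocalLifts X) (P : PrincipalBundle E.H (⊤ : Opens X)) :
    ∃ 𝒰 : PointedCover X, Nonempty (LiftSystem P 𝒰) := by
  choose V hxV _ s hs hsp using fun x => P.exists_local_section x trivial
  let 𝒰 : PointedCover X := ⟨V, hxV⟩
  have hdiv : ∀ x x' (n : ℕ) (q : EuclideanSpace ℝ (Fin n) → X), IsPlot q →
      ∀ (h : ∀ t, q t ∈ V x) (h' : ∀ t, q t ∈ V x'),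
        IsPlot (fun t => P.div (s x ⟨q t, h t⟩) (s x' ⟨q t, h' t⟩)) := fun x x' n q hq h h' =>
    PrincipalBundle.isPlot_div ((hs x).isPlot_comp (hq.subtypeMk h))
      ((hs x').isPlot_comp (hq.subtypeMk h')) fun t => by rw [hsp, hsp]
  obtain ⟨𝒱, τ, -, hτ, hQ⟩ := 𝒰.exists_refinement hX 1
    (fun t W => ∃ g : W → Ghat, DSmooth g ∧ ∀ (y : W) (h : y.1 ∈ V (t 0)) (h' : y.1 ∈ V (t 1)),
      E.quot (g y) = (P.div (s (t 0) ⟨y, h⟩) (s (t 1) ⟨y, h'⟩)).left)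
    (fun t => ⟨fun _ => 1, dSmooth_const, fun y => y.2.elim⟩)
    (fun t W W' hW ⟨g, hg, hgq⟩ => ⟨fun y => g ⟨y, hW y.2⟩,
      fun n q hq => hg.isPlot_comp (hq.subtypeVal.subtypeMk fun t => hW (q t).2),
      fun y h h' => hgq ⟨y, hW y.2⟩ h h'⟩)
    (fun t x hx => by
      have hm : ∀ y : 𝒰.inter t, ∀ i, y.1 ∈ V (t i) := fun y => PointedCover.mem_inter.1 y.2
      obtain ⟨W, hW, hxW, g, hg, hgq⟩ := hE (𝒰.inter t)
        (fun y => (P.div (s (t 0) ⟨y, hm y 0⟩) (s (t 1) ⟨y, hm y 1⟩)).left)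
        (fun n q hq => (SemidirectProduct.isPlot_iff.1 (hdiv _ _ n _ hq.subtypeVal
          (fun t => hm (q t) 0) fun t => hm (q t) 1)).1) x hx
      exact ⟨W, hxW, g, hg, fun y _ _ => hgq y⟩)
  choose g hg hgq using hQ
  refine ⟨𝒱, ⟨{
    s := fun x y hy => s (τ x) ⟨y, hτ x hy⟩
    smooth_s := fun x n q hq h => (hs _).isPlot_comp (hq.subtypeMk fun t => hτ x (h t))
    proj_s := fun x y hy => hsp _ _
    k := fun x x' y h h' => ⟨g ![x, x'] ⟨y, mem_inter_two.2 ⟨h, h'⟩⟩,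
      (P.div (s (τ x) ⟨y, hτ x h⟩) (s (τ x') ⟨y, hτ x' h'⟩)).right⟩
    smooth_k := fun x x' n q hq h h' => SemidirectProduct.isPlot_iff.2
      ⟨(hg _).isPlot_comp (hq.subtypeMk fun t => mem_inter_two.2 ⟨h t, h' t⟩),
        (SemidirectProduct.isPlot_iff.1 (hdiv _ _ n q hq (fun t => hτ x (h t))
          fun t => hτ x' (h' t))).2⟩
    s_eq := fun x x' y h h' => ?_ }⟩⟩
  have : E.toH ⟨g ![x, x'] ⟨y, mem_inter_two.2 ⟨h, h'⟩⟩,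
      (P.div (s (τ x) ⟨y, hτ x h⟩) (s (τ x') ⟨y, hτ x' h'⟩)).right⟩ =
      P.div (s (τ x) ⟨y, hτ x h⟩) (s (τ x') ⟨y, hτ x' h'⟩) :=
    SemidirectProduct.ext (hgq ![x, x'] ⟨y, mem_inter_two.2 ⟨h, h'⟩⟩ (hτ x h) (hτ x' h')) rfl
  rw [this]
  exact (PrincipalBundle.act_div (by rw [hsp, hsp])).symm

/-- The lifting datum of a system of local lifts. -/
def LiftSystem.toDatum {𝒰 : PointedCover X} (L : LiftSystem P 𝒰) : LiftingDatum P where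
  I := X
  U := 𝒰.set
  index := id
  mem_index := 𝒰.mem
  s x y := L.s x y.1 y.2
  smooth_s x n q hq := L.smooth_s x n _ hq.subtypeVal fun t => (q t).2
  proj_s x _ := L.proj_s x _ _
  h x x' y := E.toH (L.k x x' y.1 y.2.1 y.2.2)
  s_eq x x' _ := L.s_eq x x' _ _ _
  ghat x x' y := (L.k x x' y.1 y.2.1 y.2.2).left
  smooth_ghat x x' n q hq := (SemidirectProduct.isPlot_iff.1
    (L.smooth_k x x' n _ hq.subtypeVal (fun t => (q t).2.1) fun t => (q t).2.2)).1
  quot_ghat _ _ _ := rfl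

namespace LiftingDatum

/-- A lifting datum does not postulate smoothness of its transition functions; it follows because
they are quotients of smooth sections. -/
theorem isPlot_h (D : LiftingDatum P) (i j : D.I) {n : ℕ}
    {q : EuclideanSpace ℝ (Fin n) → (D.U i ⊓ D.U j : Opens X)} (hq : IsPlot q) :
    IsPlot (fun t => D.h i j (q t)) := by
  have := PrincipalBundle.isPlot_div
    ((D.smooth_s i).isPlot_comp (hq.subtypeVal.subtypeMk fun t => (q t).2.1))
    ((D.smooth_s j).isPlot_comp (hq.subtypeVal.subtypeMk fun t => (q t).2.2))
    fun t => by rw [D.proj_s, D.proj_s]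
  refine (congrArg IsPlot (funext fun t => ?_)).mp this
  exact PrincipalBundle.div_eq (D.s_eq i j (q t)).symm

/-- The system of local lifts of a lifting datum. -/
def toSystem (D : LiftingDatum P) : LiftSystem P D.cover where
  s x y h := D.s (D.index x) ⟨y, h⟩
  smooth_s x n q hq h := (D.smooth_s _).isPlot_comp (hq.subtypeMk h)
  proj_s x y h := D.proj_s _ _
  k x x' y h h' := ⟨D.ghat (D.index x) (D.index x') ⟨y, h, h'⟩,
    (D.h (D.index x) (D.index x') ⟨y, h, h'⟩).right⟩
  smooth_k x x' n q hq h h' := by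
    have hq' : IsPlot (fun t => (⟨q t, h t, h' t⟩ : (D.U (D.index x) ⊓ D.U (D.index x') : Opens X))) :=
      hq
    exact SemidirectProduct.isPlot_iff.2 ⟨(D.smooth_ghat _ _).isPlot_comp hq',
      (SemidirectProduct.isPlot_iff.1 (D.isPlot_h _ _ hq')).2⟩
  s_eq x x' y h h' := by
    have : E.toH ⟨D.ghat (D.index x) (D.index x') ⟨y, h, h'⟩,
        (D.h (D.index x) (D.index x') ⟨y, h, h'⟩).right⟩ =
        D.h (D.index x) (D.index x') ⟨y, h, h'⟩ := SemidirectProduct.ext (D.quot_ghat _ _ _) rfl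
    rw [this]
    exact D.s_eq (D.index x) (D.index x') ⟨y, h, h'⟩

theorem represents_obstruction [IsDiffeologicalGroup Ghat] (D : LiftingDatum P) :
    D.Represents D.toSystem.obstruction := by
  refine ⟨_, rfl, fun t y h0 h1 h2 hp => ?_⟩
  obtain ⟨x, x', x'', rfl⟩ : ∃ x x' x'', t = ![x, x', x''] := ⟨_, _, _, eq_vec_three t⟩
  have key : hatAt (D.toSystem.s x y h0) (D.toSystem.cochain ![x, x', x'']) = _ :=
    D.toSystem.hatAt_cochain (x := x) (y := x') (z := x'') h0 h1 h2
  -- The inverse is cleared before passing to `Ĝ`-components, because the component of an inverse in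
  -- the semidirect product involves `σ̂`.
  rw [eq_mul_inv_iff_mul_eq] at key
  have hl := congrArg SemidirectProduct.left key
  rw [circleEval_eq, defect, eq_mul_inv_iff_mul_eq]
  rw [SemidirectProduct.mul_left, hatAt, E.inclHhat_right, map_one, MulAut.one_apply] at hl
  exact hl

end LiftingDatum

end Obstruction

section Gluing

variable {X : Type u} [TopologicalSpace X] [DiffeologicalSpace X]
  {G Ghat : Type u} [Group G] [DiffeologicalSpace G] [Group Ghat] [DiffeologicalSpace Ghat]
  {E : TwistedCentralExtension G Ghat} {B : Opens X}

/-! ### Lifts from cocycles -/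

/-- Local sections of a principal `H_σ`-bundle and an `Ĥ_σ̂`-valued cocycle that lifts their
transition functions. -/
structure LiftCocycle (R : PrincipalBundle E.H B) where
  V : B → Opens X
  mem : ∀ x : B, x.1 ∈ V x
  le : ∀ x, V x ≤ B
  s : ∀ x y, y ∈ V x → R.carrier
  smooth_s : ∀ x (n : ℕ) (q : EuclideanSpace ℝ (Fin n) → X), IsPlot q →
    ∀ h : ∀ t, q t ∈ V x, IsPlot (fun t => s x (q t) (h t))
  proj_s : ∀ x y h, R.proj (s x y h) = y
  k : ∀ x x' y, y ∈ V x → y ∈ V x' → E.Hhat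
  smooth_k : ∀ x x' (n : ℕ) (q : EuclideanSpace ℝ (Fin n) → X), IsPlot q →
    ∀ (h : ∀ t, q t ∈ V x) (h' : ∀ t, q t ∈ V x'), IsPlot (fun t => k x x' (q t) (h t) (h' t))
  s_eq : ∀ x x' y h h', s x' y h' = R.act (s x y h) (E.toH (k x x' y h h'))
  cocycle : ∀ x x' x'' y h h' h'', k x x' y h h' * k x' x'' y h' h'' = k x x'' y h h''

namespace LiftCocycle

variable {R : PrincipalBundle E.H B} (L : LiftCocycle R)

theorem k_self (x : B) {y : X} (h : y ∈ L.V x) : L.k x x y h h = 1 := by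
  have := L.cocycle x x x y h h h
  exact mul_eq_left.1 this

/-- The total space of the bundle defined by a cocycle: over a point `y` it is a copy of `Ĥ_σ̂`,
in the trivialization of index `y`. -/
@[ext]
structure Total (L : LiftCocycle R) where
  base : B
  fibre : E.Hhat

/-- The coordinate in the trivialization of index `x`. -/
def chart (x : B) (p : L.Total) (h : p.base.1 ∈ L.V x) : E.Hhat :=
  L.k x p.base p.base.1 h (L.mem p.base) * p.fibre

theorem k_mul_chart (x x' : B) (p : L.Total) (h : p.base.1 ∈ L.V x) (h' : p.base.1 ∈ L.V x') :
    L.k x x' p.base.1 h h' * L.chart x' p h' = L.chart x p h := by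
  rw [chart, ← mul_assoc, L.cocycle, chart]

/-- The change of trivialization cancels in the quotient. This makes the division map of the glued
bundle smooth, although the fibre coordinates themselves depend on trivializations that vary with
the point. -/
theorem inv_chart_mul_chart (x : B) {p p' : L.Total} (hp : p.base.1 = p'.base.1)
    (h : p.base.1 ∈ L.V x) (h' : p'.base.1 ∈ L.V x) :
    (L.chart x p h)⁻¹ * L.chart x p' h' = p.fibre⁻¹ * p'.fibre := by
  obtain ⟨b, f⟩ := p
  obtain ⟨b', f'⟩ := p'
  obtain rfl : b = b' := Subtype.ext hp
  simp [chart, mul_assoc]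

/-- The stored fibre coordinate refers to a trivialization that changes from point to point, so
smoothness is imposed on chart coordinates, along all reparametrizations that stay in one chart. -/
instance : DiffeologicalSpace L.Total where
  plots n := {p | IsPlot (fun t => (p t).base.1) ∧
    ∀ (x : B) (m : ℕ) (g : EuclideanSpace ℝ (Fin m) → EuclideanSpace ℝ (Fin n)), IsPlot g →
      ∀ h : ∀ t, (p (g t)).base.1 ∈ L.V x, IsPlot (fun t => L.chart x (p (g t)) (h t))}
  constant_plots _ := ⟨isPlot_const, fun x _ _ _ h => isPlot_const (x := L.chart x _ (h 0))⟩
  plot_reparam {n m p f} hp hf := ⟨hp.1.comp_plot hf.isPlot, fun x l g hg h =>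
    hp.2 x l (fun t => f (g t)) (hf.isPlot.comp_plot hg) h⟩
  locality {n p} hp := by
    refine ⟨isPlot_of_locally fun t => ?_, fun x m g hg h => isPlot_of_locally fun t => ?_⟩
    · obtain ⟨u, hu, ht, hp⟩ := hp t
      exact ⟨u, hu, ht, fun m g hgu hg => (hp hgu hg.contDiff).1⟩
    · obtain ⟨u, hu, ht, hp⟩ := hp (g t)
      refine ⟨g ⁻¹' u, hu.preimage hg.contDiff.continuous, ht, fun l g' hg'u hg' => ?_⟩
      exact (hp (f := fun t => g (g' t)) hg'u (hg.comp_plot hg').contDiff).2 x l id isPlot_id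
        fun t => h (g' t)

variable {L}

theorem isPlot_iff {n : ℕ} {p : EuclideanSpace ℝ (Fin n) → L.Total} :
    IsPlot p ↔ IsPlot (fun t => (p t).base.1) ∧
    ∀ (x : B) (m : ℕ) (g : EuclideanSpace ℝ (Fin m) → EuclideanSpace ℝ (Fin n)), IsPlot g →
      ∀ h : ∀ t, (p (g t)).base.1 ∈ L.V x, IsPlot (fun t => L.chart x (p (g t)) (h t)) := Iff.rfl

theorem isPlot_chart {x : B} {n : ℕ} {p : EuclideanSpace ℝ (Fin n) → L.Total} (hp : IsPlot p)
    (h : ∀ t, (p t).base.1 ∈ L.V x) : IsPlot (fun t => L.chart x (p t) (h t)) :=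
  (isPlot_iff.1 hp).2 x n id isPlot_id h

theorem isPlot_base {n : ℕ} {p : EuclideanSpace ℝ (Fin n) → L.Total} (hp : IsPlot p) :
    IsPlot (fun t => (p t).base.1) := (isPlot_iff.1 hp).1

/-- One chart near each parameter is enough, since two charts differ by a smooth transition
function. -/
theorem isPlot_of_chart [IsDiffeologicalGroup Ghat] [IsDTopologyCompatible X]
    {n : ℕ} {p : EuclideanSpace ℝ (Fin n) → L.Total}
    (hb : IsPlot (fun t => (p t).base.1))
    (h : ∀ t, ∃ x : B, (p t).base.1 ∈ L.V x ∧ ∀ (m : ℕ)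
      (g : EuclideanSpace ℝ (Fin m) → EuclideanSpace ℝ (Fin n)), IsPlot g →
      ∀ h : ∀ t, (p (g t)).base.1 ∈ L.V x, IsPlot (fun t => L.chart x (p (g t)) (h t))) :
    IsPlot p := by
  have : IsDiffeologicalGroup E.Hhat := E.isDiffeologicalGroup_Hhat
  refine isPlot_iff.2 ⟨hb, fun x m g hg hgx => ?_⟩
  have hbg := hb.comp_plot hg
  refine isPlot_of_opens hbg fun t => ?_
  obtain ⟨x', hx', hp⟩ := h (g t)
  refine ⟨L.V x', hx', fun l g' hg'V hg' => ?_⟩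
  have h1 := L.smooth_k x x' l _ (hbg.comp_plot hg') (fun t => hgx (g' t)) hg'V
  have h2 := hp l _ (hg.comp_plot hg') hg'V
  refine (congrArg IsPlot (funext fun t => ?_)).mp (h1.mul h2)
  exact L.k_mul_chart x x' _ _ _

variable (L)

/-- The point over `y` with coordinate `k` in the trivialization of index `x`. -/
def point (x : B) (y : X) (h : y ∈ L.V x) (k : E.Hhat) : L.Total :=
  ⟨⟨y, L.le x h⟩, L.k ⟨y, L.le x h⟩ x y (L.mem ⟨y, L.le x h⟩) h * k⟩

theorem chart_point (x x' : B) (y : X) (h : y ∈ L.V x) (k : E.Hhat) (h' : y ∈ L.V x') :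
    L.chart x' (L.point x y h k) h' = L.k x' x y h' h * k :=
  (mul_assoc _ _ _).symm.trans
    (congrArg (· * k) (L.cocycle x' ⟨y, L.le x h⟩ x y h' (L.mem ⟨y, L.le x h⟩) h))

variable [IsDiffeologicalGroup Ghat] [IsDTopologyCompatible X]

theorem isPlot_point (x : B) {n : ℕ} {q : EuclideanSpace ℝ (Fin n) → X} (hq : IsPlot q)
    (h : ∀ t, q t ∈ L.V x) {k : EuclideanSpace ℝ (Fin n) → E.Hhat} (hk : IsPlot k) :
    IsPlot (fun t => L.point x (q t) (h t) (k t)) := by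
  refine isPlot_of_chart hq fun t => ⟨x, h t, fun m g hg hg' => ?_⟩
  refine (congrArg IsPlot (funext fun t => ?_)).mp (hk.comp_plot hg)
  exact ((L.chart_point x x _ (h (g t)) (k (g t)) (hg' t)).trans
    ((congrArg (· * k (g t)) (L.k_self x (h (g t)))).trans (one_mul _))).symm

/-- The principal bundle defined by a cocycle. -/
def bundle : PrincipalBundle E.Hhat B where
  carrier := L.Total
  proj p := p.base.1
  proj_mem p := p.base.2
  smooth_proj _ _ hp := isPlot_base hp
  act p h := ⟨p.base, p.fibre * h⟩
  act_one p := by rw [mul_one]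
  act_mul p h k := by rw [mul_assoc]
  smooth_act n p hp := by
    have : IsDiffeologicalGroup E.Hhat := E.isDiffeologicalGroup_Hhat
    have h1 := dSmooth_fst'.isPlot_comp hp
    have h2 := dSmooth_snd'.isPlot_comp hp
    have hb : IsPlot (fun t => (p t).1.base.1) := isPlot_base h1
    refine isPlot_of_chart hb fun t => ⟨(p t).1.base, L.mem _, fun m g hg hg' => ?_⟩
    refine (congrArg IsPlot (funext fun t => ?_)).mp
      ((isPlot_chart (h1.comp_plot hg) hg').mul (h2.comp_plot hg))
    exact mul_assoc _ _ _
  proj_act _ _ := rfl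
  free p h k e := mul_left_cancel (congrArg Total.fibre e)
  exists_div := by
    have : IsDiffeologicalGroup E.Hhat := E.isDiffeologicalGroup_Hhat
    refine ⟨fun z => z.1.1.fibre⁻¹ * z.1.2.fibre, fun n p hp => ?_, fun z =>
      Total.ext (Subtype.ext z.2) (mul_inv_cancel_left _ _)⟩
    have h1 := dSmooth_fst'.isPlot_comp hp.subtypeVal
    have h2 := dSmooth_snd'.isPlot_comp hp.subtypeVal
    refine isPlot_of_opens (isPlot_base h1) fun t =>
      ⟨L.V (p t).1.1.base, L.mem _, fun m g hg hgs => ?_⟩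
    have hg' : ∀ t, (p (g t)).1.2.base.1 ∈ L.V _ := fun t => (p (g t)).2 ▸ hg t
    refine (congrArg IsPlot (funext fun t => ?_)).mp
      ((isPlot_chart (h1.comp_plot hgs) hg).inv.mul (isPlot_chart (h2.comp_plot hgs) hg'))
    exact L.inv_chart_mul_chart _ (p (g t)).2 _ _
  exists_local_section x hx := ⟨L.V ⟨x, hx⟩, L.mem _, L.le _,
    fun y => L.point ⟨x, hx⟩ y.1 y.2 1, fun _ _ hq =>
      L.isPlot_point _ hq.subtypeVal (fun t => _) isPlot_const, fun _ => rfl⟩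

/-- The projection of the bundle defined by a cocycle. -/
def liftingMap : LiftingMap L.bundle R where
  toFun p := R.act (L.s p.base p.base.1 (L.mem p.base)) (E.toH p.fibre)
  smooth n p hp := by
    refine isPlot_of_opens (isPlot_base hp) fun t =>
      ⟨L.V (p t).base, L.mem _, fun m g hg hgs => ?_⟩
    have hpg := IsPlot.comp_plot hp hgs
    refine (congrArg IsPlot (funext fun x => ?_)).mp (PrincipalBundle.isPlot_act
      (L.smooth_s _ m _ (isPlot_base hpg) hg) (E.dSmooth_toH.isPlot_comp (isPlot_chart hpg hg)))
    refine (congrArg (R.act _) (map_mul E.toH _ _)).trans ?_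
    rw [R.act_mul, ← L.s_eq]
    rfl
  proj_map p := by rw [R.proj_act, L.proj_s]; rfl
  map_act p h := by
    change R.act _ (E.toH (p.fibre * h)) = _
    rw [map_mul, R.act_mul]
    rfl

theorem liftingMap_point (x : B) (y : X) (h : y ∈ L.V x) (k : E.Hhat) :
    L.liftingMap.toFun (L.point x y h k) = R.act (L.s x y h) (E.toH k) := by
  have : R.act (L.s ⟨y, L.le x h⟩ y (L.mem ⟨y, L.le x h⟩))
      (E.toH (L.k ⟨y, L.le x h⟩ x y (L.mem ⟨y, L.le x h⟩) h * k)) =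
      R.act (L.s x y h) (E.toH k) := by
    rw [map_mul, R.act_mul, ← L.s_eq]
  exact this

theorem point_eq_act (x : B) (y : X) (h : y ∈ L.V x) (k : E.Hhat) :
    L.point x y h k = L.bundle.act (L.point x y h 1) k := by
  refine Total.ext rfl ?_
  change _ = L.k _ _ _ _ _ * 1 * k
  rw [mul_one]
  rfl

theorem point_eq (x x' : B) (y : X) (h : y ∈ L.V x) (h' : y ∈ L.V x') :
    L.point x' y h' 1 = L.bundle.act (L.point x y h 1) (L.k x x' y h h') := by
  rw [← point_eq_act]
  refine Total.ext rfl ?_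
  change L.k _ _ _ _ _ * 1 = L.k _ _ _ _ _ * L.k _ _ _ _ _
  rw [mul_one, L.cocycle]

end LiftCocycle

/-! ### The obstruction class and lifts -/

open Cech

variable {P : PrincipalBundle E.H (⊤ : Opens X)} [IsDiffeologicalGroup Ghat]

/-- The computation behind the correction of lifts: `m, m', m''` are the lifts on the three edges of
a triangle, and `a, b, c` the values of the bounding cochain there. The hypothesis is the coboundary
equation, with `b` conjugated into the first trivialization. -/
theorem corrected_mul {A : Type*} [Group A] {a b c m m' m'' : A}
    (e : m * b * m⁻¹ * a = m * m' * m''⁻¹ * c) : a⁻¹ * m * (b⁻¹ * m') = c⁻¹ * m'' := by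
  have : a⁻¹ * m * (b⁻¹ * m') = (m * b * m⁻¹ * a)⁻¹ * (m * m') := by group
  rw [this, e]
  group

/-- A system of local lifts with trivial obstruction class can be corrected to a cocycle. -/
theorem LiftSystem.exists_liftCocycle {𝒰 : PointedCover X} (L : LiftSystem P 𝒰)
    (h0 : L.obstruction = 0) : Nonempty (LiftCocycle P) := by
  have : IsDiffeologicalGroup E.Hhat := E.isDiffeologicalGroup_Hhat
  obtain ⟨𝒱, hle, b, hb⟩ := exists_refine_of_mk_eq_zero h0
  rw [← L.restrict_cochain hle] at hb
  generalize L.restrict hle = L' at hb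
  have hmem : ∀ {x x' y}, y ∈ 𝒱.set x → y ∈ 𝒱.set x' → y ∈ 𝒱.inter ![x, x'] := fun h h' =>
    mem_inter_two.2 ⟨h, h'⟩
  -- Dividing by the bounding cochain leaves the image in `H_σ` unchanged and removes the defect.
  let k : ∀ x x' y, y ∈ 𝒱.set x → y ∈ 𝒱.set x' → E.Hhat := fun x x' y h h' =>
    (hatAt (L'.s x y h) (b ![x, x']))⁻¹ * L'.k x x' y h h'
  have hk : ∀ x x' y h h', E.toH (k x x' y h h') = E.toH (L'.k x x' y h h') := by
    intro x x' y h h'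
    rw [map_mul, map_inv, hatAt, E.toH_inclHhat, inv_one, one_mul]
  refine ⟨{
    V := fun x => 𝒱.set x.1
    mem := fun x => 𝒱.mem x.1
    le := fun x => le_top
    s := fun x => L'.s x.1
    smooth_s := fun x => L'.smooth_s x.1
    proj_s := fun x => L'.proj_s x.1
    k := fun x x' => k x.1 x'.1
    smooth_k := fun x x' n q hq h h' => ?_
    s_eq := fun x x' y h h' => ?_
    cocycle := fun x x' x'' y h h' h'' => ?_ }⟩
  · refine IsPlot.mul (IsPlot.inv ?_) (L'.smooth_k _ _ n q hq h h')
    exact E.dSmooth_inclHhat.isPlot_comp (p := fun t => Additive.toMul (evalAt _ _))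
      (isPlot_evalAt (b ![x.1, x'.1]) (L'.smooth_s _ n q hq h) fun t => by
        rw [L'.proj_s]; exact hmem (h t) (h' t))
  · rw [hk]; exact L'.s_eq _ _ _ _ _
  · obtain ⟨x, -⟩ := x
    obtain ⟨x', -⟩ := x'
    obtain ⟨x'', -⟩ := x''
    dsimp only at h h' h'' ⊢
    have e1 := congrArg (evalAt (L'.s x y h)) (congrFun hb ![x, x', x''])
    rw [evalAt_d_one _ (by rw [L'.proj_s]; exact mem_inter_three.2 ⟨h, h', h''⟩),
      sub_add_eq_add_sub, sub_eq_iff_eq_add] at e1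
    have e2 := congrArg (fun a => E.inclHhat (Additive.toMul a)) e1
    simp only [E.inclHhat_toMul_add] at e2
    change hatAt _ _ * hatAt _ _ = hatAt _ _ * hatAt _ _ at e2
    have e3 : hatAt (L'.s x y h) (b ![x', x'']) = L'.k x x' y h h' *
        hatAt (L'.s x' y h') (b ![x', x'']) * (L'.k x x' y h h')⁻¹ := by
      rw [L'.s_eq_symm h h', hatAt_act, inv_inv]
    rw [L'.hatAt_cochain h h' h'', e3] at e2
    exact corrected_mul e2

theorem LiftSystem.exists_bundleLift {𝒰 : PointedCover X} [IsDTopologyCompatible X]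
    (L : LiftSystem P 𝒰) (h0 : L.obstruction = 0) : Nonempty (BundleLift P) :=
  let ⟨C⟩ := L.exists_liftCocycle h0
  ⟨C.liftingMap.bundleLift⟩

/-- The obstruction class of the transition functions of a lift is zero. -/
theorem exists_liftSystem_of_bundleLift (Q : BundleLift P) :
    ∃ (𝒰 : PointedCover X) (L : LiftSystem P 𝒰), L.obstruction = 0 := by
  choose V hV _ s hs hsp using fun x => Q.bundle.exists_local_section x trivial
  -- The sections of `P` are images of sections of the lift, and the quotients of the latter lift
  -- the transition functions. Quotients in a principal bundle compose exactly, so the defect is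
  -- trivial.
  let L : LiftSystem P ⟨V, hV⟩ :=
    { s := fun x y h => Q.map.toFun (s x ⟨y, h⟩)
      smooth_s := fun x n q hq h =>
        Q.map.smooth.isPlot_comp ((hs x).isPlot_comp (hq.subtypeMk h))
      proj_s := fun x y h => by rw [Q.map.proj_map, hsp]
      k := fun x x' y h h' => Q.bundle.div (s x ⟨y, h⟩) (s x' ⟨y, h'⟩)
      smooth_k := fun x x' n q hq h h' => PrincipalBundle.isPlot_div
        ((hs x).isPlot_comp (hq.subtypeMk h)) ((hs x').isPlot_comp (hq.subtypeMk h'))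
        fun t => by rw [hsp, hsp]
      s_eq := fun x x' y h h' => by
        rw [← Q.map.map_act, PrincipalBundle.act_div (by rw [hsp, hsp])] }
  refine ⟨_, L, mk_eq_zero_of_mem ?_⟩
  have h0 : L.cochain = 0 := funext fun t => by
    obtain ⟨x, y, z, rfl⟩ : ∃ x y z, t = ![x, y, z] := ⟨_, _, _, eq_vec_three t⟩
    refine L.section_ext_at (x := x) (fun v hv => (mem_inter_three.1 hv).1) fun v hx hv => ?_
    obtain ⟨-, hy, hz⟩ := mem_inter_three.1 hv
    apply E.inclHhat_toMul_injective
    refine (L.hatAt_cochain hx hy hz).trans ?_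
    rw [Pi.zero_apply, map_zero, toMul_zero, map_one, mul_inv_eq_one]
    refine (PrincipalBundle.div_eq ?_).symm
    rw [Q.bundle.act_mul, PrincipalBundle.act_div (by rw [hsp, hsp]),
      PrincipalBundle.act_div (by rw [hsp, hsp])]
  exact (congrArg (· ∈ coboundaries _ _ 2) h0).mpr (zero_mem _)

end Gluing

/-! ### Sheaves of sets -/

section Sheaves

variable {X : Type u} [TopologicalSpace X]

/-- Restriction in a presheaf of sets. -/
def secRes (F : (Opens X)ᵒᵖ ⥤ Type u) {V W : Opens X} (h : W ≤ V) (t : F.obj (op V)) :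
    F.obj (op W) := F.map (homOfLE h).op t

theorem secRes_secRes (F : (Opens X)ᵒᵖ ⥤ Type u) {V W O : Opens X} (h : W ≤ V) (k : O ≤ W)
    (t : F.obj (op V)) : secRes F k (secRes F h t) = secRes F (k.trans h) t := by
  have : F.map (homOfLE (k.trans h)).op = F.map (homOfLE h).op ≫ F.map (homOfLE k).op := by
    rw [← F.map_comp]; rfl
  rw [secRes, secRes, secRes, this]
  rfl

theorem secRes_self (F : (Opens X)ᵒᵖ ⥤ Type u) {V : Opens X} (t : F.obj (op V)) :
    secRes F le_rfl t = t := by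
  simp [secRes]

theorem isSheaf_of_gluing (F : (Opens X)ᵒᵖ ⥤ Type u)
    (h : ∀ (ι : Type u) (U : ι → Opens X) (s : ∀ i, F.obj (op (U i))),
      (∀ i j, secRes F (inf_le_left : U i ⊓ U j ≤ _) (s i) = secRes F inf_le_right (s j)) →
      ∃! t : F.obj (op (iSup U)), ∀ i, secRes F (le_iSup U i) t = s i) :
    Presheaf.IsSheaf (Opens.grothendieckTopology X) F :=
  TopCat.Presheaf.isSheaf_of_isSheafUniqueGluing_types (X := TopCat.of X) F
    fun ι U s hs => h ι U s hs

variable {F : (Opens X)ᵒᵖ ⥤ Type u} (hF : Presheaf.IsSheaf (Opens.grothendieckTopology X) F)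
include hF

theorem exists_gluing {ι : Type u} (U : ι → Opens X) {V : Opens X} (hU : ∀ i, U i ≤ V)
    (hV : V ≤ iSup U) (s : ∀ i, F.obj (op (U i)))
    (hs : ∀ i j, secRes F (inf_le_left : U i ⊓ U j ≤ _) (s i) = secRes F inf_le_right (s j)) :
    ∃ t : F.obj (op V), ∀ i, secRes F (hU i) t = s i := by
  refine (TopCat.Sheaf.existsUnique_gluing' (C := Type u) (X := TopCat.of X) ⟨F, hF⟩ U V
    (fun i => homOfLE (hU i)) hV s ?_).exists
  exact hs

theorem eq_of_locally_eq {ι : Type u} (U : ι → Opens X) {V : Opens X} (hU : ∀ i, U i ≤ V)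
    (hV : V ≤ iSup U) {s t : F.obj (op V)} (h : ∀ i, secRes F (hU i) s = secRes F (hU i) t) :
    s = t :=
  TopCat.Sheaf.eq_of_locally_eq' (X := TopCat.of X) ⟨F, hF⟩ U V (fun i => homOfLE (hU i)) hV s t h

end Sheaves

/-! ### Torsors -/

section Torsors

variable {X : Type u} [TopologicalSpace X] {A : (Opens X)ᵒᵖ ⥤ AddCommGrpCat.{u}}

open Cech

namespace TorsorGerbe

theorem secRes_act (T : TorsorGerbe A) {V W : Opens X} (h : W ≤ V) (a : A.obj (op V))
    (t : T.sec.obj (op V)) :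
    secRes T.sec h (T.act V a t) = T.act W (res A h a) (secRes T.sec h t) := T.res_act h a t

theorem act_injective (T : TorsorGerbe A) {V : Opens X} {a b : A.obj (op V)}
    {t : T.sec.obj (op V)} (h : T.act V a t = T.act V b t) : a = b :=
  (T.simply_transitive V t (T.act V b t)).unique h rfl

/-- Two families of local sections of torsors have the same transition functions. -/
def SameTransition (T T' : TorsorGerbe A) {I : Type u} (V : I → Opens X)
    (t : ∀ i, T.sec.obj (op (V i))) (t' : ∀ i, T'.sec.obj (op (V i))) : Prop :=
  ∀ i j (O : Opens X) (hi : O ≤ V i) (hj : O ≤ V j) (a : A.obj (op O)),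
    T.act O a (secRes T.sec hi (t i)) = secRes T.sec hj (t j) →
    T'.act O a (secRes T'.sec hi (t' i)) = secRes T'.sec hj (t' j)

variable {T T' : TorsorGerbe A} {I : Type u} {V : I → Opens X}
  {t : ∀ i, T.sec.obj (op (V i))} {t' : ∀ i, T'.sec.obj (op (V i))}

theorem SameTransition.symm (h : SameTransition T T' V t t') : SameTransition T' T V t' t := by
  intro i j O hi hj a ha
  obtain ⟨b, hb, -⟩ := T.simply_transitive O (secRes T.sec hi (t i)) (secRes T.sec hj (t j))
  have := h i j O hi hj b hb
  rw [← ha] at this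
  rwa [← T'.act_injective this]

/-- Two sections of torsors have the same coordinates with respect to local sections. -/
def SameCoordinates (t : ∀ i, T.sec.obj (op (V i))) (t' : ∀ i, T'.sec.obj (op (V i)))
    {W : Opens X} (s : T.sec.obj (op W)) (s' : T'.sec.obj (op W)) : Prop :=
  ∀ i (O : Opens X) (hi : O ≤ V i) (hW : O ≤ W) (b : A.obj (op O)),
    T.act O b (secRes T.sec hi (t i)) = secRes T.sec hW s →
    T'.act O b (secRes T'.sec hi (t' i)) = secRes T'.sec hW s'

theorem SameCoordinates.res {W W' : Opens X} {s : T.sec.obj (op W)} {s' : T'.sec.obj (op W)}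
    (h : SameCoordinates t t' s s') (hW : W' ≤ W) :
    SameCoordinates t t' (secRes T.sec hW s) (secRes T'.sec hW s') := by
  intro i O hi hO b hb
  rw [secRes_secRes] at hb ⊢
  exact h i O hi _ b hb

theorem SameCoordinates.act {W : Opens X} {s : T.sec.obj (op W)} {s' : T'.sec.obj (op W)}
    (h : SameCoordinates t t' s s') (a : A.obj (op W)) :
    SameCoordinates t t' (T.act W a s) (T'.act W a s') := by
  intro i O hi hO b hb
  rw [secRes_act] at hb ⊢
  rw [← h i O hi hO (-Cech.res A hO a + b) (by rw [T.add_act, hb, ← T.add_act, neg_add_cancel,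
    T.zero_act]), ← T'.add_act, add_neg_cancel_left]

theorem SameCoordinates.unique (hV : T.U ≤ iSup V) {W : Opens X} {s : T.sec.obj (op W)}
    {s' s'' : T'.sec.obj (op W)} (h : SameCoordinates t t' s s')
    (h' : SameCoordinates t t' s s'') : s' = s'' := by
  refine eq_of_locally_eq T'.isSheaf (fun i => W ⊓ V i) (fun i => inf_le_left) ?_ fun i => ?_
  · rw [← inf_iSup_eq]
    exact le_inf le_rfl ((T.le_of_sec W s).trans hV)
  · obtain ⟨b, hb, -⟩ := T.simply_transitive (W ⊓ V i) (secRes T.sec inf_le_right (t i))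
      (secRes T.sec inf_le_left s)
    rw [← h i _ inf_le_right inf_le_left b hb, ← h' i _ inf_le_right inf_le_left b hb]

/-- Let `b i` be the coordinates of `s` with respect to `t i`. The sections `b i · t' i` agree on
overlaps because the transition functions coincide, and they glue since the target is a sheaf. -/
theorem SameTransition.exists_sameCoordinates (h : SameTransition T T' V t t') (hV : T.U ≤ iSup V)
    {W : Opens X} (s : T.sec.obj (op W)) :
    ∃ s' : T'.sec.obj (op W), SameCoordinates t t' s s' := by
  choose b hb _ using fun i => T.simply_transitive (W ⊓ V i) (secRes T.sec inf_le_right (t i))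
      (secRes T.sec inf_le_left s)
  have key : ∀ i (O : Opens X) (hi : O ≤ V i) (hW : O ≤ W) (c : A.obj (op O)),
      T.act O c (secRes T.sec hi (t i)) = secRes T.sec hW s →
      c = Cech.res A (le_inf hW hi) (b i) := fun i O hi hW c hc => by
    have := congrArg (secRes T.sec (le_inf hW hi)) (hb i)
    rw [secRes_act, secRes_secRes, secRes_secRes, ← hc] at this
    exact (T.act_injective this).symm
  obtain ⟨s', hs'⟩ := exists_gluing T'.isSheaf (fun i => W ⊓ V i) (V := W) (fun i => inf_le_left)
    (by rw [← inf_iSup_eq]; exact le_inf le_rfl ((T.le_of_sec W s).trans hV))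
    (fun i => T'.act _ (b i) (secRes T'.sec inf_le_right (t' i))) (fun i j => by
      have hi : (W ⊓ V i) ⊓ (W ⊓ V j) ≤ V i := inf_le_left.trans inf_le_right
      have hj : (W ⊓ V i) ⊓ (W ⊓ V j) ≤ V j := inf_le_right.trans inf_le_right
      have hW : (W ⊓ V i) ⊓ (W ⊓ V j) ≤ W := inf_le_left.trans inf_le_left
      obtain ⟨a, ha, -⟩ := T.simply_transitive _ (secRes T.sec hi (t i)) (secRes T.sec hj (t j))
      have ha' := h i j _ hi hj a ha
      have hbi := congrArg (secRes T.sec (inf_le_left : (W ⊓ V i) ⊓ (W ⊓ V j) ≤ _)) (hb i)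
      have hbj := congrArg (secRes T.sec (inf_le_right : (W ⊓ V i) ⊓ (W ⊓ V j) ≤ _)) (hb j)
      have := hbi.trans (Eq.trans (by rw [secRes_secRes, secRes_secRes]) hbj.symm)
      rw [secRes_act, secRes_act, secRes_secRes, secRes_secRes, ← ha, ← T.add_act] at this
      rw [secRes_act, secRes_act, secRes_secRes, secRes_secRes, ← ha', ← T'.add_act,
        T.act_injective this])
  refine ⟨s', fun i O hi hW c hc => ?_⟩
  have := congrArg (secRes T'.sec (le_inf hW hi)) (hs' i)
  rw [secRes_act, secRes_secRes, secRes_secRes] at this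
  rw [key i O hi hW c hc, this]

theorem Hom.map_secRes (m : T ⟶ T') {W O : Opens X} (h : O ≤ W) (s : T.sec.obj (op W)) :
    (Hom.map m).app (op O) (secRes T.sec h s) = secRes T'.sec h ((Hom.map m).app (op W) s) :=
  NatTrans.naturality_apply (Hom.map m) (homOfLE h).op s

/-- Local sections with the same transition functions define a morphism of torsors. -/
theorem SameTransition.exists_hom (h : SameTransition T T' V t t') (hV : T.U ≤ iSup V)
    (hU : T.U ≤ T'.U) : ∃ m : T ⟶ T', ∀ i, (Hom.map m).app _ (t i) = t' i := by
  choose f hf using fun (W : Opens X) (s : T.sec.obj (op W)) => h.exists_sameCoordinates hV s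
  refine ⟨{
    le := hU
    map := { app := fun W => ↾(f W.unop), naturality := fun W W' i => ?_ }
    map_act := fun W a s => (hf _ _).unique hV ((hf _ _).act a) }, fun i => ?_⟩
  · ext s
    exact (hf _ _).unique hV ((hf _ _).res i.unop.le)
  · have := hf (V i) (t i) i (V i) le_rfl le_rfl 0 (T.zero_act _ _)
    rw [T'.zero_act, secRes_self, secRes_self] at this
    exact this.symm

theorem hom_ext_of_sections (hV : T.U ≤ iSup V) {m m' : T ⟶ T'}
    (h : ∀ i, (Hom.map m).app _ (t i) = (Hom.map m').app _ (t i)) : m = m' := by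
  refine Hom.ext (NatTrans.ext (funext fun W => ?_))
  obtain ⟨W⟩ := W
  ext s
  refine eq_of_locally_eq T'.isSheaf (fun i => W ⊓ V i) (fun i => inf_le_left) ?_ fun i => ?_
  · rw [← inf_iSup_eq]
    exact le_inf le_rfl ((T.le_of_sec W s).trans hV)
  · obtain ⟨b, hb, -⟩ := T.simply_transitive (W ⊓ V i) (secRes T.sec inf_le_right (t i))
      (secRes T.sec inf_le_left s)
    change secRes T'.sec _ ((Hom.map m).app _ s) = secRes T'.sec _ ((Hom.map m').app _ s)
    rw [← Hom.map_secRes, ← Hom.map_secRes, ← hb, Hom.map_act, Hom.map_act, Hom.map_secRes,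
      Hom.map_secRes, h]

/-- Local sections with the same transition functions define an isomorphism of torsors. -/
theorem SameTransition.nonempty_iso (h : SameTransition T T' V t t') (hV : T.U ≤ iSup V)
    (hU : T.U = T'.U) : Nonempty (T ≅ T') := by
  have hV' : T'.U ≤ iSup V := hU ▸ hV
  obtain ⟨m, hm⟩ := h.exists_hom hV hU.le
  obtain ⟨m', hm'⟩ := h.symm.exists_hom hV' hU.ge
  refine ⟨⟨m, m', hom_ext_of_sections (t := t) hV fun i => ?_,
    hom_ext_of_sections (t := t') hV' fun i => ?_⟩⟩
  · change (Hom.map m').app _ ((Hom.map m).app _ (t i)) = t i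
    rw [hm, hm']
  · change (Hom.map m).app _ ((Hom.map m').app _ (t' i)) = t' i
    rw [hm', hm]

end TorsorGerbe

end Torsors

section Gerbe

variable {X : Type u} [TopologicalSpace X] [DiffeologicalSpace X]
  {G Ghat : Type u} [Group G] [DiffeologicalSpace G] [Group Ghat] [DiffeologicalSpace Ghat]
  {E : TwistedCentralExtension G Ghat} {P : PrincipalBundle E.H (⊤ : Opens X)}

/-! ### Morphisms of the lifting gerbe -/

namespace LiftingGerbe

variable {Q Q' Q'' : LiftingGerbe P}

theorem toP_act (Q : LiftingGerbe P) (q : Q.carrier) (k : E.Hhat) :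
    Q.toP (Q.lift.bundle.act q k) = P.act (Q.toP q) (E.toH k) :=
  congrArg Subtype.val (Q.lift.iso_act q k)

theorem proj_toP_eq (Q : LiftingGerbe P) (q : Q.carrier) :
    P.proj (Q.toP q) = Q.lift.bundle.proj q := Q.lift.proj_iso q

theorem isPlot_toP {n : ℕ} {q : EuclideanSpace ℝ (Fin n) → Q.carrier} (hq : IsPlot q) :
    IsPlot (fun t => Q.toP (q t)) :=
  (Q.lift.map.smooth.isPlot_comp hq).subtypeVal

theorem toP_eq_iff {q q' : Q.carrier} :
    Q.toP q = Q.toP q' ↔ ∃ z : Circle, q' = Q.lift.bundle.act q (E.inclHhat z) :=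
  Subtype.ext_iff.symm.trans Q.lift.map.eq_iff

theorem exists_toP_eq (Q : LiftingGerbe P) {p : P.carrier} (hp : P.proj p ∈ Q.U) :
    ∃ q, Q.toP q = p :=
  let ⟨q, hq⟩ := Q.lift.map.surjective ⟨p, hp⟩
  ⟨q, congrArg Subtype.val hq⟩

theorem isPlot_of_toP_lift [IsDTopologyCompatible X] {Z : Type*} [DiffeologicalSpace Z] {n : ℕ}
    {r : EuclideanSpace ℝ (Fin n) → P.carrier} (hr : IsPlot r) (hrU : ∀ t, P.proj (r t) ∈ Q.U)
    {f : EuclideanSpace ℝ (Fin n) → Z}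
    (h : ∀ (m : ℕ) (g : EuclideanSpace ℝ (Fin m) → EuclideanSpace ℝ (Fin n))
      (c : EuclideanSpace ℝ (Fin m) → Q.carrier), IsPlot g → IsPlot c →
      (∀ x, Q.toP (c x) = r (g x)) → IsPlot (fun x => f (g x))) : IsPlot f :=
  Q.lift.map.isPlot_of_lift (hr.subtypeMk hrU) fun m g c hg hc hcr =>
    h m g c hg hc fun x => congrArg Subtype.val (hcr x)

namespace Hom

theorem proj_toFun (f : Hom Q Q') (q : Q.carrier) :
    Q'.lift.bundle.proj (f.toFun q) = Q.lift.bundle.proj q := by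
  rw [← proj_toP_eq, f.toP_comp, proj_toP_eq]

theorem exists_toFun_eq (f : Hom Q Q') {q' : Q'.carrier} (h : Q'.lift.bundle.proj q' ∈ Q.U) :
    ∃ q, f.toFun q = q' := by
  obtain ⟨q, hq⟩ := Q.lift.bundle.exists_mem_fibre h
  refine ⟨Q.lift.bundle.act q (Q'.lift.bundle.div (f.toFun q) q'), ?_⟩
  rw [f.map_act, PrincipalBundle.act_div (by rw [f.proj_toFun, hq])]

/-- Equivariant maps preserve quotients of points in a fibre. The point `c` is thus recovered from a
local section and the quotient computed in the target, where everything is smooth. -/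
theorem isPlot_of_toFun [IsDTopologyCompatible X] (f : Hom Q Q') {n : ℕ}
    {c : EuclideanSpace ℝ (Fin n) → Q.carrier} (hc : IsPlot (fun t => f.toFun (c t))) :
    IsPlot c := by
  have hproj : ∀ t, Q'.lift.bundle.proj (f.toFun (c t)) = Q.lift.bundle.proj (c t) := fun t =>
    f.proj_toFun _
  refine isPlot_of_opens (PrincipalBundle.isPlot_proj hc) fun t => ?_
  obtain ⟨V, htV, _, s, hs, hsp⟩ := Q.lift.bundle.exists_local_section _
    (Q.lift.bundle.proj_mem (c t))
  refine ⟨V, by rwa [hproj], fun m g hgV hg => ?_⟩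
  have hcg := hc.comp_plot hg
  have hsg := hs.isPlot_comp ((PrincipalBundle.isPlot_proj hcg).subtypeMk hgV)
  have hp : ∀ x, Q'.lift.bundle.proj (f.toFun (s ⟨_, hgV x⟩)) =
      Q'.lift.bundle.proj (f.toFun (c (g x))) := fun x => by rw [f.proj_toFun, hsp]
  refine (congrArg IsPlot (funext fun x => ?_)).mp (PrincipalBundle.isPlot_act hsg
    (PrincipalBundle.isPlot_div (f.smooth.isPlot_comp hsg) hcg hp))
  have hp' : Q.lift.bundle.proj (s ⟨_, hgV x⟩) = Q.lift.bundle.proj (c (g x)) :=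
    (hsp _).trans (hproj _)
  have : Q'.lift.bundle.div (f.toFun (s ⟨_, hgV x⟩)) (f.toFun (c (g x))) =
      Q.lift.bundle.div (s ⟨_, hgV x⟩) (c (g x)) :=
    PrincipalBundle.div_eq (by rw [← f.map_act, PrincipalBundle.act_div hp'])
  rw [this, PrincipalBundle.act_div hp']
  rfl

/-- The morphism of lifts defined by sections with the same image in `P`. -/
def ofSections (hU : Q.U ≤ Q'.U) (s : Q.U → Q.carrier) (hs : DSmooth s)
    (hsp : ∀ y, Q.lift.bundle.proj (s y) = y) (s' : Q.U → Q'.carrier) (hs' : DSmooth s')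
    (h : ∀ y, Q'.toP (s' y) = Q.toP (s y)) : Hom Q Q' where
  le := hU
  toFun q := Q'.lift.bundle.act (s' ⟨Q.lift.bundle.proj q, Q.lift.bundle.proj_mem q⟩)
    (Q.lift.bundle.div (s ⟨Q.lift.bundle.proj q, Q.lift.bundle.proj_mem q⟩) q)
  smooth n q hq := by
    have hb := (PrincipalBundle.isPlot_proj hq).subtypeMk fun t => Q.lift.bundle.proj_mem (q t)
    exact PrincipalBundle.isPlot_act (hs'.isPlot_comp hb)
      (PrincipalBundle.isPlot_div (hs.isPlot_comp hb) hq fun t => hsp _)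
  map_act q k := by
    have : (⟨_, Q.lift.bundle.proj_mem (Q.lift.bundle.act q k)⟩ : Q.U) =
      ⟨_, Q.lift.bundle.proj_mem q⟩ := Subtype.ext (Q.lift.bundle.proj_act q k)
    rw [this, PrincipalBundle.div_act_right (hsp _), Q'.lift.bundle.act_mul]
  toP_comp q := by
    rw [toP_act, h, ← toP_act, PrincipalBundle.act_div (hsp _)]

theorem isPlot_hatAt {U : Opens X} (a : (circleSystem P).obj (op U)) {n : ℕ}
    {p : EuclideanSpace ℝ (Fin n) → P.carrier} (hp : IsPlot p) (h : ∀ t, P.proj (p t) ∈ U) :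
    IsPlot (fun t => hatAt (p t) a) :=
  E.dSmooth_inclHhat.isPlot_comp (p := fun t => Additive.toMul (evalAt (p t) a))
    (isPlot_evalAt a hp h)

/-- The action of sections of `U(1)_α` on morphisms of the lifting gerbe. -/
def twist (a : (circleSystem P).obj (op Q.U)) (f : Hom Q Q') : Hom Q Q' where
  le := f.le
  toFun q := Q'.lift.bundle.act (f.toFun q) (hatAt (Q.toP q) a)
  smooth n q hq := PrincipalBundle.isPlot_act (f.smooth.isPlot_comp hq)
    (isPlot_hatAt a (isPlot_toP hq) fun t => Q.proj_toP _)
  map_act q k := by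
    -- At `q · k` the value of `a` is conjugated by `k`, which is exactly what lets multiplication
    -- by `a` commute with translation by `k`.
    rw [f.map_act, toP_act, hatAt_act, ← Q'.lift.bundle.act_mul, ← Q'.lift.bundle.act_mul]
    congr 1
    group
  toP_comp q := by
    rw [toP_act, hatAt, E.toH_inclHhat, P.act_one, f.toP_comp]

theorem twist_toFun (a : (circleSystem P).obj (op Q.U)) (f : Hom Q Q') (q : Q.carrier) :
    (twist a f).toFun q = Q'.lift.bundle.act (f.toFun q) (hatAt (Q.toP q) a) := rfl

theorem twist_zero (f : Hom Q Q') : twist 0 f = f := by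
  refine Hom.ext (funext fun q => ?_)
  rw [twist_toFun, hatAt, map_zero, toMul_zero, map_one, Q'.lift.bundle.act_one]

theorem twist_add (a b : (circleSystem P).obj (op Q.U)) (f : Hom Q Q') :
    twist (a + b) f = twist a (twist b f) := by
  refine Hom.ext (funext fun q => ?_)
  rw [twist_toFun, twist_toFun, twist_toFun, ← Q'.lift.bundle.act_mul, hatAt, hatAt, hatAt,
    ← E.inclHhat_toMul_add, map_add, add_comm]

theorem comp_twist (f : Q ⟶ Q') (g : Q' ⟶ Q'') (a : (circleSystem P).obj (op Q'.U)) :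
    f ≫ (show Q' ⟶ Q'' from twist a g) = twist (Cech.res _ (Hom.le f) a) (f ≫ g) := by
  refine Hom.ext (funext fun q => ?_)
  change Q''.lift.bundle.act (g.toFun (f.toFun q)) (hatAt (Q'.toP (f.toFun q)) a) =
    Q''.lift.bundle.act (g.toFun (f.toFun q)) (hatAt (Q.toP q) _)
  rw [f.toP_comp, hatAt, hatAt, evalAt_res _ _ (Q.proj_toP q)]

theorem twist_comp (f : Q ⟶ Q') (g : Q' ⟶ Q'') (a : (circleSystem P).obj (op Q.U)) :
    (show Q ⟶ Q' from twist a f) ≫ g = twist a (f ≫ g) :=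
  Hom.ext (funext fun _ => g.map_act _ _)

/-- Both morphisms have the same image in `P`, so at each `q` they differ by a circle element. It
depends only on the image of `q` in `P`, because `U(1)` is commutative. Smoothness is tested on
local lifts of plots of `P`, and equivariance follows from freeness. -/
theorem exists_twist_eq [IsDTopologyCompatible X] (f f' : Hom Q Q') : ∃ a, twist a f = f' := by
  have key : ∀ q, ∃ z, f'.toFun q = Q'.lift.bundle.act (f.toFun q) (E.inclHhat z) := fun q =>
    toP_eq_iff.1 (by rw [f.toP_comp, f'.toP_comp])
  have hchoice : ∀ p : P.carrier, ∃ z : Circle, ∀ q, Q.toP q = p →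
      f'.toFun q = Q'.lift.bundle.act (f.toFun q) (E.inclHhat z) := fun p => by
    by_cases h : ∃ q, Q.toP q = p
    · obtain ⟨q, rfl⟩ := h
      obtain ⟨z, hz⟩ := key q
      refine ⟨z, fun q' hq' => ?_⟩
      obtain ⟨w, rfl⟩ := toP_eq_iff.1 hq'.symm
      rw [f'.map_act, f.map_act, hz, ← Q'.lift.bundle.act_mul, ← Q'.lift.bundle.act_mul,
        ← map_mul, ← map_mul, mul_comm]
    · exact ⟨1, fun q hq => absurd ⟨q, hq⟩ h⟩
  choose z hz using hchoice
  refine ⟨sectionMk (fun p => Additive.ofMul (z p)) (fun n r hr hrU => ?_) (fun p k hp => ?_),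
    Hom.ext (funext fun q => ?_)⟩
  · refine isPlot_of_toP_lift hr hrU fun m g c hg hc hcr => ?_
    refine E.isPlot_of_inclHhat (p := fun x => z (r (g x))) ?_
    refine (congrArg IsPlot (funext fun x => ?_)).mp (PrincipalBundle.isPlot_div
      (f.smooth.isPlot_comp hc) (f'.smooth.isPlot_comp hc) fun x => by
        rw [f.proj_toFun, f'.proj_toFun])
    exact PrincipalBundle.div_eq (hz _ _ (hcr x)).symm
  · obtain ⟨q, rfl⟩ := Q.exists_toP_eq hp
    obtain ⟨κ, rfl⟩ := E.toH_surjective k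
    apply E.inclHhat_toMul_injective
    refine Eq.trans ?_ (E.inclHhat_centralAction κ (z (Q.toP q))).symm
    have h1 := hz _ _ (Q.toP_act q κ)
    rw [f'.map_act, hz _ q rfl, f.map_act, ← Q'.lift.bundle.act_mul, ← Q'.lift.bundle.act_mul] at h1
    have h2 := Q'.lift.bundle.free _ _ _ h1
    rw [mul_assoc, h2, inv_mul_cancel_left]
    rfl
  · rw [twist_toFun, hatAt, evalAt_sectionMk (Q.proj_toP q)]
    exact (hz _ q rfl).symm

theorem twist_injective {a b : (circleSystem P).obj (op Q.U)} {f : Hom Q Q'}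
    (h : twist a f = twist b f) : a = b := section_ext fun p hp => by
  obtain ⟨q, rfl⟩ := Q.exists_toP_eq hp
  exact E.inclHhat_toMul_injective
    (Q'.lift.bundle.free _ _ _ (congrFun (congrArg Hom.toFun h) q))

end Hom

end LiftingGerbe

end Gerbe

section Gerbe

variable {X : Type u} [TopologicalSpace X] [DiffeologicalSpace X]
  {G Ghat : Type u} [Group G] [DiffeologicalSpace G] [Group Ghat] [DiffeologicalSpace Ghat]
  {E : TwistedCentralExtension G Ghat} {P : PrincipalBundle E.H (⊤ : Opens X)}

/-- Smooth maps to `H_σ` lift locally to `Ĥ_σ̂`. -/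
theorem TwistedCentralExtension.HasLocalLifts.exists_lift (hE : E.HasLocalLifts X) {U : Opens X}
    {g : U → E.H} (hg : DSmooth g) {x : X} (hx : x ∈ U) :
    ∃ (V : Opens X) (hV : V ≤ U), x ∈ V ∧ ∃ k : V → E.Hhat, DSmooth k ∧
      ∀ y : V, E.toH (k y) = g ⟨y, hV y.2⟩ := by
  obtain ⟨V, hV, hxV, ghat, hghat, hq⟩ := hE U (fun y => (g y).left)
    (fun n p hp => (SemidirectProduct.isPlot_iff.1 (hg.isPlot_comp hp)).1) x hx
  exact ⟨V, hV, hxV, fun y => ⟨ghat y, (g ⟨y, hV y.2⟩).right⟩, fun n p hp =>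
    SemidirectProduct.isPlot_iff.2 ⟨hghat.isPlot_comp hp, (SemidirectProduct.isPlot_iff.1
      (hg.isPlot_comp (hp.subtypeVal.subtypeMk fun t => hV (p t).2))).2⟩,
    fun y => SemidirectProduct.ext (hq y) rfl⟩

namespace LiftingGerbe

variable [IsDTopologyCompatible X]

/-! ### Sections of the lifting gerbe defined by a lift -/

/-- The restriction of a lift of `P` to an open subset. -/
def ofLift (L : BundleLift P) (V : Opens X) : LiftingGerbe P where
  U := V
  lift := LiftingMap.bundleLift (Q := L.bundle.restrict V le_top)
    { toFun := fun q => ⟨L.map.toFun q.1, by rw [L.map.proj_map]; exact q.2⟩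
      smooth := fun n q hq => L.map.smooth.isPlot_comp hq.subtypeVal
      proj_map := fun q => L.map.proj_map q.1
      map_act := fun q k => Subtype.ext (L.map.map_act q.1 k) }

theorem toP_ofLift (L : BundleLift P) (V : Opens X) (q : (ofLift L V).carrier) :
    (ofLift L V).toP q = L.map.toFun q.1 := rfl

/-- The functor of restrictions of a lift of `P`. -/
def restrictions (L : BundleLift P) : Opens X ⥤ LiftingGerbe P where
  obj V := ofLift L V
  map {V W} h :=
    { le := h.le
      toFun := fun q => ⟨q.1, h.le q.2⟩
      smooth := fun n q hq => hq.subtypeVal.subtypeMk _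
      map_act := fun _ _ => rfl
      toP_comp := fun _ => rfl }

/-- The images in `P` of local sections of `L` and `Q` differ by an `H_σ`-valued map, which lifts
locally to `Ĥ_σ̂`. Translating the section of `Q` by the inverse of this lift makes the images
equal. -/
theorem exists_local_hom [IsDiffeologicalGroup Ghat] (hE : E.HasLocalLifts X) (L : BundleLift P)
    (Q : LiftingGerbe P) {x : X} (hx : x ∈ Q.U) :
    ∃ V : Opens X, x ∈ V ∧ Nonempty (ofLift L V ⟶ Q) := by
  have : IsDiffeologicalGroup E.Hhat := E.isDiffeologicalGroup_Hhat
  obtain ⟨V₁, hx₁, -, s₁, hs₁, hp₁⟩ := L.bundle.exists_local_section x trivial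
  obtain ⟨V₂, hx₂, hV₂, s₂, hs₂, hp₂⟩ := Q.lift.bundle.exists_local_section x hx
  have hd : DSmooth fun y : (V₁ ⊓ V₂ : Opens X) =>
      P.div (L.map.toFun (s₁ ⟨y, y.2.1⟩)) (Q.toP (s₂ ⟨y, y.2.2⟩)) := fun n q hq =>
    PrincipalBundle.isPlot_div
      (L.map.smooth.isPlot_comp (hs₁.isPlot_comp (hq.subtypeVal.subtypeMk _)))
      (isPlot_toP (hs₂.isPlot_comp (hq.subtypeVal.subtypeMk _)))
      fun t => by rw [L.map.proj_map, hp₁, proj_toP_eq, hp₂]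
  obtain ⟨V, hV, hxV, k, hk, hkq⟩ := hE.exists_lift hd ⟨hx₁, hx₂⟩
  have key : ∀ y : V, Q.toP (Q.lift.bundle.act (s₂ ⟨y, (hV y.2).2⟩) (k y)⁻¹) =
      L.map.toFun (s₁ ⟨y, (hV y.2).1⟩) := fun y => by
    rw [toP_act, map_inv, hkq]
    have := PrincipalBundle.act_div (P := P) (p := L.map.toFun (s₁ ⟨y, (hV y.2).1⟩))
      (q := Q.toP (s₂ ⟨y, (hV y.2).2⟩)) (by rw [L.map.proj_map, hp₁, proj_toP_eq, hp₂])
    exact (congrArg (fun z => P.act z _) this.symm).trans (PrincipalBundle.act_act_inv _ _)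
  have h₁ : DSmooth fun y : V => (⟨s₁ ⟨y, (hV y.2).1⟩, by rw [hp₁]; exact y.2⟩ :
      (ofLift L V).carrier) := fun n q hq => by
    have hq' : IsPlot fun t => (⟨(q t).1, (hV (q t).2).1⟩ : V₁) := hq
    exact hs₁.isPlot_comp hq'
  have h₂ : DSmooth fun y : V => Q.lift.bundle.act (s₂ ⟨y, (hV y.2).2⟩) (k y)⁻¹ := fun n q hq => by
    have hq' : IsPlot fun t => (⟨(q t).1, (hV (q t).2).2⟩ : V₂) := hq
    exact PrincipalBundle.isPlot_act (hs₂.isPlot_comp hq') (hk.isPlot_comp hq).inv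
  exact ⟨V, hxV, ⟨Hom.ofSections (hV.trans (inf_le_right.trans hV₂)) _ h₁ (fun y => hp₁ _) _ h₂ key⟩⟩

/-- The presheaf of morphisms from the restrictions of a lift of `P`. -/
def homPresheaf (L : BundleLift P) (Q : LiftingGerbe P) : (Opens X)ᵒᵖ ⥤ Type u :=
  (restrictions L).op ⋙ yoneda.obj Q

theorem isSheaf_homPresheaf (L : BundleLift P) (Q : LiftingGerbe P) :
    Presheaf.IsSheaf (Opens.grothendieckTopology X) (homPresheaf L Q) := by
  refine isSheaf_of_gluing _ fun ι U s hs => ?_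
  have hs' : ∀ i j (q : L.bundle.carrier) (hi : L.bundle.proj q ∈ U i)
      (hj : L.bundle.proj q ∈ U j), Hom.toFun (s i) ⟨q, hi⟩ = Hom.toFun (s j) ⟨q, hj⟩ :=
    fun i j q hi hj => congrFun (congrArg Hom.toFun (hs i j)) ⟨q, hi, hj⟩
  have hmem : ∀ q : (ofLift L (iSup U)).carrier, ∃ i, L.bundle.proj q.1 ∈ U i := fun q =>
    Opens.mem_iSup.1 q.2
  choose i hi using hmem
  refine ⟨{
    le := iSup_le fun i => Hom.le (s i)
    toFun := fun q => Hom.toFun (s (i q)) ⟨q.1, hi q⟩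
    smooth := fun n q hq => ?_
    map_act := fun q k => ?_
    toP_comp := fun q => Hom.toP_comp (s (i q)) _ }, fun j => ?_, fun f hf => ?_⟩
  · refine isPlot_of_opens (PrincipalBundle.isPlot_proj hq) fun t =>
      ⟨U (i (q t)), hi (q t), fun m g hgU hg => ?_⟩
    have := (Hom.smooth (s (i (q t)))).isPlot_comp ((hq.subtypeVal.comp_plot hg).subtypeMk hgU)
    exact (congrArg IsPlot (funext fun x => hs' _ _ _ _ _)).mp this
  · exact Eq.trans (hs' _ (i q) _ _ ((congrArg (· ∈ U (i q)) (L.bundle.proj_act q.1 k)).mpr (hi q)))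
      (Hom.map_act (s (i q)) ⟨q.1, hi q⟩ k)
  · exact Hom.ext (funext fun q => hs' _ _ _ _ _)
  · refine Hom.ext (funext fun q => ?_)
    exact congrFun (congrArg Hom.toFun (hf (i q))) ⟨q.1, hi q⟩

variable [IsDiffeologicalGroup Ghat]

/-- The torsor of morphisms from the restrictions of a lift of `P`. -/
def torsor (hE : E.HasLocalLifts X) (L : BundleLift P) (Q : LiftingGerbe P) :
    TorsorGerbe (circleSystem P) where
  U := Q.U
  sec := homPresheaf L Q
  isSheaf := isSheaf_homPresheaf L Q
  le_of_sec _ f := Hom.le f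
  act V a f := Hom.twist (Q := ofLift L V) a f
  zero_act V f := Hom.twist_zero (Q := ofLift L V) f
  add_act V a b f := Hom.twist_add (Q := ofLift L V) a b f
  res_act {V _} h a f := Hom.comp_twist (Q' := ofLift L V) ((restrictions L).map (homOfLE h)) f a
  simply_transitive V f f' :=
    let ⟨a, ha⟩ := Hom.exists_twist_eq (Q := ofLift L V) f f'
    ⟨a, ha, fun _ hb => Hom.twist_injective (Q := ofLift L V) (hb.trans ha.symm)⟩
  locally_nonempty _ hx := exists_local_hom hE L Q hx

/-- The functor from the lifting gerbe to torsors defined by a lift of `P`. -/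
def torsorFunctor (hE : E.HasLocalLifts X) (L : BundleLift P) :
    LiftingGerbe P ⥤ TorsorGerbe (circleSystem P) where
  obj Q := torsor hE L Q
  map f :=
    { le := Hom.le f
      map := Functor.whiskerLeft _ (yoneda.map f)
      map_act := fun V a g => Hom.twist_comp (Q := ofLift L V) g f a }
  map_id Q := TorsorGerbe.Hom.ext (congrArg (Functor.whiskerLeft (restrictions L).op) (yoneda.map_id Q))
  map_comp f g := TorsorGerbe.Hom.ext 
    (congrArg (Functor.whiskerLeft (restrictions L).op) (yoneda.map_comp f g))

/-! ### Full faithfulness of the torsor functor -/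

variable (hE : E.HasLocalLifts X) (L : BundleLift P) {Q Q' : LiftingGerbe P}

include hE in
/-- Every point of a lift of a restriction of `P` is the value of a local morphism. -/
theorem exists_hom_eq (Q : LiftingGerbe P) (q : Q.carrier) :
    ∃ (V : Opens X) (f : ofLift L V ⟶ Q) (r : (ofLift L V).carrier), Hom.toFun f r = q := by
  obtain ⟨V, hxV, ⟨f⟩⟩ := exists_local_hom hE L Q (Q.lift.bundle.proj_mem q)
  obtain ⟨r, hr⟩ := Hom.exists_toFun_eq f hxV
  exact ⟨V, f, r, hr⟩

/-- A morphism is determined by its composites with local morphisms from `L`, since these reach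
every point. -/
instance : (torsorFunctor hE L).Faithful where
  map_injective {Q Q'} f f' h := Hom.ext (funext fun q => by
    obtain ⟨V, g, r, rfl⟩ := exists_hom_eq hE L Q q
    have h1 : g ≫ f = g ≫ f' :=
      ConcreteCategory.congr_hom (congrFun (congrArg NatTrans.app (congrArg TorsorGerbe.Hom.map h))
        (op V)) g
    exact congrFun (congrArg Hom.toFun h1) r)

/-- The value at a section of a morphism of torsors. -/
def mapSection (m : torsor hE L Q ⟶ torsor hE L Q') {V : Opens X} (f : ofLift L V ⟶ Q) :
    ofLift L V ⟶ Q' := (TorsorGerbe.Hom.map m).app (op V) f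

/-- On the overlap, `f` is `g` twisted by a section `a`, and `r` is `r'` translated by `z`. Equality
of the values forces `z` and the value of `a` to cancel. As `m` commutes with the action, the same
cancellation occurs after applying it. -/
theorem mapSection_toFun_eq (m : torsor hE L Q ⟶ torsor hE L Q') {V W : Opens X}
    (f : ofLift L V ⟶ Q) (g : ofLift L W ⟶ Q) {r : (ofLift L V).carrier}
    {r' : (ofLift L W).carrier} (h : Hom.toFun f r = Hom.toFun g r') :
    Hom.toFun (mapSection hE L m f) r = Hom.toFun (mapSection hE L m g) r' := by
  have hr : L.map.toFun r'.1 = L.map.toFun r.1 := by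
    rw [← toP_ofLift, ← toP_ofLift, ← Hom.toP_comp f, h, Hom.toP_comp g]
  obtain ⟨z, hz⟩ := L.map.eq_iff.1 hr
  have hW : L.bundle.proj r.1 ∈ W := by
    rw [hz, L.bundle.proj_act]; exact r'.2
  have hV : L.bundle.proj r'.1 ∈ V := by
    have := r.2
    rwa [hz, L.bundle.proj_act] at this
  let f₀ : ofLift L (V ⊓ W) ⟶ Q := (restrictions L).map (homOfLE inf_le_left) ≫ f
  let g₀ : ofLift L (V ⊓ W) ⟶ Q := (restrictions L).map (homOfLE inf_le_right) ≫ g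
  let r₀ : (ofLift L (V ⊓ W)).carrier := ⟨r.1, r.2, hW⟩
  let r₀' : (ofLift L (V ⊓ W)).carrier := ⟨r'.1, hV, r'.2⟩
  have hr₀ : r₀ = (ofLift L (V ⊓ W)).lift.bundle.act r₀' (E.inclHhat z) := Subtype.ext hz
  obtain ⟨a, ha⟩ := Hom.exists_twist_eq (Q := ofLift L (V ⊓ W)) g₀ f₀
  have hf : mapSection hE L m f₀ = (restrictions L).map (homOfLE inf_le_left) ≫ mapSection hE L m f :=
    TorsorGerbe.Hom.map_secRes m (inf_le_left : V ⊓ W ≤ V) f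
  have hg : mapSection hE L m g₀ = (restrictions L).map (homOfLE inf_le_right) ≫ mapSection hE L m g :=
    TorsorGerbe.Hom.map_secRes m (inf_le_right : V ⊓ W ≤ W) g
  have hma : mapSection hE L m f₀ = Hom.twist a (mapSection hE L m g₀) := by
    rw [← ha]
    exact TorsorGerbe.Hom.map_act m (V ⊓ W) a g₀
  have e1 : Hom.toFun f₀ r₀ = Hom.toFun g₀ r₀' := h
  rw [← ha, Hom.twist_toFun, hr₀, Hom.map_act, ← Q.lift.bundle.act_mul] at e1
  have e2 := Q.lift.bundle.free _ _ _ (e1.trans (Q.lift.bundle.act_one _).symm)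
  change Hom.toFun ((restrictions L).map (homOfLE inf_le_left) ≫ mapSection hE L m f) r₀ =
    Hom.toFun ((restrictions L).map (homOfLE inf_le_right) ≫ mapSection hE L m g) r₀'
  rw [← hf, ← hg, hma, Hom.twist_toFun, hr₀, Hom.map_act, ← Q'.lift.bundle.act_mul, e2,
    Q'.lift.bundle.act_one]

/-- The morphism is defined at `q` by choosing a local morphism that hits `q` and evaluating its
image under `m`; the preceding lemma removes the dependence on the choice. -/
instance : (torsorFunctor hE L).Full where
  map_surjective {Q Q'} m := by
    choose V f r hr using exists_hom_eq hE L Q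
    have key : ∀ {W : Opens X} (g : ofLift L W ⟶ Q) (r' : (ofLift L W).carrier),
        Hom.toFun (mapSection hE L m (f (Hom.toFun g r'))) (r (Hom.toFun g r')) =
          Hom.toFun (mapSection hE L m g) r' := fun g r' => mapSection_toFun_eq hE L m _ _ (hr _)
    let F : Q ⟶ Q' :=
      { le := TorsorGerbe.Hom.le m
        toFun := fun q => Hom.toFun (mapSection hE L m (f q)) (r q)
        smooth := fun n q hq => by
          refine isPlot_of_opens (PrincipalBundle.isPlot_proj hq) fun t => ?_
          obtain ⟨W, hxW, ⟨g⟩⟩ := exists_local_hom hE L Q (Q.lift.bundle.proj_mem (q t))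
          refine ⟨W, hxW, fun l g' hW hg' => ?_⟩
          -- Near a given parameter a single morphism `g` hits the whole plot. Its preimages form a
          -- plot, so smoothness can be read from `mapSection hE L m g`, although the pointwise
          -- choices are not smooth.
          choose c hc using fun x => Hom.exists_toFun_eq g (hW x)
          have hcp : IsPlot c := Hom.isPlot_of_toFun g (by
            simp only [hc]; exact hq.comp_plot hg')
          refine (congrArg IsPlot (funext fun x => ?_)).mp
            ((Hom.smooth (mapSection hE L m g)).isPlot_comp hcp)
          rw [← key, hc]
          rfl
        map_act := fun q k => by
          obtain ⟨W, g, r', rfl⟩ := exists_hom_eq hE L Q q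
          rw [← Hom.map_act g, key, key, Hom.map_act]
        toP_comp := fun q => by
          rw [Hom.toP_comp (mapSection hE L m (f q)), ← Hom.toP_comp (f q), hr] }
    refine ⟨F, TorsorGerbe.Hom.ext (NatTrans.ext (funext fun W => ?_))⟩
    obtain ⟨W⟩ := W
    ext g
    exact Hom.ext (funext fun r' => key g r')

end LiftingGerbe

end Gerbe

section Gerbe

variable {X : Type u} [TopologicalSpace X] [DiffeologicalSpace X]
  {G Ghat : Type u} [Group G] [DiffeologicalSpace G] [Group Ghat] [DiffeologicalSpace Ghat]
  {E : TwistedCentralExtension G Ghat} {P : PrincipalBundle E.H (⊤ : Opens X)}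

/-! ### The lift defined by a torsor -/

/-- Local sections of a lift of `P` and of a torsor, and the transition functions of the
latter. -/
structure LocalTrivialization (L : BundleLift P) (T : TorsorGerbe (circleSystem P)) where
  V : T.U → Opens X
  mem : ∀ x, x.1 ∈ V x
  t : ∀ x, T.sec.obj (op (V x))
  s : ∀ x, V x → L.bundle.carrier
  smooth_s : ∀ x, DSmooth (s x)
  proj_s : ∀ x y, L.bundle.proj (s x y) = y
  a : ∀ x x', (circleSystem P).obj (op (V x ⊓ V x'))
  act_a : ∀ x x', T.act _ (a x x') (secRes T.sec inf_le_left (t x)) =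
    secRes T.sec inf_le_right (t x')

theorem exists_localTrivialization (L : BundleLift P) (T : TorsorGerbe (circleSystem P)) :
    Nonempty (LocalTrivialization L T) := by
  have : ∀ x : T.U, ∃ V : Opens X, x.1 ∈ V ∧ ∃ (_ : T.sec.obj (op V)) (s : V → L.bundle.carrier),
      DSmooth s ∧ ∀ y, L.bundle.proj (s y) = y := fun x => by
    obtain ⟨V₁, hx₁, ⟨t⟩⟩ := T.locally_nonempty x x.2
    obtain ⟨V₂, hx₂, -, s, hs, hsp⟩ := L.bundle.exists_local_section x.1 trivial
    refine ⟨V₁ ⊓ V₂, ⟨hx₁, hx₂⟩, secRes T.sec inf_le_left t, fun y => s ⟨y, y.2.2⟩,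
      fun n q hq => ?_, fun y => hsp _⟩
    have hq' : IsPlot fun t => (⟨(q t).1, (q t).2.2⟩ : V₂) := hq
    exact hs.isPlot_comp hq'
  choose V hV t s hs hsp using this
  choose a ha _ using fun x x' => T.simply_transitive (V x ⊓ V x')
    (secRes T.sec inf_le_left (t x)) (secRes T.sec inf_le_right (t x'))
  exact ⟨⟨V, hV, t, s, hs, hsp, a, ha⟩⟩

namespace LocalTrivialization

variable {L : BundleLift P} {T : TorsorGerbe (circleSystem P)} (D : LocalTrivialization L T)

theorem eq_res_a {x x' : T.U} {O : Opens X} (h : O ≤ D.V x) (h' : O ≤ D.V x')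
    {c : (circleSystem P).obj (op O)}
    (hc : T.act O c (secRes T.sec h (D.t x)) = secRes T.sec h' (D.t x')) :
    c = Cech.res _ (le_inf h h') (D.a x x') := by
  have := congrArg (secRes T.sec (le_inf h h')) (D.act_a x x')
  rw [TorsorGerbe.secRes_act, secRes_secRes, secRes_secRes, ← hc] at this
  exact (T.act_injective this).symm

theorem hatAt_a_mul {x x' x'' : T.U} {p : P.carrier} (h : P.proj p ∈ D.V x)
    (h' : P.proj p ∈ D.V x') (h'' : P.proj p ∈ D.V x'') :
    hatAt p (D.a x x') * hatAt p (D.a x' x'') = hatAt p (D.a x x'') := by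
  let O := D.V x ⊓ D.V x' ⊓ D.V x''
  have hO : O ≤ D.V x := inf_le_left.trans inf_le_left
  have hO' : O ≤ D.V x' := inf_le_left.trans inf_le_right
  have hO'' : O ≤ D.V x'' := inf_le_right
  have hp : P.proj p ∈ O := ⟨⟨h, h'⟩, h''⟩
  have e1 := congrArg (secRes T.sec (le_inf hO hO')) (D.act_a x x')
  have e2 := congrArg (secRes T.sec (le_inf hO' hO'')) (D.act_a x' x'')
  rw [TorsorGerbe.secRes_act, secRes_secRes, secRes_secRes] at e1 e2
  rw [← e1, ← T.add_act] at e2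
  have e3 := congrArg (evalAt p) (D.eq_res_a hO hO'' e2)
  rw [map_add, evalAt_res _ _ hp, evalAt_res _ _ hp, evalAt_res _ _ hp] at e3
  rw [hatAt, hatAt, hatAt, ← E.inclHhat_toMul_add, ← e3, add_comm]

theorem toP_s_eq {x x' : T.U} {y : X} (h : y ∈ D.V x) (h' : y ∈ D.V x') :
    L.map.toFun (D.s x' ⟨y, h'⟩) = P.act (L.map.toFun (D.s x ⟨y, h⟩))
      (E.toH (L.bundle.div (D.s x ⟨y, h⟩) (D.s x' ⟨y, h'⟩))) := by
  rw [← L.map.map_act, PrincipalBundle.act_div (by rw [D.proj_s, D.proj_s])]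

theorem proj_toP_s {x : T.U} {y : X} (h : y ∈ D.V x) :
    P.proj (L.map.toFun (D.s x ⟨y, h⟩)) = y := by
  rw [L.map.proj_map, D.proj_s]

/-- The cocycle of a lift of `P`, twisted by the cocycle of a torsor. -/
def cocycle [IsDiffeologicalGroup Ghat] : LiftCocycle (P.restrict T.U le_top) where
  V := D.V
  mem := D.mem
  le x := T.le_of_sec _ (D.t x)
  s x y h := ⟨L.map.toFun (D.s x ⟨y, h⟩), by
    rw [D.proj_toP_s]; exact T.le_of_sec _ (D.t x) h⟩
  smooth_s x n q hq h := L.map.smooth.isPlot_comp ((D.smooth_s x).isPlot_comp (hq.subtypeMk h))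
  proj_s x y h := D.proj_toP_s h
  -- The transition function of `L` multiplied by that of the torsor; the new factor is
  -- circle-valued, so the image in `H_σ` is unchanged.
  k x x' y h h' := hatAt (L.map.toFun (D.s x ⟨y, h⟩)) (D.a x x') *
    L.bundle.div (D.s x ⟨y, h⟩) (D.s x' ⟨y, h'⟩)
  smooth_k x x' n q hq h h' := by
    have : IsDiffeologicalGroup E.Hhat := E.isDiffeologicalGroup_Hhat
    have hs := (D.smooth_s x).isPlot_comp (hq.subtypeMk h)
    have hs' := (D.smooth_s x').isPlot_comp (hq.subtypeMk h')
    refine IsPlot.mul (LiftingGerbe.Hom.isPlot_hatAt _ (L.map.smooth.isPlot_comp hs) fun t => ?_)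
      (PrincipalBundle.isPlot_div hs hs' fun t => by rw [D.proj_s, D.proj_s])
    rw [D.proj_toP_s]
    exact ⟨h t, h' t⟩
  s_eq x x' y h h' := Subtype.ext (by
    refine (D.toP_s_eq h h').trans (congrArg (P.act _) ?_)
    rw [map_mul, hatAt, E.toH_inclHhat, one_mul])
  cocycle x x' x'' y h h' h'' := by
    have e := D.hatAt_a_mul (x := x) (x' := x') (x'' := x'') (p := L.map.toFun (D.s x ⟨y, h⟩))
      (by rwa [D.proj_toP_s]) (by rwa [D.proj_toP_s]) (by rwa [D.proj_toP_s])
    have ed := PrincipalBundle.div_eq (P := L.bundle) (p := D.s x ⟨y, h⟩) (q := D.s x'' ⟨y, h''⟩)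
      (k := L.bundle.div (D.s x ⟨y, h⟩) (D.s x' ⟨y, h'⟩) *
        L.bundle.div (D.s x' ⟨y, h'⟩) (D.s x'' ⟨y, h''⟩))
      (by rw [L.bundle.act_mul, PrincipalBundle.act_div (by rw [D.proj_s, D.proj_s]),
        PrincipalBundle.act_div (by rw [D.proj_s, D.proj_s])])
    -- The second torsor factor is evaluated at the section of index `x'`. Moving it to that of
    -- index `x` conjugates it by the transition function of `L`, and the product splits into the
    -- two cocycles.
    rw [D.toP_s_eq h h', hatAt_act, ← e, ed]
    group

variable [IsDiffeologicalGroup Ghat] [IsDTopologyCompatible X]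

/-- The lift of a restriction of `P` defined by a torsor. -/
def lift : LiftingGerbe P := ⟨T.U, D.cocycle.liftingMap.bundleLift⟩

/-- The local sections of the lift defined by a torsor. -/
def point (x : T.U) (y : X) (h : y ∈ D.V x) : D.lift.carrier := D.cocycle.point x y h 1

theorem toP_point (x : T.U) (y : X) (h : y ∈ D.V x) :
    D.lift.toP (D.point x y h) = L.map.toFun (D.s x ⟨y, h⟩) := by
  refine (congrArg Subtype.val (D.cocycle.liftingMap_point x y h 1)).trans ?_
  rw [map_one, PrincipalBundle.act_one]
  rfl

theorem point_eq (x x' : T.U) (y : X) (h : y ∈ D.V x) (h' : y ∈ D.V x') :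
    D.point x' y h' = D.lift.lift.bundle.act (D.point x y h)
      (hatAt (L.map.toFun (D.s x ⟨y, h⟩)) (D.a x x') *
        L.bundle.div (D.s x ⟨y, h⟩) (D.s x' ⟨y, h'⟩)) :=
  D.cocycle.point_eq x x' y h h'

theorem exists_hom (x : T.U) : ∃ f : LiftingGerbe.ofLift L (D.V x) ⟶ D.lift,
    ∀ (q : L.bundle.carrier) (h : L.bundle.proj q ∈ D.V x),
      LiftingGerbe.Hom.toFun f ⟨q, h⟩ = D.lift.lift.bundle.act (D.point x (L.bundle.proj q) h)
        (L.bundle.div (D.s x ⟨L.bundle.proj q, h⟩) q) := by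
  refine ⟨LiftingGerbe.Hom.ofSections (Q := LiftingGerbe.ofLift L (D.V x)) (Q' := D.lift)
    (T.le_of_sec _ (D.t x))
    (fun y : D.V x => ⟨D.s x y, (congrArg (· ∈ D.V x) (D.proj_s x y)).mpr y.2⟩)
    (fun n q hq => (D.smooth_s x).isPlot_comp hq) (fun y => D.proj_s x y)
    (fun y => D.point x y.1 y.2) (fun n q hq => ?_) (fun y => D.toP_point x y.1 y.2),
    fun q h => ?_⟩
  · exact D.cocycle.isPlot_point x hq.subtypeVal (fun t => (q t).2) isPlot_const
  · have hd : L.bundle.act (D.s x ⟨L.bundle.proj q, h⟩)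
        (L.bundle.div (D.s x ⟨L.bundle.proj q, h⟩) q) = q :=
      PrincipalBundle.act_div (by rw [D.proj_s])
    exact congrArg (D.lift.lift.bundle.act _) (PrincipalBundle.div_eq
      (P := (LiftingGerbe.ofLift L (D.V x)).lift.bundle) (Subtype.ext hd))

/-- The morphism of index `x` carries the section `s x` of `L` to the section `point x` of the
twisted lift. In comparing two indices the quotients coming from `L` cancel, and only the transition
function of the torsor remains. -/
theorem exists_sameTransition (hE : E.HasLocalLifts X) :
    ∃ f : ∀ x, (LiftingGerbe.torsor hE L D.lift).sec.obj (op (D.V x)),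
      TorsorGerbe.SameTransition T (LiftingGerbe.torsor hE L D.lift) D.V D.t f := by
  choose f hf using D.exists_hom
  refine ⟨f, fun x x' O h h' c hc => LiftingGerbe.Hom.ext (funext fun q => ?_)⟩
  obtain ⟨q, hq⟩ := q
  have hq : L.bundle.proj q ∈ O := hq
  change D.lift.lift.bundle.act (LiftingGerbe.Hom.toFun (f x) ⟨q, h hq⟩)
    (hatAt (L.map.toFun q) c) = LiftingGerbe.Hom.toFun (f x') ⟨q, h' hq⟩
  have hp : P.proj (L.map.toFun q) ∈ O := by rwa [L.map.proj_map]
  have hc' : hatAt (L.map.toFun q) c = hatAt (L.map.toFun q) (D.a x x') := by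
    rw [hatAt, hatAt, D.eq_res_a h h' hc, evalAt_res _ _ hp]
  generalize hs : D.s x ⟨L.bundle.proj q, h hq⟩ = s
  generalize hs' : D.s x' ⟨L.bundle.proj q, h' hq⟩ = s'
  have hps : L.bundle.proj s = L.bundle.proj q := by rw [← hs, D.proj_s]
  have hps' : L.bundle.proj s' = L.bundle.proj q := by rw [← hs', D.proj_s]
  have hd : L.bundle.div s q = L.bundle.div s s' * L.bundle.div s' q := PrincipalBundle.div_eq (by
    rw [L.bundle.act_mul, PrincipalBundle.act_div (hps.trans hps'.symm),
      PrincipalBundle.act_div hps'])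
  have hL : L.map.toFun q = P.act (L.map.toFun s) (E.toH (L.bundle.div s q)) := by
    rw [← L.map.map_act, PrincipalBundle.act_div hps]
  rw [hc', hf, hf, D.point_eq x x' _ (h hq) (h' hq), hs, hs', ← PrincipalBundle.act_mul,
    ← PrincipalBundle.act_mul, hL, hatAt_act, mul_assoc, mul_inv_cancel_left, hd, mul_assoc]

end LocalTrivialization

namespace LiftingGerbe

variable [IsDiffeologicalGroup Ghat] [IsDTopologyCompatible X]

instance (hE : E.HasLocalLifts X) (L : BundleLift P) : (torsorFunctor hE L).EssSurj where
  mem_essImage T := by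
    obtain ⟨D⟩ := exists_localTrivialization L T
    obtain ⟨f, hf⟩ := D.exists_sameTransition hE
    obtain ⟨e⟩ := hf.nonempty_iso (fun x hx => Opens.mem_iSup.2 ⟨⟨x, hx⟩, D.mem ⟨x, hx⟩⟩) rfl
    exact ⟨D.lift, ⟨e.symm⟩⟩

omit [IsDiffeologicalGroup Ghat] [IsDTopologyCompatible X] in
theorem Hom.comp_eq_twist {Q Q' : LiftingGerbe P} {a : (circleSystem P).obj (op Q.U)}
    {f : Q ⟶ Q} (hf : Q.IsBandAutomorphism a f) (g : Q' ⟶ Q) :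
    g ≫ f = Hom.twist (Cech.res _ (Hom.le g) a) g := Hom.ext (funext fun q => by
  change Hom.toFun f (Hom.toFun g q) =
    Q.lift.bundle.act (Hom.toFun g q) (hatAt (Q'.toP q) (Cech.res _ (Hom.le g) a))
  rw [hf, circleEval_eq, Hom.toP_comp g, hatAt, evalAt_res _ _ (Q'.proj_toP q)])

theorem isTrivial_of_bundleLift (hE : E.HasLocalLifts X) (L : BundleLift P) :
    LiftingGerbeIsTrivial P :=
  ⟨torsorFunctor hE L, {}, fun _ => rfl, fun _ _ _ hf V _ t =>
    Hom.comp_eq_twist (Q' := ofLift L V) hf t⟩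

end LiftingGerbe

end Gerbe

section Gerbe

variable {X : Type u} [TopologicalSpace X] [DiffeologicalSpace X]
  {G Ghat : Type u} [Group G] [DiffeologicalSpace G] [Group Ghat] [DiffeologicalSpace Ghat]
  {E : TwistedCentralExtension G Ghat} {P : PrincipalBundle E.H (⊤ : Opens X)}

/-! ### The trivial torsor -/

section TrivialTorsor

variable {T : Type} [AddCommGroup T] [DiffeologicalSpace T] [IsDiffeologicalAddGroup T]
  {ρ : Z2 → T →+ T} [IsDTopologyCompatible X]

theorem isSheaf_localSystem : Presheaf.IsSheaf (Opens.grothendieckTopology X)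
    (localSystem P ρ ⋙ forget AddCommGrpCat.{u}) := by
  refine isSheaf_of_gluing _ fun ι U s hs => ?_
  let s' : ∀ i, (localSystem P ρ).obj (op (U i)) := s
  have hs' : ∀ i j (p : P.carrier), P.proj p ∈ U i → P.proj p ∈ U j →
      evalAt p (s' i) = evalAt p (s' j) := fun i j p hi hj => by
    rw [evalAt_of_mem _ hi, evalAt_of_mem _ hj]
    exact congrFun (congrArg Subtype.val (hs i j)) ⟨p, hi, hj⟩
  have hchoice : ∀ p : P.carrier, ∃ c : T, ∀ i, P.proj p ∈ U i → evalAt p (s' i) = c := fun p => by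
    by_cases h : ∃ i, P.proj p ∈ U i
    · obtain ⟨i, hi⟩ := h
      exact ⟨evalAt p (s' i), fun j hj => hs' j i p hj hi⟩
    · exact ⟨0, fun i hi => absurd ⟨i, hi⟩ h⟩
  choose c hc using hchoice
  let t : (localSystem P ρ).obj (op (iSup U)) := sectionMk c
    (fun n p hp hpU => by
      refine isPlot_of_opens (PrincipalBundle.isPlot_proj hp) fun x => ?_
      obtain ⟨i, hi⟩ := Opens.mem_iSup.1 (hpU x)
      refine ⟨U i, hi, fun m g hgU hg => ?_⟩
      exact (congrArg IsPlot (funext fun y => hc _ i (hgU y))).mp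
        (isPlot_evalAt (s' i) (hp.comp_plot hg) hgU))
    (fun p k hp => by
      obtain ⟨i, hi⟩ := Opens.mem_iSup.1 hp
      rw [← hc p i hi, ← hc _ i (by rwa [P.proj_act]), evalAt_act])
  refine ⟨t, fun i => ?_, fun t' ht' => ?_⟩
  · refine section_ext (f := Cech.res _ (le_iSup U i) t) (g := s' i) fun p hp => ?_
    rw [evalAt_res _ _ hp, evalAt_sectionMk (Opens.mem_iSup.2 ⟨i, hp⟩), hc p i hp]
  · refine section_ext (f := (show (localSystem P ρ).obj (op (iSup U)) from t')) (g := t)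
      fun p hp => ?_
    obtain ⟨i, hi⟩ := Opens.mem_iSup.1 hp
    rw [evalAt_sectionMk hp, ← hc p i hi, ← evalAt_res (le_iSup U i) _ hi]
    exact congrArg (evalAt p) (ht' i)

/-- The trivial torsor of a local system. -/
def trivialTorsor (P : PrincipalBundle E.H (⊤ : Opens X)) (ρ : Z2 → T →+ T) :
    TorsorGerbe (localSystem P ρ) where
  U := ⊤
  sec := localSystem P ρ ⋙ forget AddCommGrpCat.{u}
  isSheaf := isSheaf_localSystem
  le_of_sec _ _ := le_top
  act V a t := (a + t : (localSystem P ρ).obj (op V))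
  zero_act V t := zero_add (t : (localSystem P ρ).obj (op V))
  add_act V a b t := add_assoc a b (t : (localSystem P ρ).obj (op V))
  res_act {V _} h a t := map_add (Cech.res _ h) a (t : (localSystem P ρ).obj (op V))
  simply_transitive V t t' :=
    ⟨(show (localSystem P ρ).obj (op V) from t') - (show (localSystem P ρ).obj (op V) from t),
      sub_add_cancel _ _, fun _ h => eq_sub_of_add_eq h⟩
  locally_nonempty _ _ := ⟨⊤, trivial, ⟨(0 : (localSystem P ρ).obj (op ⊤))⟩⟩

end TrivialTorsor

/-- The lift of `P` defined by an object of the lifting gerbe over `X`. -/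
theorem LiftingGerbe.nonempty_bundleLift [IsDTopologyCompatible X] (Q : LiftingGerbe P)
    (hQ : Q.U = ⊤) : Nonempty (BundleLift P) := by
  obtain ⟨U, L⟩ := Q
  obtain rfl : U = ⊤ := hQ
  exact ⟨LiftingMap.bundleLift (Q := L.bundle)
    { toFun := fun q => (L.map.toFun q).1
      smooth := fun n q hq => (L.map.smooth.isPlot_comp hq).subtypeVal
      proj_map := fun q => L.map.proj_map q
      map_act := fun q k => congrArg Subtype.val (L.map.map_act q k) }⟩

/-- The trivial torsor lives over all of `X`, and an object of the lifting gerbe over `X` is a lift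
of `P`; so a preimage of that torsor is what is wanted. -/
theorem nonempty_bundleLift_of_isTrivial [IsDTopologyCompatible X] (h : LiftingGerbeIsTrivial P) :
    Nonempty (BundleLift P) := by
  obtain ⟨F, hF, hU, -⟩ := h
  let T : TorsorGerbe (circleSystem P) := trivialTorsor P _
  refine (F.objPreimage T).nonempty_bundleLift (top_unique ?_)
  -- Morphisms of torsors go over inclusions of open sets, so the isomorphism with the trivial
  -- torsor forces the preimage to lie over `X`.
  rw [← hU]
  exact TorsorGerbe.Hom.le (F.objObjPreimageIso T).inv

end Gerbe

end

/-! ### The connecting isomorphism, the obstruction class and the equivalences -/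

theorem mainTheorem8 {X G Ghat : Type u}
    [TopologicalSpace X] [DiffeologicalSpace X] [IsDTopologyCompatible X]
    [Group G] [DiffeologicalSpace G] [IsDiffeologicalGroup G]
    [Group Ghat] [DiffeologicalSpace Ghat] [IsDiffeologicalGroup Ghat]
    (hX : HasSmoothPartitionsOfUnity X)
    (E : TwistedCentralExtension G Ghat) (hE : E.HasLocalLifts X)
    (P : PrincipalBundle E.H (⊤ : Opens X)) :
    -- the connecting map of the twisted exponential sequence is an isomorphism `Δ`,
    -- and all choices of a cover, sections and lifts give one class `c = [a]`
    ∃ (Δ : Cech.H (circleSystem P) 2 ≃+ Cech.H (intSystem P) 3) (c : Cech.H (circleSystem P) 2),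
      (∀ x y, Δ x = y ↔ IsConnecting P x y) ∧
      Nonempty (LiftingDatum P) ∧ (∀ D : LiftingDatum P, D.Represents c) ∧
      -- `DD_α(P) = Δ [a]`
      [Δ c = 0, c = 0, LiftingGerbeIsTrivial P, Nonempty (BundleLift P)].TFAE := by
  obtain ⟨Δ, hΔ⟩ := exists_connecting_equiv hX P
  obtain ⟨𝒰, ⟨L⟩⟩ := exists_liftSystem hX hE P
  -- The class is taken from one system of local lifts; independence of choices identifies it with
  -- the class of every lifting datum, and of every lift in the implication from 4 to 2.
  refine ⟨Δ, L.obstruction, hΔ, ⟨L.toDatum⟩, fun D => ?_, ?_⟩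
  · rw [← L.obstruction_eq hE D.toSystem]
    exact D.represents_obstruction
  · tfae_have 1 ↔ 2 := map_eq_zero_iff Δ Δ.injective
    tfae_have 2 → 4 := L.exists_bundleLift
    tfae_have 4 → 2 := fun ⟨Q⟩ => by
      obtain ⟨𝒱, L', h⟩ := exists_liftSystem_of_bundleLift Q
      rw [L'.obstruction_eq hE L, h]
    tfae_have 4 → 3 := fun ⟨Q⟩ => LiftingGerbe.isTrivial_of_bundleLift hE Q
    tfae_have 3 → 4 := nonempty_bundleLift_of_isTrivial
    tfae_finish
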